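/- For $\alpha\in\mathbb R^d$ let $T_\alpha f=f(\cdot-\alpha)$, and for an invertible real $d\times d$ matrix $A$ let $D_Af=|\det A|^{1/2}f(A\,\cdot)$ and $\widetilde D_Af=|\det A|\,f(A\,\cdot)$, acting on $L^2(\mathbb R^d)$; let $\hat f(\xi)=\int f(x)e^{-2\pi i x\cdot\xi}\,dx$, extended to $L^2(\mathbb R^d)$, and let $A^*$ be the transpose of $A$. For a finite family $\Psi=(\psi_1,\dots,\psi_r)$ in $L^2(\mathbb R^d)$ the affine system is the family $\mathcal U_A(\Psi)=(D_A^nT_z\psi_i)_{n\in\mathbb Z,\,z\in\mathbb Z^d,\,1\le i\le r}$, and the quasi-affine system $\mathcal U^q_A(\Psi)$ is the family with the same index set whose members are $D_A^nT_z\psi_i$ for $n\ge 0$ and $T_z\widetilde D_A^n\psi_i$ for $n<0$. A family $(x_j)$ in a Hilbert space is Bessel if $\sum_j|\langle v,x_j\rangle|^2\le M\|v\|^2$ for all $v$ and some constant $M$; for two Bessel families with the same index set the mixed Gramian is the bounded operator $\Theta_Y^*\Theta_X v=\sum_j\langle v,x_j\rangle y_j$. Theorem. Let $A$ be an integer matrix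 all of whose eigenvalues have modulus greater than $1$, and let $\Psi=(\psi_1,\dots,\psi_r)$, $\Phi=(\phi_1,\dots,\phi_r)$ be finite families in $L^2(\mathbb R^d)$ such that $\mathcal U_A(\Psi)$ and $\mathcal U_A(\Phi)$ are Bessel. Then $\mathcal U^q_A(\Psi)$ and $\mathcal U^q_A(\Phi)$ are Bessel as well; the series over $j$ in condition 6 (for every $q\in\mathbb Z^d$ and every $i$) and in the formula for $s$ (for every $i$) converge absolutely for almost every $\xi$. Write $\theta=\theta_\Phi^*\theta_\Psi=\sum\langle\,\cdot\,,D_A^nT_z\psi_i\rangle D_A^nT_z\phi_i$ for the mixed Gramian of the affine systems, $\theta^q=\theta_\Phi^{q*}\theta^q_\Psi$ for the corresponding one of the quasi-affine systems, and $$s(\xi)=\sum_{i=1}^r\sum_{j\in\mathbb Z}\overline{\hat\psi_i(A^{*j}\xi)}\,\hat\phi_i(A^{*j}\xi).$$ The following are equivalent: 1. $\theta$ commutes with $T_z$ for all $z\in\mathbb Z^d$; 2. $\theta^q$ commutes with $D_A$; 3. $\theta$ commutes with $T_\beta$ for all $\beta\in\mathbb R^d$; 4. $\theta^q$ commutes with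 $T_\beta$ for all $\beta\in\mathbb R^d$; 5. $\theta=\theta^q$; 6. for every $q\in\mathbb Z^d\setminus A^*\mathbb Z^d$, $\displaystyle\sum_{i=1}^r\sum_{j=0}^\infty\overline{\hat\phi_i(A^{*j}\xi)}\,\hat\psi_i(A^{*j}(\xi+q))=0$ for a.e. $\xi$; 7. $\theta$ is the Fourier multiplier with symbol $s$, i.e. $s\in L^\infty(\mathbb R^d)$ and $\widehat{\theta f}(\xi)=s(\xi)\hat f(\xi)$ a.e. for all $f\in L^2(\mathbb R^d)$; 8. $\theta^q$ is the Fourier multiplier with the same symbol $s$, in the same sense. -/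

import Mathlib

open MeasureTheory
open scoped ENNReal FourierTransform InnerProductSpace ComplexConjugate

noncomputable section

/-! ### Bessel sequences and mixed Gramians in a Hilbert space -/

section Bessel

variable {H : Type*} [NormedAddCommGroup H] [InnerProductSpace ℂ H] {J : Type*}

/-- A family `x` is a Bessel sequence if `∑ j, |⟨v, x j⟩|² ≤ M ‖v‖²` for some constant `M`. -/
def IsBesselSeq (x : J → H) : Prop :=
  ∃ M : ℝ, ∀ v : H, Summable (fun j => ‖⟪x j, v⟫_ℂ‖ ^ 2) ∧ ∑' j, ‖⟪x j, v⟫_ℂ‖ ^ 2 ≤ M * ‖v‖ ^ 2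

theorem IsBesselSeq.memℓp {x : J → H} (hx : IsBesselSeq x) (v : H) :
    Memℓp (fun j => ⟪x j, v⟫_ℂ) 2 := by
  obtain ⟨M, hM⟩ := hx
  refine memℓp_gen ?_
  simpa using (hM v).1

/-- The analysis operator `v ↦ (⟨v, x j⟩)_j` (Mathlib's inner product is linear in its second
argument). -/
def analysisOp (x : J → H) (hx : IsBesselSeq x) : H →L[ℂ] lp (fun _ : J => ℂ) 2 :=
  LinearMap.mkContinuousOfExistsBound
    { toFun := fun v => ⟨fun j => ⟪x j, v⟫_ℂ, hx.memℓp v⟩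
      map_add' := fun v w => by
        ext j
        exact inner_add_right (x j) v w
      map_smul' := fun c v => by
        ext j
        exact inner_smul_right (x j) v c }
    (by
      obtain ⟨M, hM⟩ := hx
      refine ⟨Real.sqrt M, fun v => ?_⟩
      have h0 : 0 ≤ M * ‖v‖ ^ 2 := le_trans (tsum_nonneg fun j => sq_nonneg _) (hM v).2
      refine lp.norm_le_of_tsum_le (by norm_num) (by positivity) ?_
      rcases eq_or_ne v 0 with rfl | hv
      · simp
      · have hM0 : 0 ≤ M := by
          by_contra hneg
          have : 0 < ‖v‖ ^ 2 := by positivity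
          nlinarith
        have := (hM v).2
        simp only [ENNReal.toReal_ofNat, Real.rpow_two]
        rw [mul_pow, Real.sq_sqrt hM0]
        exact this)

@[simp] theorem analysisOp_apply (x : J → H) (hx : IsBesselSeq x) (v : H) (j : J) :
    analysisOp x hx v j = ⟪x j, v⟫_ℂ := rfl

/-- The synthesis operator, the adjoint of the analysis operator. -/
def synthesisOp [CompleteSpace H] (x : J → H) (hx : IsBesselSeq x) :
    lp (fun _ : J => ℂ) 2 →L[ℂ] H :=
  (analysisOp x hx).adjoint

/-- The synthesis operator is `c ↦ ∑ j, c j • x j`. -/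
theorem hasSum_synthesisOp [CompleteSpace H] (x : J → H) (hx : IsBesselSeq x)
    (c : lp (fun _ : J => ℂ) 2) : HasSum (fun j => c j • x j) (synthesisOp x hx c) := by
  classical
  have key : ∀ (j : J) (a : ℂ), synthesisOp x hx (lp.single 2 j a) = a • x j := by
    intro j a
    refine ext_inner_right ℂ fun v => ?_
    rw [synthesisOp, ContinuousLinearMap.adjoint_inner_left, lp.inner_single_left,
      analysisOp_apply, inner_smul_left, RCLike.inner_apply, mul_comm]
  have h := (lp.hasSum_single (p := 2) (by norm_num) c).mapL (synthesisOp x hx)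
  simpa only [key] using h

/-- The mixed Gramian `Θ_y^* Θ_x`, that is, `v ↦ ∑ j, ⟨v, x j⟩ y j`. -/
def mixedGramian [CompleteSpace H] {x y : J → H} (hx : IsBesselSeq x) (hy : IsBesselSeq y) :
    H →L[ℂ] H :=
  synthesisOp y hy ∘L analysisOp x hx

theorem hasSum_mixedGramian [CompleteSpace H] {x y : J → H} (hx : IsBesselSeq x)
    (hy : IsBesselSeq y) (v : H) :
    HasSum (fun j => ⟪x j, v⟫_ℂ • y j) (mixedGramian hx hy v) :=
  hasSum_synthesisOp y hy (analysisOp x hx v)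

end Bessel

/-! ### Translations and dilations on `L²(ℝᵈ)` -/

section Euclid

variable {d : ℕ}

/-- `ℝᵈ` with its Euclidean structure. -/
abbrev Rd (d : ℕ) : Type := EuclideanSpace ℝ (Fin d)

/-- `L²(ℝᵈ)`, complex valued, with respect to Lebesgue measure. -/
abbrev L2 (d : ℕ) : Type := Lp (α := Rd d) ℂ 2 volume

/-- The point of `ℤᵈ` with the given integer coordinates, as a vector of `ℝᵈ`. -/
def intVec (k : Fin d → ℤ) : Rd d := WithLp.toLp 2 fun i => (k i : ℝ)

/-- The linear action of a square matrix on `ℝᵈ`. -/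
def matAct (M : Matrix (Fin d) (Fin d) ℝ) : Rd d →ₗ[ℝ] Rd d := Matrix.toEuclideanLin M

/-- The translation `T_α f = f(· - α)`. -/
def translation (α : Rd d) : L2 d →L[ℂ] L2 d :=
  (Lp.compMeasurePreservingₗᵢ ℂ (fun x : Rd d => x - α)
    (measurePreserving_sub_right volume α)).toContinuousLinearMap

theorem translation_ae (α : Rd d) (f : L2 d) : translation α f =ᵐ[volume] fun x => f (x - α) :=
  Lp.coeFn_compMeasurePreserving f (measurePreserving_sub_right volume α)

theorem det_matAct (M : Matrix (Fin d) (Fin d) ℝ) : LinearMap.det (matAct M) = M.det := by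
  rw [matAct, Matrix.toEuclideanLin_eq_toLin_orthonormal, LinearMap.det_toLin]

theorem gl_det_ne_zero (A : GL (Fin d) ℝ) : A.val.det ≠ 0 :=
  ((Matrix.isUnit_iff_isUnit_det _).1 A.isUnit).ne_zero

theorem map_matAct (A : GL (Fin d) ℝ) :
    Measure.map (matAct A.val) (volume : Measure (Rd d))
      = ENNReal.ofReal |A.val.det⁻¹| • volume := by
  have h := Measure.map_linearMap_addHaar_eq_smul_addHaar (volume : Measure (Rd d))
    (f := matAct A.val) (by rw [det_matAct]; exact gl_det_ne_zero A)
  rwa [det_matAct] at h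

theorem measurable_matAct (M : Matrix (Fin d) (Fin d) ℝ) : Measurable (matAct M) :=
  (LinearMap.continuous_of_finiteDimensional _).measurable

theorem quasiMeasurePreserving_matAct (A : GL (Fin d) ℝ) :
    Measure.QuasiMeasurePreserving (matAct A.val) (volume : Measure (Rd d)) volume := by
  refine ⟨measurable_matAct _, ?_⟩
  rw [map_matAct]
  exact Measure.smul_absolutelyContinuous

theorem memLp_comp_matAct (A : GL (Fin d) ℝ) (f : L2 d) :
    MemLp (fun x => f (matAct A.val x)) 2 volume := by
  refine MemLp.comp_of_map (f := matAct A.val) ?_ (measurable_matAct _).aemeasurable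
  rw [map_matAct]
  exact (Lp.memLp f).smul_measure ENNReal.ofReal_ne_top

theorem norm_comp_matAct (A : GL (Fin d) ℝ) (f : L2 d) :
    ‖(memLp_comp_matAct A f).toLp‖ = (ENNReal.ofReal |A.val.det⁻¹|).toReal ^ (1 / 2 : ℝ) * ‖f‖ := by
  have h : eLpNorm (fun x => f (matAct A.val x)) 2 volume
      = eLpNorm f 2 (Measure.map (matAct A.val) (volume : Measure (Rd d))) := by
    refine (eLpNorm_map_measure ?_ (measurable_matAct _).aemeasurable).symm
    rw [map_matAct]
    exact (Lp.aestronglyMeasurable f).mono_ac Measure.smul_absolutelyContinuous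
  rw [Lp.norm_toLp, h, map_matAct, eLpNorm_smul_measure_of_ne_top (by norm_num), Lp.norm_def,
    smul_eq_mul, ENNReal.toReal_mul, ENNReal.toReal_rpow]
  norm_num

/-- Composition `f ↦ f(A ·)` with an invertible matrix. -/
def compCLM (A : GL (Fin d) ℝ) : L2 d →L[ℂ] L2 d :=
  LinearMap.mkContinuousOfExistsBound
    { toFun := fun f => (memLp_comp_matAct A f).toLp
      map_add' := fun f g => by
        rw [← MemLp.toLp_add]
        exact MemLp.toLp_congr _ _
          ((quasiMeasurePreserving_matAct A).ae_eq_comp (Lp.coeFn_add f g))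
      map_smul' := fun c f => by
        rw [RingHom.id_apply, ← MemLp.toLp_const_smul]
        exact MemLp.toLp_congr _ _
          ((quasiMeasurePreserving_matAct A).ae_eq_comp (Lp.coeFn_smul c f)) }
    ⟨_, fun f => (norm_comp_matAct A f).le⟩

theorem compCLM_ae (A : GL (Fin d) ℝ) (f : L2 d) :
    compCLM A f =ᵐ[volume] fun x => f (matAct A.val x) :=
  MemLp.coeFn_toLp (memLp_comp_matAct A f)

theorem compCLM_compCLM_of_mul_eq_one (A B : GL (Fin d) ℝ) (h : A * B = 1) (f : L2 d) :
    compCLM B (compCLM A f) = f := by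
  have hAB : ∀ x, matAct A.val (matAct B.val x) = x := fun x => by
    have h1 : A.val * B.val = 1 := by rw [← Units.val_mul, h, Units.val_one]
    simp [matAct, Matrix.toLpLin_apply, Matrix.mulVec_mulVec, h1]
  refine Lp.ext ?_
  filter_upwards [compCLM_ae B (compCLM A f),
    (quasiMeasurePreserving_matAct B).ae_eq_comp (compCLM_ae A f)] with x h1 h2
  rw [h1]
  simpa [hAB] using h2

/-- The bounded invertible operator `f ↦ c f(A ·)`, for an invertible matrix `A` and `c ≠ 0`. -/
def scaledComp (c : ℝ) (hc : c ≠ 0) (A : GL (Fin d) ℝ) : L2 d ≃L[ℂ] L2 d :=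
  (ContinuousLinearEquiv.equivOfInverse (compCLM A) (compCLM A⁻¹)
      (compCLM_compCLM_of_mul_eq_one A A⁻¹ (mul_inv_cancel A))
      (compCLM_compCLM_of_mul_eq_one A⁻¹ A (inv_mul_cancel A))).trans
    (ContinuousLinearEquiv.smulLeft (Units.mk0 (c : ℂ) (Complex.ofReal_ne_zero.2 hc)))

theorem scaledComp_ae (c : ℝ) (hc : c ≠ 0) (A : GL (Fin d) ℝ) (f : L2 d) :
    scaledComp c hc A f =ᵐ[volume] fun x => (c : ℂ) * f (matAct A.val x) := by
  filter_upwards [Lp.coeFn_smul (c : ℂ) (compCLM A f), compCLM_ae A f] with x h1 h2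
  rw [← h2]
  exact h1

theorem abs_det_ne_zero (A : GL (Fin d) ℝ) : |A.val.det| ≠ 0 := abs_ne_zero.2 (gl_det_ne_zero A)

/-- The dilation `D_A f = |det A|^{1/2} f(A ·)`. -/
def dilation (A : GL (Fin d) ℝ) : L2 d ≃L[ℂ] L2 d :=
  scaledComp (Real.sqrt |A.val.det|)
    (Real.sqrt_ne_zero'.2 (abs_pos.2 (gl_det_ne_zero A))) A

/-- The renormalized dilation `f ↦ |det A| f(A ·)`. -/
def dilationR (A : GL (Fin d) ℝ) : L2 d ≃L[ℂ] L2 d :=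
  scaledComp |A.val.det| (abs_det_ne_zero A) A

/-- All (complex) eigenvalues of `A` have modulus strictly greater than `1`. -/
def IsExpansive (A : GL (Fin d) ℝ) : Prop :=
  ∀ μ : ℂ, Module.End.HasEigenvalue (Matrix.toLin' (A.val.map (fun t : ℝ => (t : ℂ)))) μ → 1 < ‖μ‖

/-- All entries of `A` are integers. -/
def IsIntegralMatrix (A : GL (Fin d) ℝ) : Prop :=
  ∀ i j, ∃ n : ℤ, A.val i j = (n : ℝ)

variable {r : ℕ}

/-- The affine system `D_A^n T_z ψ_i`, with `n ∈ ℤ`, `z ∈ ℤᵈ`, `1 ≤ i ≤ r`. -/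
def affineSystem (A : GL (Fin d) ℝ) (Ψ : Fin r → L2 d) : ℤ × (Fin d → ℤ) × Fin r → L2 d :=
  fun p => (dilation A ^ p.1) (translation (intVec p.2.1) (Ψ p.2.2))

/-- The quasi-affine system: `D_A^n T_z ψ_i` for `n ≥ 0`, and `T_z (dilationR A)^n ψ_i`
for `n < 0`. -/
def quasiAffineSystem (A : GL (Fin d) ℝ) (Ψ : Fin r → L2 d) :
    ℤ × (Fin d → ℤ) × Fin r → L2 d :=
  fun p =>
    if 0 ≤ p.1 then (dilation A ^ p.1) (translation (intVec p.2.1) (Ψ p.2.2))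
    else translation (intVec p.2.1) ((dilationR A ^ p.1) (Ψ p.2.2))

/-- The vector `A^{*j} ξ`, where `A^*` is the transpose of `A`. -/
def adjPow (A : GL (Fin d) ℝ) (j : ℤ) (ξ : Rd d) : Rd d := matAct ((A ^ j).val.transpose) ξ

/-- The lattice `A^* ℤᵈ`. -/
def dualLattice (A : GL (Fin d) ℝ) : Set (Rd d) :=
  Set.range fun k : Fin d → ℤ => adjPow A 1 (intVec k)

/-- The bounded operator `S` is a Fourier multiplier with the (essentially bounded) symbol `s`:
`(S f)^ = s f^` almost everywhere, for every `f` in `L²(ℝᵈ)`. -/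
def IsFourierMultiplier (S : L2 d →L[ℂ] L2 d) (s : Rd d → ℂ) : Prop :=
  MemLp s ∞ volume ∧
    ∀ f : L2 d, ⇑(𝓕 (S f) : L2 d) =ᵐ[volume] fun ξ => s ξ * (𝓕 f : L2 d) ξ

/-- The term `conj (f^(A^{*j} ξ)) g^(A^{*j} η)`. -/
def crossTerm (A : GL (Fin d) ℝ) (f g : L2 d) (j : ℤ) (ξ η : Rd d) : ℂ :=
  conj ((𝓕 f : L2 d) (adjPow A j ξ)) * (𝓕 g : L2 d) (adjPow A j η)

end Euclid

end

noncomputable section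

/-! ### Algebra of matrices, dilations and translations on L². -/

section Operators

variable {d : ℕ}

/-! An operator S is tested through ⟨g, S f⟩ with f, g band-limited, and everything is read on the
Fourier side. Parseval's identity for periodizations (`hasSum_periodization`) turns each level n of
a system into a sum of integrals `shiftPairing` over frequency shifts. The shifts run through all of
ℤᵈ at an oversampled level n < 0, and through A*ⁿℤᵈ at a level n ≥ 0. Sorting by the shift k instead
of the level writes ⟨g, θ^q f⟩ as a finite sum of components `shiftComponent`
(`inner_quasiGramian`).

Two symmetries drive the proof. Translating f and g by β multiplies the component k by exp(-2πi
β·k), so the components are the Fourier coefficients of the periodic function β ↦ ⟨T_β g, θ^q T_β f⟩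
(`integral_inner_quasiGramian`). Dilating f and g by D_A^N carries the component k to the component
A*^N k (`shiftComponent_dilation`). Since A is expansive, a nonzero integer vector can be divided by
A* only finitely often, so every component with k ≠ 0 reduces to one with q ∉ A*ℤᵈ. The latter has,
up to conjugation, the sum in condition 6 as its symbol, while the component 0 has the symbol s.
Hence 6 makes θ^q the multiplier s (`isFourierMultiplier_quasiGramian`), which commutes with
translations and with D_A.

The two Gramians differ only in the levels n < 0, and these lose all influence on functions T_β
D_A^N f, which concentrate at β as N grows (`tendsto_inner_sub_mixedGramian`). Now θ always commutes
with D_A. If θ^q does too, the form of θ - θ^q is unchanged by D_A^N and tends to 0, so it vanishes.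
If instead θ commutes with all translations, then the component of θ^q at q ≠ 0 equals, for every N,
a nonconstant Fourier coefficient in which only θ - θ^q contributes; it tends to 0, which gives 6.
Integer translations suffice for θ because the union of the lattices A^{-N}ℤᵈ is dense, and θ^q
always commutes with integer translations.

The Bessel property passes to the quasi-affine system by averaging over coset representatives of Aℤᵈ
(`quasi_bound`). Testing it on f with f^ an indicator bounds the Calderón sum of |ψ^(A*^j ξ)|²
(`ae_tsum_int_le`), which justifies every exchange of sum and integral. -/

theorem matAct_mul (M N : Matrix (Fin d) (Fin d) ℝ) (x : Rd d) :
    matAct (M * N) x = matAct M (matAct N x) := by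
  simp [matAct, Matrix.toLpLin_apply, Matrix.mulVec_mulVec]

@[simp] theorem matAct_one (x : Rd d) : matAct (1 : Matrix (Fin d) (Fin d) ℝ) x = x := by
  simp [matAct]

theorem inner_matAct_left (M : Matrix (Fin d) (Fin d) ℝ) (x y : Rd d) :
    ⟪matAct M x, y⟫_ℝ = ⟪x, matAct M.transpose y⟫_ℝ := by
  have := LinearMap.adjoint_inner_right (matAct M) x y
  rw [← this, matAct, ← Matrix.toEuclideanLin_conjTranspose_eq_adjoint,
    Matrix.conjTranspose_eq_transpose_of_trivial, matAct]

@[fun_prop] theorem continuous_matAct (M : Matrix (Fin d) (Fin d) ℝ) : Continuous (matAct M) :=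
  LinearMap.continuous_of_finiteDimensional _

theorem matAct_inv_matAct (A : GL (Fin d) ℝ) (x : Rd d) :
    matAct (A⁻¹).val (matAct A.val x) = x := by
  rw [← matAct_mul, ← Units.val_mul, inv_mul_cancel, Units.val_one, matAct_one]

theorem matAct_matAct_inv (A : GL (Fin d) ℝ) (x : Rd d) :
    matAct A.val (matAct (A⁻¹).val x) = x := by
  rw [← matAct_mul, ← Units.val_mul, mul_inv_cancel, Units.val_one, matAct_one]

theorem adjPow_zero (A : GL (Fin d) ℝ) (ξ : Rd d) : adjPow A 0 ξ = ξ := by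
  simp [adjPow]

theorem adjPow_adjPow (A : GL (Fin d) ℝ) (j k : ℤ) (ξ : Rd d) :
    adjPow A j (adjPow A k ξ) = adjPow A (j + k) ξ := by
  rw [adjPow, adjPow, ← matAct_mul, ← Matrix.transpose_mul, ← Units.val_mul, ← zpow_add, add_comm,
    adjPow]

theorem adjPow_add (A : GL (Fin d) ℝ) (j : ℤ) (ξ η : Rd d) :
    adjPow A j (ξ + η) = adjPow A j ξ + adjPow A j η := map_add _ _ _

theorem adjPow_injective (A : GL (Fin d) ℝ) (j : ℤ) : Function.Injective (adjPow A j) := by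
  intro x y h
  have := congrArg (adjPow A (-j)) h
  simpa [adjPow_adjPow, adjPow_zero] using this

@[fun_prop] theorem continuous_adjPow (A : GL (Fin d) ℝ) (j : ℤ) : Continuous (adjPow A j) :=
  continuous_matAct _

/-- The transposed matrix as an element of the general linear group. -/
def glTranspose (A : GL (Fin d) ℝ) : GL (Fin d) ℝ where
  val := A.val.transpose
  inv := (A⁻¹).val.transpose
  val_inv := by rw [← Matrix.transpose_mul, ← Units.val_mul, inv_mul_cancel, Units.val_one,
    Matrix.transpose_one]
  inv_val := by rw [← Matrix.transpose_mul, ← Units.val_mul, mul_inv_cancel, Units.val_one,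
    Matrix.transpose_one]

theorem quasiMeasurePreserving_adjPow (A : GL (Fin d) ℝ) (j : ℤ) :
    Measure.QuasiMeasurePreserving (adjPow A j) (volume : Measure (Rd d)) volume :=
  quasiMeasurePreserving_matAct (glTranspose (A ^ j))

/-- An invertible matrix as a homeomorphic linear automorphism. -/
def matActCLE (A : GL (Fin d) ℝ) : Rd d ≃L[ℝ] Rd d :=
  (LinearEquiv.ofLinearMap (matAct A.val) (matAct (A⁻¹).val)
    (LinearMap.ext (matAct_matAct_inv A)) (LinearMap.ext (matAct_inv_matAct A))).toContinuousLinearEquiv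

theorem measurableEmbedding_matAct (A : GL (Fin d) ℝ) : MeasurableEmbedding (matAct A.val) :=
  (matActCLE A).toHomeomorph.measurableEmbedding

theorem abs_det_pos (A : GL (Fin d) ℝ) : 0 < |A.val.det| := abs_pos.2 (gl_det_ne_zero A)

theorem integral_comp_matAct {E : Type*} [NormedAddCommGroup E] [NormedSpace ℝ E]
    (A : GL (Fin d) ℝ) (u : Rd d → E) :
    ∫ x, u (matAct A.val x) = |A.val.det|⁻¹ • ∫ x, u x := by
  rw [← (measurableEmbedding_matAct A).integral_map, map_matAct, integral_smul_measure,
    abs_inv, ENNReal.toReal_ofReal (by positivity)]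

theorem lintegral_comp_matAct (A : GL (Fin d) ℝ) (u : Rd d → ℝ≥0∞) :
    ∫⁻ x, u (matAct A.val x) = ENNReal.ofReal |A.val.det|⁻¹ * ∫⁻ x, u x := by
  rw [← (measurableEmbedding_matAct A).lintegral_map, map_matAct, lintegral_smul_measure,
    abs_inv, smul_eq_mul]

theorem integral_comp_adjPow {E : Type*} [NormedAddCommGroup E] [NormedSpace ℝ E]
    (A : GL (Fin d) ℝ) (j : ℤ) (u : Rd d → E) :
    ∫ x, u (adjPow A j x) = |(A ^ j).val.det|⁻¹ • ∫ x, u x := by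
  have := integral_comp_matAct (glTranspose (A ^ j)) u
  rwa [show (glTranspose (A ^ j)).val.det = (A ^ j).val.det from Matrix.det_transpose _] at this

theorem dilation_ae (A : GL (Fin d) ℝ) (f : L2 d) :
    dilation A f =ᵐ[volume] fun x => (Real.sqrt |A.val.det| : ℂ) * f (matAct A.val x) :=
  scaledComp_ae _ _ _ _

theorem dilationR_ae (A : GL (Fin d) ℝ) (f : L2 d) :
    dilationR A f =ᵐ[volume] fun x => ((|A.val.det| : ℝ) : ℂ) * f (matAct A.val x) :=
  scaledComp_ae _ _ _ _

theorem dilation_mul (A B : GL (Fin d) ℝ) : dilation (A * B) = dilation B * dilation A := by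
  refine ContinuousLinearEquiv.ext (funext fun f => Lp.ext ?_)
  filter_upwards [dilation_ae (A * B) f, dilation_ae B (dilation A f),
    (quasiMeasurePreserving_matAct B).ae_eq_comp (dilation_ae A f)] with x h1 h2 h3
  simp only [Function.comp] at h3
  refine h1.trans (Eq.trans ?_ h2.symm)
  rw [h3, Units.val_mul, Matrix.det_mul, abs_mul,
    Real.sqrt_mul (abs_nonneg _), matAct_mul]
  push_cast
  ring

theorem dilationR_mul (A B : GL (Fin d) ℝ) : dilationR (A * B) = dilationR B * dilationR A := by
  refine ContinuousLinearEquiv.ext (funext fun f => Lp.ext ?_)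
  filter_upwards [dilationR_ae (A * B) f, dilationR_ae B (dilationR A f),
    (quasiMeasurePreserving_matAct B).ae_eq_comp (dilationR_ae A f)] with x h1 h2 h3
  simp only [Function.comp] at h3
  refine h1.trans (Eq.trans ?_ h2.symm)
  rw [h3, Units.val_mul, Matrix.det_mul, abs_mul,
    matAct_mul]
  push_cast
  ring

/-- Dilation reverses products, so it is a homomorphism only into the opposite group; powers of a
single element do not see the difference. -/
theorem map_zpow_of_antihom {G K : Type*} [Group G] [Group K] (φ : G → K)
    (h : ∀ a b, φ (a * b) = φ b * φ a) (a : G) (n : ℤ) : φ a ^ n = φ (a ^ n) := by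
  have := map_zpow (MonoidHom.mk' (fun g => MulOpposite.op (φ g))
    (fun a b => by rw [h, MulOpposite.op_mul])) a n
  simp only [MonoidHom.mk'_apply] at this
  exact (MulOpposite.op_injective (by rw [this, MulOpposite.op_zpow])).symm

theorem dilation_zpow (A : GL (Fin d) ℝ) (n : ℤ) : dilation A ^ n = dilation (A ^ n) :=
  map_zpow_of_antihom dilation dilation_mul A n

theorem dilationR_zpow (A : GL (Fin d) ℝ) (n : ℤ) : dilationR A ^ n = dilationR (A ^ n) :=
  map_zpow_of_antihom dilationR dilationR_mul A n

theorem dilation_dilation (A B : GL (Fin d) ℝ) (f : L2 d) :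
    dilation A (dilation B f) = dilation (B * A) f := by
  rw [dilation_mul]; rfl

theorem dilation_one (f : L2 d) : dilation (1 : GL (Fin d) ℝ) f = f := by
  have := dilation_zpow (1 : GL (Fin d) ℝ) 0
  rw [zpow_zero, zpow_zero] at this
  rw [← this]; rfl

theorem dilationR_eq (A : GL (Fin d) ℝ) (f : L2 d) :
    dilationR A f = (Real.sqrt |A.val.det| : ℂ) • dilation A f := by
  refine Lp.ext ?_
  filter_upwards [dilationR_ae A f, dilation_ae A f,
    Lp.coeFn_smul (Real.sqrt |A.val.det| : ℂ) (dilation A f)] with x h1 h2 h3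
  rw [h1, h3, Pi.smul_apply, h2, smul_eq_mul, ← mul_assoc, ← Complex.ofReal_mul,
    Real.mul_self_sqrt (abs_nonneg _)]

theorem inner_dilation_dilation (A : GL (Fin d) ℝ) (f g : L2 d) :
    ⟪dilation A f, dilation A g⟫_ℂ = ⟪f, g⟫_ℂ := by
  rw [L2.inner_def, L2.inner_def]
  have h : ∫ x, ⟪dilation A f x, dilation A g x⟫_ℂ
      = ∫ x, (fun y => ((|A.val.det| : ℝ) : ℂ) * ⟪f y, g y⟫_ℂ) (matAct A.val x) := by
    refine integral_congr_ae ?_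
    filter_upwards [dilation_ae A f, dilation_ae A g] with x h1 h2
    rw [h1, h2]
    simp only [RCLike.inner_apply, map_mul, Complex.conj_ofReal]
    rw [← Real.mul_self_sqrt (abs_nonneg A.val.det)]
    push_cast
    rw [Real.mul_self_sqrt (abs_nonneg A.val.det)]
    ring
  rw [h, integral_comp_matAct A fun y => ((|A.val.det| : ℝ) : ℂ) * ⟪f y, g y⟫_ℂ, integral_const_mul, Complex.real_smul, ← mul_assoc,
    ← Complex.ofReal_mul, inv_mul_cancel₀ (abs_det_ne_zero A), Complex.ofReal_one, one_mul]

theorem norm_dilation (A : GL (Fin d) ℝ) (f : L2 d) : ‖dilation A f‖ = ‖f‖ := by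
  rw [@norm_eq_sqrt_re_inner ℂ, inner_dilation_dilation, ← @norm_eq_sqrt_re_inner ℂ]

theorem inner_dilation_left (A : GL (Fin d) ℝ) (f g : L2 d) :
    ⟪dilation A f, g⟫_ℂ = ⟪f, dilation A⁻¹ g⟫_ℂ := by
  rw [← inner_dilation_dilation A f, dilation_dilation, inv_mul_cancel, dilation_one]

theorem inner_dilation_right (A : GL (Fin d) ℝ) (f g : L2 d) :
    ⟪f, dilation A g⟫_ℂ = ⟪dilation A⁻¹ f, g⟫_ℂ := by
  rw [inner_dilation_left, inv_inv]

theorem norm_translation (α : Rd d) (f : L2 d) : ‖translation α f‖ = ‖f‖ :=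
  (Lp.compMeasurePreservingₗᵢ ℂ (fun x : Rd d => x - α)
    (measurePreserving_sub_right volume α)).norm_map f

theorem inner_translation_translation (α : Rd d) (f g : L2 d) :
    ⟪translation α f, translation α g⟫_ℂ = ⟪f, g⟫_ℂ :=
  (Lp.compMeasurePreservingₗᵢ ℂ (fun x : Rd d => x - α)
    (measurePreserving_sub_right volume α)).inner_map_map f g

theorem translation_translation (α β : Rd d) (f : L2 d) :
    translation α (translation β f) = translation (α + β) f := by
  refine Lp.ext ?_
  filter_upwards [translation_ae α (translation β f), translation_ae (α + β) f,
    (measurePreserving_sub_right volume α).quasiMeasurePreserving.ae_eq_comp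
      (translation_ae β f)] with x h1 h2 h3
  rw [h1, h2]
  simpa [sub_sub] using h3

theorem translation_zero (f : L2 d) : translation (0 : Rd d) f = f := by
  refine Lp.ext ?_
  filter_upwards [translation_ae 0 f] with x h1
  rw [h1, sub_zero]

theorem inner_translation_left (α : Rd d) (f g : L2 d) :
    ⟪translation α f, g⟫_ℂ = ⟪f, translation (-α) g⟫_ℂ := by
  rw [← inner_translation_translation α f, translation_translation, add_neg_cancel,
    translation_zero]

theorem dilation_translation (A : GL (Fin d) ℝ) (α : Rd d) (f : L2 d) :
    dilation A (translation α f) = translation (matAct (A⁻¹).val α) (dilation A f) := by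
  refine Lp.ext ?_
  filter_upwards [translation_ae (matAct (A⁻¹).val α) (dilation A f),
    dilation_ae A (translation α f),
    (quasiMeasurePreserving_matAct A).ae_eq_comp (translation_ae α f),
    (measurePreserving_sub_right volume (matAct (A⁻¹).val α)).quasiMeasurePreserving.ae_eq_comp
      (dilation_ae A f)] with x h1 h2 h3 h4
  simp only [Function.comp] at h3 h4
  rw [h1, h2, h3, h4, map_sub, matAct_matAct_inv]

theorem translation_dilation (A : GL (Fin d) ℝ) (α : Rd d) (f : L2 d) :
    translation α (dilation A f) = dilation A (translation (matAct A.val α) f) := by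
  rw [dilation_translation, matAct_inv_matAct]

theorem continuous_translation (f : L2 d) : Continuous fun α : Rd d => translation α f := by
  have hg : Continuous fun α : Rd d =>
      (⟨fun x => x - α, by fun_prop⟩ : C(Rd d, Rd d)) :=
    ContinuousMap.continuous_of_continuous_uncurry _
      (continuous_snd.sub continuous_fst)
  exact continuous_const.compMeasurePreservingLp hg
    (fun α => measurePreserving_sub_right volume α) (by norm_num)

end Operators

/-! ### The Fourier transform of translates and dilates. -/

section Fourier

variable {d : ℕ}

/-- The exponential `ξ ↦ exp (2 π i a · ξ)`. -/
def expo (a ξ : Rd d) : ℂ := (Real.fourierChar ⟪a, ξ⟫_ℝ : ℂ)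

@[simp] theorem norm_expo (a ξ : Rd d) : ‖expo a ξ‖ = 1 := Circle.norm_coe _

theorem expo_add_left (a b ξ : Rd d) : expo (a + b) ξ = expo a ξ * expo b ξ := by
  simp [expo, inner_add_left, AddChar.map_add_eq_mul]

theorem expo_comm (a ξ : Rd d) : expo a ξ = expo ξ a := by
  rw [expo, real_inner_comm, expo]

theorem expo_add_right (a ξ η : Rd d) : expo a (ξ + η) = expo a ξ * expo a η := by
  rw [expo_comm, expo_add_left, expo_comm ξ, expo_comm η]

@[simp] theorem expo_zero_left (ξ : Rd d) : expo 0 ξ = 1 := by simp [expo]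

theorem expo_neg_left (a ξ : Rd d) : expo (-a) ξ = conj (expo a ξ) := by
  rw [expo, inner_neg_left, AddChar.map_neg_eq_inv, Circle.coe_inv_eq_conj, expo]

theorem expo_neg_right (a ξ : Rd d) : expo a (-ξ) = conj (expo a ξ) := by
  rw [expo_comm, expo_neg_left, expo_comm]

@[fun_prop] theorem continuous_expo (a : Rd d) : Continuous (expo a) := by
  unfold expo
  fun_prop

theorem memLp_expo (a : Rd d) : MemLp (expo a) ∞ volume :=
  memLp_top_of_bound (by fun_prop) 1 (.of_forall fun ξ => (norm_expo a ξ).le)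

theorem expo_mul_conj (a ξ : Rd d) : expo a ξ * conj (expo a ξ) = 1 := by
  rw [← expo_neg_left, ← expo_add_left, add_neg_cancel, expo_zero_left]

/-- Multiplication by an essentially bounded function, as an operator on `L²`. -/
def mulOp (s : Rd d → ℂ) (hs : MemLp s ∞ volume) : L2 d →L[ℂ] L2 d :=
  (ContinuousLinearMap.mul ℂ ℂ).holderL volume ∞ 2 2 hs.toLp

theorem mulOp_ae (s : Rd d → ℂ) (hs : MemLp s ∞ volume) (f : L2 d) :
    mulOp s hs f =ᵐ[volume] fun ξ => s ξ * f ξ := by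
  filter_upwards [(ContinuousLinearMap.mul ℂ ℂ).coeFn_holder (r := 2) hs.toLp f,
    hs.coeFn_toLp] with x h1 h2
  rw [mulOp, ContinuousLinearMap.holderL_apply_apply, h1, h2, ContinuousLinearMap.mul_apply']

/-- The L² Fourier transform is an extension by continuity; identities for it are checked on
Schwartz functions, where it is an integral and a change of variables applies. -/
theorem schwartz_dense {p : L2 d → Prop} (hp : IsClosed {f | p f})
    (h : ∀ u : SchwartzMap (Rd d) ℂ, p (u.toLp 2)) (f : L2 d) : p f :=
  DenseRange.induction_on (p := p)
    (SchwartzMap.denseRange_toLpCLM (E := Rd d) (F := ℂ) (p := 2) (μ := volume)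
      ENNReal.ofNat_ne_top) f hp h

theorem continuous_fourier_L2 : Continuous fun f : L2 d => (𝓕 f : L2 d) :=
  (Lp.fourierTransformₗᵢ (Rd d) ℂ).continuous

theorem fourier_toLp_eq (u : SchwartzMap (Rd d) ℂ) :
    (𝓕 (u.toLp 2 : L2 d) : L2 d) =ᵐ[volume] 𝓕 (u : Rd d → ℂ) := by
  rw [SchwartzMap.toLp_fourier_eq]
  exact SchwartzMap.coeFn_toLp _ _ _

theorem fourier_translation (α : Rd d) (f : L2 d) :
    (𝓕 (translation α f) : L2 d) = mulOp (expo (-α)) (memLp_expo _) (𝓕 f : L2 d) := by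
  refine schwartz_dense (p := fun f => (𝓕 (translation α f) : L2 d)
    = mulOp (expo (-α)) (memLp_expo _) (𝓕 f : L2 d)) ?_ (fun u => ?_) f
  · exact isClosed_eq (continuous_fourier_L2.comp (translation α).continuous)
      ((mulOp _ _).continuous.comp continuous_fourier_L2)
  · have hg : (fun x : Rd d => x - α).HasTemperateGrowth := by
      fun_prop
    let v : SchwartzMap (Rd d) ℂ := SchwartzMap.compCLMOfAntilipschitz ℂ hg
      (Isometry.of_dist_eq fun x y => dist_sub_right x y α).antilipschitz u
    have hv : translation α (u.toLp 2) = v.toLp 2 := by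
      refine Lp.ext ?_
      filter_upwards [translation_ae α (u.toLp 2), v.coeFn_toLp 2,
        (measurePreserving_sub_right volume α).quasiMeasurePreserving.ae_eq_comp
          (u.coeFn_toLp 2)] with x h1 h2 h3
      rw [h1, h2]
      exact h3
    rw [hv]
    refine Lp.ext ?_
    filter_upwards [fourier_toLp_eq u, fourier_toLp_eq v,
      mulOp_ae (expo (-α)) (memLp_expo _) (𝓕 (u.toLp 2 : L2 d) : L2 d)] with ξ h1 h2 h3
    rw [h3, h2, h1, Real.fourier_eq, Real.fourier_eq, ← integral_const_mul,
      ← integral_add_right_eq_self _ α]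
    congr 1
    ext x
    have : ((Real.fourierChar (-⟪x + α, ξ⟫_ℝ) : Circle) : ℂ)
        = expo (-α) ξ * (Real.fourierChar (-⟪x, ξ⟫_ℝ) : ℂ) := by
      rw [expo, ← Circle.coe_mul, ← AddChar.map_add_eq_mul, inner_add_left, inner_neg_left, neg_add,
        add_comm]
    have hvx : v (x + α) = u x := by
      change u (x + α - α) = u x
      rw [add_sub_cancel_right]
    rw [Circle.smul_def, Circle.smul_def, this, smul_eq_mul, smul_eq_mul, mul_assoc, hvx]

theorem fourier_translation_ae (α : Rd d) (f : L2 d) :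
    (𝓕 (translation α f) : L2 d) =ᵐ[volume] fun ξ => expo (-α) ξ * (𝓕 f : L2 d) ξ := by
  rw [fourier_translation]
  exact mulOp_ae _ _ _

theorem fourier_compCLM (M : GL (Fin d) ℝ) (f : L2 d) :
    (𝓕 (compCLM M f) : L2 d)
      = ((|M.val.det|⁻¹ : ℝ) : ℂ) • compCLM (glTranspose M⁻¹) (𝓕 f : L2 d) := by
  refine schwartz_dense (p := fun f => (𝓕 (compCLM M f) : L2 d)
      = ((|M.val.det|⁻¹ : ℝ) : ℂ) • compCLM (glTranspose M⁻¹) (𝓕 f : L2 d)) ?_ (fun u => ?_) f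
  · exact isClosed_eq (continuous_fourier_L2.comp (compCLM M).continuous)

      (((compCLM (glTranspose M⁻¹)).continuous.comp continuous_fourier_L2).const_smul
        ((|M.val.det|⁻¹ : ℝ) : ℂ))
  · let v : SchwartzMap (Rd d) ℂ :=
      SchwartzMap.compCLMOfContinuousLinearEquiv ℂ (matActCLE M) u
    have hv : compCLM M (u.toLp 2) = v.toLp 2 := by
      refine Lp.ext ?_
      filter_upwards [compCLM_ae M (u.toLp 2), v.coeFn_toLp 2,
        (quasiMeasurePreserving_matAct M).ae_eq_comp (u.coeFn_toLp 2)] with x h1 h2 h3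
      rw [h1, h2]
      exact h3
    rw [hv]
    refine Lp.ext ?_
    filter_upwards [fourier_toLp_eq v, Lp.coeFn_smul ((|M.val.det|⁻¹ : ℝ) : ℂ)
      (compCLM (glTranspose M⁻¹) (𝓕 (u.toLp 2 : L2 d) : L2 d)),
      compCLM_ae (glTranspose M⁻¹) (𝓕 (u.toLp 2 : L2 d) : L2 d),
      (quasiMeasurePreserving_matAct (glTranspose M⁻¹)).ae_eq_comp (fourier_toLp_eq u)]
      with ξ h1 h2 h3 h4
    simp only [Function.comp] at h4
    rw [h1, h2, Pi.smul_apply, h3, h4, Real.fourier_eq, Real.fourier_eq, smul_eq_mul,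
      ← Complex.real_smul, ← integral_comp_matAct M]
    congr 1
    ext x
    have : ⟪matAct M.val x, matAct (glTranspose M⁻¹).val ξ⟫_ℝ = ⟪x, ξ⟫_ℝ := by
      rw [real_inner_comm]
      change ⟪matAct (M⁻¹).val.transpose ξ, _⟫_ℝ = _
      rw [inner_matAct_left, Matrix.transpose_transpose, matAct_inv_matAct, real_inner_comm]
    rw [this]
    rfl

theorem dilationR_eq_smul_compCLM (M : GL (Fin d) ℝ) (f : L2 d) :
    dilationR M f = ((|M.val.det| : ℝ) : ℂ) • compCLM M f := rfl

theorem dilation_eq_smul_compCLM (M : GL (Fin d) ℝ) (f : L2 d) :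
    dilation M f = ((Real.sqrt |M.val.det| : ℝ) : ℂ) • compCLM M f := rfl

theorem glTranspose_inv_zpow (A : GL (Fin d) ℝ) (n : ℤ) (ξ : Rd d) :
    matAct (glTranspose (A ^ n)⁻¹).val ξ = adjPow A (-n) ξ := by
  rw [← zpow_neg]
  rfl

theorem fourier_smul_L2 (c : ℂ) (f : L2 d) : (𝓕 (c • f) : L2 d) = c • (𝓕 f : L2 d) :=
  (Lp.fourierTransformₗᵢ (Rd d) ℂ).map_smul c f

theorem fourier_dilationR_zpow_ae (A : GL (Fin d) ℝ) (n : ℤ) (f : L2 d) :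
    (𝓕 ((dilationR A ^ n) f) : L2 d) =ᵐ[volume] fun ξ => (𝓕 f : L2 d) (adjPow A (-n) ξ) := by
  rw [dilationR_zpow, dilationR_eq_smul_compCLM, fourier_smul_L2, fourier_compCLM, smul_smul,
    ← Complex.ofReal_mul, mul_inv_cancel₀ (abs_det_ne_zero _), Complex.ofReal_one, one_smul]
  filter_upwards [compCLM_ae (glTranspose (A ^ n)⁻¹) (𝓕 f : L2 d)] with ξ h
  rw [h, glTranspose_inv_zpow]

theorem fourier_dilation_zpow_ae (A : GL (Fin d) ℝ) (n : ℤ) (f : L2 d) :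
    (𝓕 ((dilation A ^ n) f) : L2 d) =ᵐ[volume]
      fun ξ => (((Real.sqrt |(A ^ n).val.det|)⁻¹ : ℝ) : ℂ) * (𝓕 f : L2 d) (adjPow A (-n) ξ) := by
  rw [dilation_zpow, dilation_eq_smul_compCLM, fourier_smul_L2, fourier_compCLM, smul_smul,
    ← Complex.ofReal_mul]
  have : Real.sqrt |(A ^ n).val.det| * |(A ^ n).val.det|⁻¹ = (Real.sqrt |(A ^ n).val.det|)⁻¹ := by
    have h := Real.sqrt_pos.2 (abs_det_pos (A ^ n))
    nth_rewrite 2 [← Real.mul_self_sqrt (abs_nonneg (A ^ n).val.det)]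
    field_simp
  rw [this]
  filter_upwards [compCLM_ae (glTranspose (A ^ n)⁻¹) (𝓕 f : L2 d),
    Lp.coeFn_smul (((Real.sqrt |(A ^ n).val.det|)⁻¹ : ℝ) : ℂ)
      (compCLM (glTranspose (A ^ n)⁻¹) (𝓕 f : L2 d))] with ξ h h2
  rw [h2, Pi.smul_apply, h, glTranspose_inv_zpow, smul_eq_mul]

theorem inner_eq_integral_fourier (f g : L2 d) :
    ⟪f, g⟫_ℂ = ∫ ξ, conj ((𝓕 f : L2 d) ξ) * (𝓕 g : L2 d) ξ := by
  rw [← Lp.inner_fourier_eq, L2.inner_def]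
  exact integral_congr_ae (.of_forall fun ξ => mul_comm _ _)

end Fourier

/-! ### Fourier series on the unit cube. -/

section Parseval

variable {d : ℕ}

/-- The unit cube `(0, 1]ᵈ`. -/
def unitCube (d : ℕ) : Set (Rd d) := {x | ∀ i, x i ∈ Set.Ioc (0 : ℝ) 1}

theorem measurableSet_unitCube : MeasurableSet (unitCube d) := by
  have : unitCube d = ⋂ i, (fun x : Rd d => x i) ⁻¹' Set.Ioc (0 : ℝ) 1 := by
    ext x; simp [unitCube]
  rw [this]
  exact MeasurableSet.iInter fun i => (by fun_prop : Measurable fun x : Rd d => x i) measurableSet_Ioc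

theorem volume_unitCube : volume (unitCube d) = 1 := by
  rw [← (PiLp.volume_preserving_toLp (Fin d)).measure_preimage
    measurableSet_unitCube.nullMeasurableSet]
  have h : (WithLp.toLp 2 : (Fin d → ℝ) → Rd d) ⁻¹' unitCube d
      = Set.univ.pi fun _ => Set.Ioc (0 : ℝ) 1 := by
    ext x; simp [unitCube]
  rw [h, Real.volume_pi_Ioc]
  simp

attribute [local instance] instMeasureSpaceUnitAddCircle

/-- The standard measurable section of `ℝᵈ → ℝᵈ / ℤᵈ` with values in the unit cube. -/
def torusSection (t : UnitAddTorus (Fin d)) : Rd d :=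
  WithLp.toLp 2 (UnitAddTorus.measurableEquivPiIoc (fun _ => (0 : ℝ)) t).1

theorem measurableEmbedding_torusSection : MeasurableEmbedding (torusSection (d := d)) := by
  have h0 : MeasurableSet {x : Fin d → ℝ | ∀ i, x i ∈ Set.Ioc (0 : ℝ) (0 + 1)} :=
    MeasurableSet.univ_pi' fun _ => measurableSet_Ioc
  have h1 := (MeasurableEquiv.toLp 2 (Fin d → ℝ)).measurableEmbedding
  exact h1.comp ((MeasurableEmbedding.subtype_coe h0).comp
    (UnitAddTorus.measurableEquivPiIoc (fun _ : Fin d => (0 : ℝ))).measurableEmbedding)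

theorem measurePreserving_torusSection :
    MeasurePreserving (torusSection (d := d)) volume (volume.restrict (unitCube d)) := by
  have h0 : MeasurableSet {x : Fin d → ℝ | ∀ i, x i ∈ Set.Ioc (0 : ℝ) (0 + 1)} :=
    MeasurableSet.univ_pi' fun _ => measurableSet_Ioc
  have h1 := UnitAddTorus.measurePreserving_equivPiIoc (fun _ : Fin d => (0 : ℝ))
  have h2 : MeasurePreserving (Subtype.val :
      {x : Fin d → ℝ // ∀ i, x i ∈ Set.Ioc (0 : ℝ) (0 + 1)} → Fin d → ℝ)
      (Measure.comap Subtype.val volume)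
      (volume.restrict {x : Fin d → ℝ | ∀ i, x i ∈ Set.Ioc (0 : ℝ) (0 + 1)}) :=
    ⟨measurable_subtype_coe, map_comap_subtype_coe h0 volume⟩
  have h3 := (PiLp.volume_preserving_toLp (Fin d)).restrict_preimage
    (measurableSet_unitCube (d := d))
  have h4 : (WithLp.toLp 2 : (Fin d → ℝ) → Rd d) ⁻¹' unitCube d
      = {x : Fin d → ℝ | ∀ i, x i ∈ Set.Ioc (0 : ℝ) (0 + 1)} := by
    ext x; simp [unitCube]
  rw [h4] at h3
  exact h3.comp (h2.comp h1)

theorem mFourier_eq_expo (n : Fin d → ℤ) (t : UnitAddTorus (Fin d)) :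
    UnitAddTorus.mFourier n t = expo (intVec n) (torusSection t) := by
  have ht : ∀ i, ((torusSection t i : ℝ) : UnitAddCircle) = t i := fun i =>
    (AddCircle.equivIoc 1 (0 : ℝ)).symm_apply_apply (t i)
  simp only [UnitAddTorus.mFourier, ContinuousMap.coe_mk]
  have h1 : ∀ i, fourier (n i) (t i) = Complex.exp (2 * Real.pi * Complex.I * (n i * torusSection t i)) := by
    intro i
    rw [← ht i, fourier_coe_apply]
    congr 1
    push_cast
    ring
  rw [Finset.prod_congr rfl fun i _ => h1 i, ← Complex.exp_sum, expo, Real.fourierChar_apply]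
  congr 1
  rw [← Finset.mul_sum]
  simp only [intVec, PiLp.inner_apply, RCLike.inner_apply, conj_trivial]
  push_cast
  rw [Finset.sum_congr rfl fun i _ => mul_comm _ _]
  ring

theorem intVec_neg (k : Fin d → ℤ) : intVec (-k) = -intVec k := by
  ext i; simp [intVec]

theorem intVec_add (k l : Fin d → ℤ) : intVec (k + l) = intVec k + intVec l := by
  ext i; simp [intVec]

theorem intVec_sub (k l : Fin d → ℤ) : intVec (k - l) = intVec k - intVec l := by
  ext i; simp [intVec]

@[simp] theorem intVec_zero : intVec (0 : Fin d → ℤ) = 0 := by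
  ext i; simp [intVec]

theorem intVec_injective : Function.Injective (intVec (d := d)) := by
  intro k l h
  ext i
  have := congrArg (fun x : Rd d => x i) h
  simpa [intVec] using this

theorem expo_intVec_intVec (k l : Fin d → ℤ) : expo (intVec k) (intVec l) = 1 := by
  have h : ⟪intVec k, intVec l⟫_ℝ = ((∑ i, l i * k i : ℤ) : ℝ) := by
    simp [intVec, PiLp.inner_apply]
  rw [expo, h, Real.fourierChar_apply, Complex.exp_eq_one_iff]
  exact ⟨∑ i, l i * k i, by push_cast; ring⟩

/-- Parseval's identity on the unit cube. -/
theorem hasSum_unitCube {U V : Rd d → ℂ} (hU : MemLp U 2 (volume.restrict (unitCube d)))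
    (hV : MemLp V 2 (volume.restrict (unitCube d))) :
    HasSum (fun z : Fin d → ℤ => (∫ x in unitCube d, expo (intVec z) x * U x)
      * conj (∫ x in unitCube d, expo (intVec z) x * V x))
      (∫ x in unitCube d, U x * conj (V x)) := by
  have hU' := hU.comp_measurePreserving measurePreserving_torusSection
  have hV' := hV.comp_measurePreserving measurePreserving_torusSection
  have key := UnitAddTorus.hasSum_prod_mFourierCoeff hV'.toLp hU'.toLp
  have coef : ∀ {W : Rd d → ℂ} (hW : MemLp (W ∘ torusSection) 2
      (volume : Measure (UnitAddTorus (Fin d)))) (n : Fin d → ℤ),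
      UnitAddTorus.mFourierCoeff hW.toLp (-n) = ∫ x in unitCube d, expo (intVec n) x * W x := by
    intro W hW n
    rw [UnitAddTorus.mFourierCoeff, ← measurePreserving_torusSection.integral_comp
      measurableEmbedding_torusSection]
    refine integral_congr_ae ?_
    filter_upwards [hW.coeFn_toLp] with t ht
    rw [ht, neg_neg, mFourier_eq_expo, smul_eq_mul, Function.comp]
  have hint : ∫ t : UnitAddTorus (Fin d), conj ((MemLp.toLp _ hV') t) * (MemLp.toLp _ hU') t = ∫ x in unitCube d, U x * conj (V x) := by
    rw [← measurePreserving_torusSection.integral_comp measurableEmbedding_torusSection]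
    refine integral_congr_ae ?_
    filter_upwards [hU'.coeFn_toLp, hV'.coeFn_toLp] with t h1 h2
    rw [h1, h2, mul_comm]
    rfl
  rw [hint] at key
  -- A Fourier coefficient at n integrates against the character of -n, so the sum is reindexed by
  -- negation.
  refine ((Equiv.neg (Fin d → ℤ)).hasSum_iff.2 key).congr_fun ?_
  intro z
  simp only [Function.comp, Equiv.neg_apply]
  rw [coef hU', coef hV', mul_comm]

/-- Orthonormality of the torus characters, tested against the constant one; this is what later
isolates a single frequency shift. -/
theorem integral_unitCube_expo (k : Fin d → ℤ) :
    ∫ x in unitCube d, expo (intVec k) x = if k = 0 then 1 else 0 := by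
  rw [← measurePreserving_torusSection.integral_comp measurableEmbedding_torusSection]
  have h := (orthonormal_iff_ite.1 (UnitAddTorus.orthonormal_mFourier (d := Fin d))) 0 k
  rw [ContinuousMap.inner_toLp] at h
  simp only [UnitAddTorus.mFourier_zero] at h
  simp only [eq_comm (a := k)]
  rw [← h]
  refine integral_congr_ae (.of_forall fun t => ?_)
  simp [mFourier_eq_expo]

end Parseval

/-! ### Periodizing functions of bounded support. -/

section Periodization

variable {d : ℕ}

/-- The lattice points all of whose coordinates have modulus at most `N`. -/
def latticeBox (d N : ℕ) : Finset (Fin d → ℤ) :=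
  Fintype.piFinset fun _ => Finset.Icc (-N : ℤ) N

theorem mem_latticeBox {N : ℕ} {k : Fin d → ℤ} : k ∈ latticeBox d N ↔ ∀ i, |k i| ≤ (N : ℤ) := by
  simp [latticeBox, abs_le]

theorem abs_coord_le_norm (x : Rd d) (i : Fin d) : |x i| ≤ ‖x‖ := by
  simpa using PiLp.norm_apply_le x i

theorem mem_latticeBox_of_norm_le {N : ℕ} {k : Fin d → ℤ} (h : ‖intVec k‖ ≤ N) :
    k ∈ latticeBox d N := by
  rw [mem_latticeBox]
  intro i
  have := (abs_coord_le_norm (intVec k) i).trans h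
  simp only [intVec] at this
  exact_mod_cast this

theorem iUnion_cells :
    (⋃ k : Fin d → ℤ, (fun x : Rd d => x - intVec k) ⁻¹' unitCube d) = Set.univ := by
  -- The cube is open on the left and closed on the right, hence the ceiling minus one rather than
  -- the floor.
  refine Set.eq_univ_of_forall fun x => Set.mem_iUnion.2 ⟨fun i => ⌈x i⌉ - 1, fun i => ?_⟩
  have h1 := Int.ceil_lt_add_one (x i)
  have h2 := Int.le_ceil (x i)
  simp only [intVec, PiLp.sub_apply, Int.cast_sub, Int.cast_one, Set.mem_Ioc]
  constructor <;> linarith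

theorem disjoint_cells :
    Pairwise (Function.onFun Disjoint
      fun k : Fin d → ℤ => (fun x : Rd d => x - intVec k) ⁻¹' unitCube d) := by
  intro k l hkl
  refine Set.disjoint_left.2 fun x hk hl => hkl (funext fun i => ?_)
  have h1 := hk i
  have h2 := hl i
  simp only [intVec, PiLp.sub_apply, Set.mem_Ioc] at h1 h2
  have h3 : (k i : ℝ) < l i + 1 := by linarith
  have h4 : (l i : ℝ) < k i + 1 := by linarith
  have h5 : k i < l i + 1 := by exact_mod_cast h3
  have h6 : l i < k i + 1 := by exact_mod_cast h4
  omega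

theorem measurableSet_cell (k : Fin d → ℤ) :
    MeasurableSet ((fun x : Rd d => x - intVec k) ⁻¹' unitCube d) :=
  (measurable_id.sub_const _) measurableSet_unitCube

theorem setIntegral_cell (w : Rd d → ℂ) (k : Fin d → ℤ) :
    ∫ x in (fun x : Rd d => x - intVec k) ⁻¹' unitCube d, w x
      = ∫ x in unitCube d, w (x + intVec k) := by
  have h := (measurePreserving_sub_right (volume : Measure (Rd d)) (intVec k)).setIntegral_preimage_emb
    (MeasurableEquiv.subRight (intVec k)).measurableEmbedding (fun x => w (x + intVec k))
    (unitCube d)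
  simpa using h

theorem hasSum_setIntegral_unitCube {w : Rd d → ℂ} (hw : Integrable w) :
    HasSum (fun k : Fin d → ℤ => ∫ x in unitCube d, w (x + intVec k)) (∫ x, w x) := by
  have h := hasSum_integral_iUnion (f := w) (μ := volume) (fun k => measurableSet_cell (d := d) k)
    disjoint_cells (by rw [iUnion_cells]; exact hw.integrableOn)
  rw [iUnion_cells, setIntegral_univ] at h
  simpa only [setIntegral_cell] using h

theorem not_mem_latticeBox_norm {N : ℕ} {k : Fin d → ℤ} (hk : k ∉ latticeBox d N) {x : Rd d}
    (hx : x ∈ unitCube d) : (N : ℝ) ≤ ‖x + intVec k‖ := by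
  rw [mem_latticeBox] at hk
  push Not at hk
  obtain ⟨i, hi⟩ := hk
  refine le_trans ?_ (abs_coord_le_norm _ i)
  have h1 := hx i
  simp only [PiLp.add_apply, intVec, Set.mem_Ioc] at h1 ⊢
  rcases le_or_gt 0 (k i) with h | h
  · rw [abs_of_nonneg h] at hi
    have h2 : (N : ℝ) < k i := by exact_mod_cast hi
    rw [abs_of_nonneg] <;> linarith
  · rw [abs_of_neg h] at hi
    -- Integrality gains one unit, which absorbs the coordinate of the cube point, at most 1.
    have h2 : (N : ℝ) + 1 ≤ -k i := by exact_mod_cast hi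
    rw [abs_of_nonpos] <;> linarith

/-- Bounded support makes the decomposition into unit cells finite, with a box depending on the
radius alone, so that periodizations are finite sums. -/
theorem integral_eq_sum_latticeBox {w : Rd d → ℂ} (hw : Integrable w) {R : ℝ} {N : ℕ}
    (hN : R < N) (hR : ∀ ξ, R < ‖ξ‖ → w ξ = 0) :
    ∫ x, w x = ∑ k ∈ latticeBox d N, ∫ x in unitCube d, w (x + intVec k) := by
  rw [← (hasSum_setIntegral_unitCube hw).tsum_eq]
  refine tsum_eq_sum fun k hk => ?_
  refine setIntegral_eq_zero_of_forall_eq_zero fun x hx => ?_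
  exact hR _ (hN.trans_le (not_mem_latticeBox_norm hk hx))

theorem integrable_of_memLp_two_of_bounded_support {u : Rd d → ℂ} (hu : MemLp u 2 volume) {R : ℝ}
    (hR : ∀ ξ, R < ‖ξ‖ → u ξ = 0) : Integrable u := by
  have h1 : IntegrableOn u (Metric.closedBall 0 R) := by
    have : Fact (volume (Metric.closedBall (0 : Rd d) R) < ∞) := ⟨measure_closedBall_lt_top⟩
    exact (hu.restrict _).integrable (by norm_num)
  refine h1.integrable_of_forall_notMem_eq_zero fun x hx => hR x ?_
  simpa using hx

theorem integral_add_mul_conj_eq_zero {u v : Rd d → ℂ} {R R' : ℝ} (hRu : ∀ ξ, R < ‖ξ‖ → u ξ = 0)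
    (hRv : ∀ ξ, R' < ‖ξ‖ → v ξ = 0) {a : Rd d} (ha : R + R' < ‖a‖) (ξ : Rd d) :
    u (ξ + a) * conj (v ξ) = 0 := by
  rcases lt_or_ge R' ‖ξ‖ with h | h
  · simp [hRv ξ h]
  · rw [hRu (ξ + a), zero_mul]
    have := norm_sub_le (ξ + a) ξ
    rw [add_sub_cancel_left] at this
    linarith

/-- Parseval's identity for the Fourier coefficients of periodizations. -/
theorem hasSum_periodization {u v : Rd d → ℂ} (hu : MemLp u 2 volume) (hv : MemLp v 2 volume)
    {R : ℝ} (hRu : ∀ ξ, R < ‖ξ‖ → u ξ = 0) (hRv : ∀ ξ, R < ‖ξ‖ → v ξ = 0) :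
    HasSum (fun z : Fin d → ℤ => (∫ x, expo (intVec z) x * u x)
      * conj (∫ x, expo (intVec z) x * v x))
      (∑' l : Fin d → ℤ, ∫ ξ, u (ξ + intVec l) * conj (v ξ)) := by
  obtain ⟨N, hN⟩ := exists_nat_gt R
  set F := latticeBox d N with hF
  have shift : ∀ {w : Rd d → ℂ}, MemLp w 2 volume → ∀ a : Rd d,
      MemLp (fun x => w (x + a)) 2 volume := fun hw a =>
    hw.comp_measurePreserving (measurePreserving_add_right volume a)
  have memU : ∀ {w : Rd d → ℂ}, MemLp w 2 volume →
      MemLp (fun x => ∑ k ∈ F, w (x + intVec k)) 2 (volume.restrict (unitCube d)) := fun hw =>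
    memLp_finsetSum _ fun k _ => (shift hw (intVec k)).restrict _
  have coef : ∀ {w : Rd d → ℂ}, MemLp w 2 volume → (∀ ξ, R < ‖ξ‖ → w ξ = 0) → ∀ z : Fin d → ℤ,
      ∫ x, expo (intVec z) x * w x
        = ∫ x in unitCube d, expo (intVec z) x * ∑ k ∈ F, w (x + intVec k) := by
    intro w hw hR z
    have hint : Integrable fun x => expo (intVec z) x * w x :=
      (integrable_of_memLp_two_of_bounded_support hw hR).bdd_mul (c := 1)
        (by fun_prop) (.of_forall fun x => (norm_expo _ x).le)
    rw [integral_eq_sum_latticeBox hint hN fun ξ hξ => by rw [hR ξ hξ, mul_zero],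
      ← integral_finsetSum]
    · refine integral_congr_ae (.of_forall fun x => ?_)
      simp only [expo_add_right, expo_intVec_intVec, mul_one, Finset.mul_sum]
      rfl
    · intro k _
      exact (hint.comp_add_right (intVec k)).integrableOn
  have main := hasSum_unitCube (memU hu) (memU hv)
  simp only [← coef hu hRu, ← coef hv hRv] at main
  convert! main using 1
  have hprod : ∀ a b : Rd d, Integrable fun x => u (x + a) * conj (v (x + b)) := fun a b =>
    (shift hu a).integrable_mul (shift hv b).star
  -- A shift l matters only as a difference of two cells of the box of size N, hence the box of size
  -- 2N; beyond it the two supports are disjoint.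
  rw [tsum_eq_sum (s := latticeBox d (2 * N))]
  · have h1 : ∀ l : Fin d → ℤ, ∫ ξ, u (ξ + intVec l) * conj (v ξ)
        = ∑ k ∈ F, ∫ x in unitCube d, u (x + intVec k + intVec l) * conj (v (x + intVec k)) := by
      intro l
      refine integral_eq_sum_latticeBox ?_ hN fun ξ hξ => by rw [hRv ξ hξ]; simp
      simpa using hprod (intVec l) 0
    simp only [h1]
    rw [Finset.sum_comm]
    have h2 : ∀ k ∈ F, ∑ l ∈ latticeBox d (2 * N),
        ∫ x in unitCube d, u (x + intVec k + intVec l) * conj (v (x + intVec k))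
        = ∫ x in unitCube d, (∑ m ∈ F, u (x + intVec m)) * conj (v (x + intVec k)) := by
      intro k hk
      rw [← integral_finsetSum]
      · refine setIntegral_congr_fun measurableSet_unitCube fun x hx => ?_
        simp only [← Finset.sum_mul]
        congr 1
        have h3 : ∑ l ∈ latticeBox d (2 * N), u (x + intVec k + intVec l)
            = ∑ m ∈ (latticeBox d (2 * N)).map (Equiv.addLeft k).toEmbedding,
              u (x + intVec m) := by
          rw [Finset.sum_map]
          refine Finset.sum_congr rfl fun l _ => ?_
          simp [intVec_add, add_assoc]
        rw [h3]
        -- The box of size 2N shifted by k still contains the box of size N, and the cells in excess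
        -- lie outside the support of `u`.
        refine (Finset.sum_subset ?_ ?_).symm
        · intro m hm
          rw [Finset.mem_map_equiv, mem_latticeBox]
          intro i
          have h4 := mem_latticeBox.1 hm i
          have h5 := mem_latticeBox.1 hk i
          simp only [Equiv.addLeft_symm, Equiv.coe_addLeft, Pi.add_apply, Pi.neg_apply]
          rw [abs_le] at *
          push_cast
          omega
        · intro m _ hm
          exact hRu _ (hN.trans_le (not_mem_latticeBox_norm hm hx))
      · intro l _
        simp only [add_assoc]
        exact (hprod _ _).integrableOn
    rw [Finset.sum_congr rfl h2, ← integral_finsetSum]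
    · refine integral_congr_ae (.of_forall fun x => ?_)
      simp only [← Finset.mul_sum, map_sum]
    · intro k _
      simp only [Finset.sum_mul]
      exact integrable_finsetSum _ fun m _ => (hprod _ _).integrableOn
  · intro l hl
    have h6 : R + R < ‖intVec l‖ := by
      by_contra hcon
      refine hl (mem_latticeBox_of_norm_le ?_)
      push_cast
      linarith
    simp [integral_add_mul_conj_eq_zero hRu hRv h6]

end Periodization

/-! ### Band-limited functions and the frequency expansion of one level. -/

section BandLimited

variable {d : ℕ}

theorem HasSum.of_eq {ι E : Type*} [AddCommMonoid E] [TopologicalSpace E] {u v : ι → E} {a b : E}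
    (h : HasSum u a) (huv : ∀ i, v i = u i) (hab : a = b) : HasSum v b := by
  rw [← hab]
  exact h.congr_fun huv

/-- A function in `L²` whose Fourier transform is bounded with bounded support. -/
def IsBandLimited (f : L2 d) : Prop :=
  ∃ (h : Rd d → ℂ) (R C : ℝ), Measurable h ∧ (∀ ξ, ‖h ξ‖ ≤ C) ∧ (∀ ξ, R < ‖ξ‖ → h ξ = 0) ∧
    (𝓕 f : L2 d) =ᵐ[volume] h

theorem memLp_of_bounded_of_bounded_support {h : Rd d → ℂ} {R C : ℝ} (hm : Measurable h)
    (hC : ∀ ξ, ‖h ξ‖ ≤ C) (hR : ∀ ξ, R < ‖ξ‖ → h ξ = 0) : MemLp h 2 volume := by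
  have hs : Function.support h ⊆ Metric.closedBall 0 R := by
    intro x hx
    by_contra hcon
    exact hx (hR x (by simpa using hcon))
  rw [← Set.indicator_eq_self.2 hs, memLp_indicator_iff_restrict measurableSet_closedBall]
  have : Fact (volume (Metric.closedBall (0 : Rd d) R) < ∞) := ⟨measure_closedBall_lt_top⟩
  exact MemLp.of_bound hm.aestronglyMeasurable C (.of_forall hC)

/-- The band-limited function with the given Fourier transform. -/
theorem exists_isBandLimited {h : Rd d → ℂ} {R C : ℝ} (hm : Measurable h)
    (hC : ∀ ξ, ‖h ξ‖ ≤ C) (hR : ∀ ξ, R < ‖ξ‖ → h ξ = 0) :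
    ∃ f : L2 d, IsBandLimited f ∧ (𝓕 f : L2 d) =ᵐ[volume] h := by
  have hmem := memLp_of_bounded_of_bounded_support hm hC hR
  refine ⟨(Lp.fourierTransformₗᵢ (Rd d) ℂ).symm hmem.toLp, ?_⟩
  have : (𝓕 ((Lp.fourierTransformₗᵢ (Rd d) ℂ).symm hmem.toLp) : L2 d) = hmem.toLp :=
    (Lp.fourierTransformₗᵢ (Rd d) ℂ).apply_symm_apply _
  have h2 : (𝓕 ((Lp.fourierTransformₗᵢ (Rd d) ℂ).symm hmem.toLp) : L2 d) =ᵐ[volume] h := by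
    rw [this]
    exact hmem.coeFn_toLp
  exact ⟨⟨h, R, C, hm, hC, hR, h2⟩, h2⟩

/-- Continuous compactly supported functions are dense on the Fourier side, and the inverse
transform is an isometry onto L². -/
theorem dense_isBandLimited : Dense {f : L2 d | IsBandLimited f} := by
  have key : Dense {F : L2 d | IsBandLimited ((Lp.fourierTransformₗᵢ (Rd d) ℂ).symm F)} := by
    refine Metric.dense_iff.2 fun F ε hε => ?_
    obtain ⟨h, hsupp, hle, hcont, hmem⟩ :=
      (Lp.memLp F).exists_hasCompactSupport_eLpNorm_sub_le (p := 2) (by norm_num)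
        (ε := ENNReal.ofReal (ε / 2)) (by simpa using hε)
    refine ⟨hmem.toLp, ?_, ?_⟩
    · rw [Metric.mem_ball, dist_comm, Lp.dist_def]
      have : eLpNorm (⇑F - ⇑hmem.toLp) 2 volume ≤ ENNReal.ofReal (ε / 2) := by
        refine le_trans (le_of_eq (eLpNorm_congr_ae ?_)) hle
        filter_upwards [hmem.coeFn_toLp] with x hx
        simp [hx]
      refine (ENNReal.toReal_mono ENNReal.ofReal_ne_top this).trans_lt ?_
      rw [ENNReal.toReal_ofReal (by positivity)]
      linarith
    · obtain ⟨C, hC⟩ := hcont.bounded_above_of_compact_support hsupp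
      obtain ⟨R, hR⟩ := hsupp.isCompact.isBounded.subset_closedBall 0
      refine ⟨h, R, C, hcont.measurable, hC, fun ξ hξ => ?_, ?_⟩
      · by_contra hne
        have := hR (subset_tsupport h hne)
        simp only [Metric.mem_closedBall, dist_zero_right] at this
        linarith
      · have : (𝓕 ((Lp.fourierTransformₗᵢ (Rd d) ℂ).symm hmem.toLp) : L2 d) = hmem.toLp :=
          (Lp.fourierTransformₗᵢ (Rd d) ℂ).apply_symm_apply _
        rw [this]
        exact hmem.coeFn_toLp
  have h2 := (Lp.fourierTransformₗᵢ (Rd d) ℂ).symm.surjective.denseRange.dense_image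
    (Lp.fourierTransformₗᵢ (Rd d) ℂ).symm.continuous key
  refine h2.mono ?_
  rintro _ ⟨F, hF, rfl⟩
  exact hF

theorem IsBandLimited.translation {f : L2 d} (hf : IsBandLimited f) (β : Rd d) :
    IsBandLimited (translation β f) := by
  obtain ⟨h, R, C, hm, hC, hR, hh⟩ := hf
  refine ⟨fun ξ => expo (-β) ξ * h ξ, R, C, ((continuous_expo _).measurable).mul hm, fun ξ => ?_,
    fun ξ hξ => by simp only [hR ξ hξ, mul_zero], ?_⟩
  · rw [norm_mul, norm_expo, one_mul]
    exact hC ξ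
  · filter_upwards [fourier_translation_ae β f, hh] with ξ h1 h2
    rw [h1, h2]

theorem IsBandLimited.dilation_zpow {f : L2 d} (hf : IsBandLimited f) (A : GL (Fin d) ℝ) (n : ℤ) :
    IsBandLimited ((dilation A ^ n) f) := by
  obtain ⟨h, R, C, hm, hC, hR, hh⟩ := hf
  set c : ℂ := (((Real.sqrt |(A ^ n).val.det|)⁻¹ : ℝ) : ℂ)
  -- The frequency support is multiplied by the transpose of Aⁿ, so a norm bound K of that map turns
  -- the radius R into K R.
  obtain ⟨K, hK0, hK⟩ := (LinearMap.toContinuousLinearMap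
    (matAct ((A ^ n).val.transpose))).isBoundedLinearMap.bound
  refine ⟨fun ξ => c * h (adjPow A (-n) ξ), K * R, ‖c‖ * C,
    (hm.comp (continuous_adjPow A (-n)).measurable).const_mul c, fun ξ => ?_, fun ξ hξ => ?_, ?_⟩
  · rw [norm_mul]
    exact mul_le_mul_of_nonneg_left (hC _) (norm_nonneg _)
  · refine mul_eq_zero_of_right _ (hR _ ?_)
    by_contra hcon
    push Not at hcon
    have h1 : ‖adjPow A n (adjPow A (-n) ξ)‖ ≤ K * ‖adjPow A (-n) ξ‖ := hK _
    rw [adjPow_adjPow, add_neg_cancel, adjPow_zero] at h1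
    have := mul_le_mul_of_nonneg_left hcon hK0.le
    linarith
  · filter_upwards [fourier_dilation_zpow_ae A n f,
      (quasiMeasurePreserving_adjPow A (-n)).ae_eq_comp hh] with ξ h1 h2
    rw [h1]
    exact congrArg (c * ·) h2

/-- The frequency-domain pairing of `f` and `g` at the scale `n` and the frequency shift `a`. -/
def shiftPairing (A : GL (Fin d) ℝ) (ψ φ f g : L2 d) (n : ℤ) (a : Rd d) : ℂ :=
  ∫ ξ, conj (crossTerm A φ ψ (-n) ξ (ξ + a)) * ((𝓕 f : L2 d) (ξ + a) * conj ((𝓕 g : L2 d) ξ))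

theorem ae_comp_add_right {E : Type*} {u v : Rd d → E} (h : u =ᵐ[volume] v) (a : Rd d) :
    (fun ξ => u (ξ + a)) =ᵐ[volume] fun ξ => v (ξ + a) :=
  (measurePreserving_add_right volume a).quasiMeasurePreserving.ae_eq_comp h

/-- The phases at ξ + a and at ξ cancel except for the constant phase of a. This makes frequency
shifts visible as characters in β. -/
theorem shiftPairing_translation (A : GL (Fin d) ℝ) (ψ φ f g : L2 d) (n : ℤ) (a β : Rd d) :
    shiftPairing A ψ φ (translation β f) (translation β g) n a
      = expo (-β) a * shiftPairing A ψ φ f g n a := by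
  rw [shiftPairing, shiftPairing, ← integral_const_mul]
  refine integral_congr_ae ?_
  filter_upwards [ae_comp_add_right (fourier_translation_ae β f) a,
    fourier_translation_ae β g] with ξ h1 h2
  rw [h1, h2, map_mul, expo_add_right]
  have := expo_mul_conj (-β) ξ
  linear_combination (conj (crossTerm A φ ψ (-n) ξ (ξ + a)) * ((𝓕 f : L2 d) (ξ + a)
    * conj ((𝓕 g : L2 d) ξ)) * expo (-β) a) * this

theorem crossTerm_adjPow (A : GL (Fin d) ℝ) (f g : L2 d) (j m : ℤ) (ξ η : Rd d) :
    crossTerm A f g j (adjPow A m ξ) (adjPow A m η) = crossTerm A f g (j + m) ξ η := by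
  simp only [crossTerm, adjPow_adjPow]

/-- Substitute the variable A*^(-m) ξ: the normalizations of the two dilated functions multiply to
the inverse of the Jacobian factor, and only the scale and the shift change. -/
theorem shiftPairing_dilation (A : GL (Fin d) ℝ) (ψ φ f g : L2 d) (n m : ℤ) (a : Rd d) :
    shiftPairing A ψ φ ((dilation A ^ m) f) ((dilation A ^ m) g) n (adjPow A m a)
      = shiftPairing A ψ φ f g (n - m) a := by
  set c : ℝ := (Real.sqrt |(A ^ m).val.det|)⁻¹ with hc
  let G : Rd d → ℂ := fun ξ => conj (crossTerm A φ ψ (-(n - m)) ξ (ξ + a))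
    * ((𝓕 f : L2 d) (ξ + a) * conj ((𝓕 g : L2 d) ξ))
  have h1 : shiftPairing A ψ φ ((dilation A ^ m) f) ((dilation A ^ m) g) n (adjPow A m a)
      = ∫ ξ, ((c * c : ℝ) : ℂ) * G (adjPow A (-m) ξ) := by
    refine integral_congr_ae ?_
    filter_upwards [ae_comp_add_right (fourier_dilation_zpow_ae A m f) (adjPow A m a),
      fourier_dilation_zpow_ae A m g] with ξ h1 h2
    have h3 : adjPow A (-m) (ξ + adjPow A m a) = adjPow A (-m) ξ + a := by
      rw [adjPow_add, adjPow_adjPow, neg_add_cancel, adjPow_zero]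
    have h4 : crossTerm A φ ψ (-(n - m)) (adjPow A (-m) ξ) (adjPow A (-m) ξ + a)
        = crossTerm A φ ψ (-n) ξ (ξ + adjPow A m a) := by
      rw [← h3, crossTerm_adjPow]
      congr 1
      ring
    simp only [G, h4]
    rw [h1, h2, h3, map_mul, Complex.conj_ofReal, ← hc, Complex.ofReal_mul]
    ring
  have hd : |(A ^ (-m)).val.det|⁻¹ = |(A ^ m).val.det| := by
    have : (A ^ (-m)).val.det * (A ^ m).val.det = 1 := by
      rw [← Matrix.det_mul, ← Units.val_mul, ← zpow_add, neg_add_cancel, zpow_zero, Units.val_one,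
        Matrix.det_one]
    rw [← abs_inv, eq_inv_of_mul_eq_one_right this]
  rw [h1, integral_const_mul, integral_comp_adjPow, hd, Complex.real_smul, ← mul_assoc,
    ← Complex.ofReal_mul, hc, ← mul_inv, Real.mul_self_sqrt (abs_nonneg _),
    inv_mul_cancel₀ (abs_det_ne_zero _), Complex.ofReal_one, one_mul]
  rfl

theorem shiftPairing_eq_zero {ψ φ f g : L2 d} {h h' : Rd d → ℂ} {R R' : ℝ}
    (hR : ∀ ξ, R < ‖ξ‖ → h ξ = 0) (hh : (𝓕 f : L2 d) =ᵐ[volume] h)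
    (hR' : ∀ ξ, R' < ‖ξ‖ → h' ξ = 0) (hh' : (𝓕 g : L2 d) =ᵐ[volume] h')
    (A : GL (Fin d) ℝ) (n : ℤ) {a : Rd d} (ha : R + R' < ‖a‖) :
    shiftPairing A ψ φ f g n a = 0 := by
  refine integral_eq_zero_of_ae ?_
  filter_upwards [ae_comp_add_right hh a, hh'] with ξ h1 h2
  rw [h1, h2, integral_add_mul_conj_eq_zero hR hR' ha ξ, mul_zero, Pi.zero_apply]

/-- The coefficients are Fourier coefficients of conj ψ^ · f^ and conj φ^ · g^. Band-limitation
makes both products square integrable with bounded support, so `hasSum_periodization` applies. -/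
theorem hasSum_translates {ψ φ f g : L2 d} (hf : IsBandLimited f) (hg : IsBandLimited g) :
    HasSum (fun z : Fin d → ℤ => ⟪translation (intVec z) ψ, f⟫_ℂ * ⟪g, translation (intVec z) φ⟫_ℂ)
      (∑' l : Fin d → ℤ, ∫ ξ, conj ((𝓕 ψ : L2 d) (ξ + intVec l)) * (𝓕 φ : L2 d) ξ *
        ((𝓕 f : L2 d) (ξ + intVec l) * conj ((𝓕 g : L2 d) ξ))) := by
  obtain ⟨h, R, C, hm, hC, hR, hh⟩ := hf
  obtain ⟨h', R', C', hm', hC', hR', hh'⟩ := hg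
  have mem : ∀ {h : Rd d → ℂ} {C : ℝ} (ψ : L2 d), Measurable h → (∀ ξ, ‖h ξ‖ ≤ C) →
      MemLp (fun ξ => conj ((𝓕 ψ : L2 d) ξ) * h ξ) 2 volume := by
    intro h C ψ hm hC
    exact (memLp_top_of_bound hm.aestronglyMeasurable C (.of_forall hC)).mul
      (Lp.memLp (𝓕 ψ : L2 d)).star
  have inn : ∀ {f : L2 d} {h : Rd d → ℂ} (ψ : L2 d) (z : Fin d → ℤ), (𝓕 f : L2 d) =ᵐ[volume] h →
      ⟪translation (intVec z) ψ, f⟫_ℂ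
        = ∫ ξ, expo (intVec z) ξ * (conj ((𝓕 ψ : L2 d) ξ) * h ξ) := by
    intro f h ψ z hh
    rw [inner_eq_integral_fourier]
    refine integral_congr_ae ?_
    filter_upwards [fourier_translation_ae (intVec z) ψ, hh] with ξ h1 h2
    rw [h1, h2, map_mul, ← expo_neg_left, neg_neg, mul_assoc]
  have key := hasSum_periodization (R := max R R') (mem ψ hm hC) (mem φ hm' hC')
    (fun ξ hξ => by rw [hR ξ ((le_max_left _ _).trans_lt hξ), mul_zero])
    (fun ξ hξ => by rw [hR' ξ ((le_max_right _ _).trans_lt hξ), mul_zero])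
  refine key.of_eq (fun z => ?_) ?_
  · rw [inn ψ z hh, ← inner_conj_symm g, inn φ z hh']
  · refine tsum_congr fun l => integral_congr_ae (μ := (volume : Measure (Rd d))) ?_
    filter_upwards [ae_comp_add_right hh (intVec l), hh'] with ξ h1 h2
    rw [h1, h2, map_mul, Complex.conj_conj]
    ring

theorem hasSum_translates_dilationR (A : GL (Fin d) ℝ) {ψ φ f g : L2 d} (hf : IsBandLimited f)
    (hg : IsBandLimited g) (n : ℤ) :
    HasSum (fun z : Fin d → ℤ => ⟪translation (intVec z) ((dilationR A ^ n) ψ), f⟫_ℂ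
        * ⟪g, translation (intVec z) ((dilationR A ^ n) φ)⟫_ℂ)
      (∑' l : Fin d → ℤ, shiftPairing A ψ φ f g n (intVec l)) := by
  refine (hasSum_translates hf hg).of_eq (fun _ => rfl) (tsum_congr fun l => integral_congr_ae ?_)
  filter_upwards [ae_comp_add_right (fourier_dilationR_zpow_ae A n ψ) (intVec l),
    fourier_dilationR_zpow_ae A n φ] with ξ h1 h2
  rw [h1, h2, crossTerm, map_mul, Complex.conj_conj, mul_comm (conj _) ((𝓕 φ : L2 d) _)]

/-- The unitary dilation is moved onto f and g, which reduces to level 0; undoing it by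
`shiftPairing_dilation` stretches the shift lattice to A*ⁿℤᵈ. -/
theorem hasSum_dilation_translates (A : GL (Fin d) ℝ) {ψ φ f g : L2 d} (hf : IsBandLimited f)
    (hg : IsBandLimited g) (n : ℤ) :
    HasSum (fun z : Fin d → ℤ => ⟪(dilation A ^ n) (translation (intVec z) ψ), f⟫_ℂ
        * ⟪g, (dilation A ^ n) (translation (intVec z) φ)⟫_ℂ)
      (∑' l : Fin d → ℤ, shiftPairing A ψ φ f g n (adjPow A n (intVec l))) := by
  have h := hasSum_translates_dilationR A (ψ := ψ) (φ := φ) (hf.dilation_zpow A (-n))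
    (hg.dilation_zpow A (-n)) 0
  refine h.of_eq (fun z => ?_) (tsum_congr fun l => ?_)
  · simp only [dilation_zpow]
    rw [inner_dilation_left (A ^ n), inner_dilation_right (A ^ n), ← zpow_neg]
    rfl
  · have h2 := shiftPairing_dilation A ψ φ f g 0 (-n) (adjPow A n (intVec l))
    rw [adjPow_adjPow, neg_add_cancel, adjPow_zero] at h2
    rw [h2]
    congr 1
    ring

end BandLimited

/-! ### Bessel bounds in extended nonnegative reals. -/

section BesselSum

variable {H : Type*} [NormedAddCommGroup H] [InnerProductSpace ℂ H] {J : Type*}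

theorem ENNReal.tsum_prod_mk {α β : Type*} (u : α × β → ℝ≥0∞) :
    ∑' p, u p = ∑' (a) (b), u (a, b) :=
  ENNReal.tsum_prod (f := fun a b => u (a, b))

/-- The sum of the squared moduli of the coefficients of `v` against a family `x`. -/
def besselSum (x : J → H) (v : H) : ℝ≥0∞ := ∑' j, ‖⟪x j, v⟫_ℂ‖ₑ ^ 2

theorem enorm_sq_eq_ofReal {E : Type*} [NormedAddCommGroup E] (a : E) :
    ‖a‖ₑ ^ 2 = ENNReal.ofReal (‖a‖ ^ 2) := by
  rw [← ofReal_norm, ENNReal.ofReal_pow (norm_nonneg a)]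

/-- In `ℝ≥0∞` the sums over levels, lattice points and generators can be rearranged without
summability conditions. -/
theorem isBesselSeq_iff (x : J → H) :
    IsBesselSeq x ↔ ∃ C : NNReal, ∀ v, besselSum x v ≤ C * ‖v‖ₑ ^ 2 := by
  constructor
  · rintro ⟨M, hM⟩
    refine ⟨M.toNNReal, fun v => ?_⟩
    simp only [besselSum, enorm_sq_eq_ofReal]
    rw [← ENNReal.ofReal_tsum_of_nonneg (fun j => by positivity) (hM v).1,
      show ((M.toNNReal : NNReal) : ℝ≥0∞) = ENNReal.ofReal M from rfl,
      ← ENNReal.ofReal_mul' (by positivity)]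
    exact ENNReal.ofReal_le_ofReal (hM v).2
  · rintro ⟨C, hC⟩
    refine ⟨C, fun v => ?_⟩
    have h := hC v
    simp only [besselSum, enorm_sq_eq_ofReal] at h
    have hC' : (C : ℝ≥0∞) * ENNReal.ofReal (‖v‖ ^ 2) = ENNReal.ofReal (C * ‖v‖ ^ 2) := by
      rw [ENNReal.ofReal_mul C.coe_nonneg, ENNReal.ofReal_coe_nnreal]
    rw [hC'] at h
    have hs : Summable fun j => ‖⟪x j, v⟫_ℂ‖ ^ 2 := by
      have := ENNReal.summable_toReal (ne_top_of_le_ne_top ENNReal.ofReal_ne_top h)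
      simpa only [ENNReal.toReal_ofReal (sq_nonneg _)] using this
    refine ⟨hs, ?_⟩
    rw [← ENNReal.ofReal_tsum_of_nonneg (fun j => by positivity) hs] at h
    exact (ENNReal.ofReal_le_ofReal_iff (by positivity)).1 h

end BesselSum

/-! ### The Bessel property passes to the quasi-affine system. -/

section QuasiBessel

variable {d : ℕ}

theorem IsIntegralMatrix.exists_intMatrix {A : GL (Fin d) ℝ} (hA : IsIntegralMatrix A) :
    ∃ M : Matrix (Fin d) (Fin d) ℤ, A.val = M.map (Int.cast : ℤ → ℝ) := by
  choose M hM using hA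
  exact ⟨Matrix.of M, by ext i j; simp [hM]⟩

theorem matAct_intVec (M : Matrix (Fin d) (Fin d) ℤ) (k : Fin d → ℤ) :
    matAct (M.map (Int.cast : ℤ → ℝ)) (intVec k) = intVec (M.mulVec k) := by
  ext i
  simp [matAct, intVec, Matrix.toLpLin_apply, Matrix.mulVec, dotProduct]

theorem natAbs_det_eq_index (M : Matrix (Fin d) (Fin d) ℤ) (hM : Function.Injective M.mulVec) :
    (M.mulVecLin.range.toAddSubgroup).index = M.det.natAbs := by
  have e := LinearEquiv.ofInjective M.mulVecLin hM
  have h := Submodule.natAbs_det_equiv M.mulVecLin.range (LinearEquiv.ofInjective M.mulVecLin hM)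
  have h2 : M.mulVecLin.range.subtype ∘ₗ
      AddMonoidHom.toIntLinearMap ((LinearEquiv.ofInjective M.mulVecLin hM : _ →+ _))
      = M.mulVecLin := by
    ext x
    rfl
  rw [h2] at h
  rw [show LinearMap.det M.mulVecLin = M.det from LinearMap.det_toLin' M] at h
  exact h.symm

/-- The digits δ are representatives of the cosets of Mℤᵈ, whose index is |det M|. -/
theorem exists_digits (M : Matrix (Fin d) (Fin d) ℤ) (hM : M.det ≠ 0) :
    ∃ (ι : Type) (_ : Fintype ι) (δ : ι → Fin d → ℤ), Fintype.card ι = M.det.natAbs ∧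
      Function.Bijective fun p : ι × (Fin d → ℤ) => δ p.1 + M.mulVec p.2 := by
  have hinj : Function.Injective M.mulVec := by
    intro x y hxy
    have h0 : M.mulVec (x - y) = 0 := by rw [Matrix.mulVec_sub, sub_eq_zero]; exact hxy
    exact sub_eq_zero.1 (Matrix.eq_zero_of_mulVec_eq_zero hM h0)
  set K := M.mulVecLin.range.toAddSubgroup with hK
  have hidx := natAbs_det_eq_index M hinj
  have hfin : K.FiniteIndex := ⟨by rw [hidx]; exact Int.natAbs_ne_zero.2 hM⟩
  have : Fintype ((Fin d → ℤ) ⧸ K) := K.fintypeQuotientOfFiniteIndex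
  have hmem : ∀ y, M.mulVec y ∈ K := fun y => ⟨y, rfl⟩
  refine ⟨(Fin d → ℤ) ⧸ K, this, Quotient.out, ?_, ?_, ?_⟩
  · rw [← hidx, ← Nat.card_eq_fintype_card]
    rfl
  · rintro ⟨a, x⟩ ⟨b, y⟩ hab
    have key : ∀ (a : (Fin d → ℤ) ⧸ K) (x : Fin d → ℤ),
        (QuotientAddGroup.mk (Quotient.out a + M.mulVec x) : (Fin d → ℤ) ⧸ K) = a := by
      intro a x
      rw [QuotientAddGroup.mk_add, (QuotientAddGroup.eq_zero_iff _).2 (hmem x), add_zero]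
      exact QuotientAddGroup.out_eq' a
    have h1 : a = b := by rw [← key a x, ← key b y]; exact congrArg _ hab
    subst h1
    simp only [add_right_inj] at hab
    rw [hinj hab]
  · intro w
    have h1 : -Quotient.out (QuotientAddGroup.mk w : (Fin d → ℤ) ⧸ K) + w ∈ K :=
      QuotientAddGroup.eq.1 (QuotientAddGroup.out_eq' _)
    obtain ⟨x, hx⟩ := h1
    refine ⟨⟨QuotientAddGroup.mk w, x⟩, ?_⟩
    have hx' : M.mulVec x = -Quotient.out (QuotientAddGroup.mk w : (Fin d → ℤ) ⧸ K) + w := hx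
    simp only [hx']
    abel

/-- The squared coefficients at the level `n` of an affine system. -/
def affineLayer (A : GL (Fin d) ℝ) (ψ : L2 d) (n : ℤ) (f : L2 d) : ℝ≥0∞ :=
  besselSum (fun z : Fin d → ℤ => (dilation A ^ n) (translation (intVec z) ψ)) f

/-- The squared coefficients at the level `n` of an oversampled affine system. -/
def quasiLayer (A : GL (Fin d) ℝ) (ψ : L2 d) (n : ℤ) (f : L2 d) : ℝ≥0∞ :=
  besselSum (fun z : Fin d → ℤ => translation (intVec z) ((dilationR A ^ n) ψ)) f

theorem quasiLayer_zero (A : GL (Fin d) ℝ) (ψ : L2 d) (f : L2 d) :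
    quasiLayer A ψ 0 f = affineLayer A ψ 0 f := rfl

theorem affineLayer_add_dilation (A : GL (Fin d) ℝ) (ψ f : L2 d) (n m : ℤ) :
    affineLayer A ψ (n + m) ((dilation A ^ m) f) = affineLayer A ψ n f := by
  refine tsum_congr fun z => ?_
  have h : ∀ g : L2 d, (dilation A ^ (n + m)) g = dilation (A ^ m) ((dilation A ^ n) g) := by
    intro g
    rw [add_comm, zpow_add]
    simp only [dilation_zpow]
    rfl
  simp only [h]
  rw [dilation_zpow A m, inner_dilation_dilation]

/-- Moved across the dilation, the translation by a becomes the translation by Aⁿa = k, which only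
relabels the lattice. -/
theorem affineLayer_translation (A : GL (Fin d) ℝ) (ψ f : L2 d) (n : ℤ) (k : Fin d → ℤ) (a : Rd d)
    (ha : matAct (A ^ n).val a = intVec k) :
    affineLayer A ψ n (translation (-a) f) = affineLayer A ψ n f := by
  rw [affineLayer, besselSum, affineLayer, besselSum,
    ← (Equiv.addLeft k).tsum_eq fun z => ‖⟪(dilation A ^ n) (translation (intVec z) ψ), f⟫_ℂ‖ₑ ^ 2]
  refine tsum_congr fun z => ?_
  rw [← inner_translation_left, dilation_zpow, translation_dilation, translation_translation, ha,
    Equiv.coe_addLeft, intVec_add]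

theorem dilationR_zpow_succ (A : GL (Fin d) ℝ) (ψ : L2 d) (n : ℤ) :
    (dilationR A ^ (n + 1)) ψ
      = ((Real.sqrt |A.val.det| : ℝ) : ℂ) • dilation A ((dilationR A ^ n) ψ) := by
  rw [← dilationR_eq, add_comm, zpow_add, zpow_one]
  rfl

/-- Applying D_A inside the inner product raises the level by one and replaces the lattice by A⁻¹ℤᵈ,
a union of the cosets A⁻¹δᵢ + ℤᵈ, one for each i. The factor |det A| comes from the two
normalizations of dilation. -/
theorem quasiLayer_pred {A : GL (Fin d) ℝ} {M : Matrix (Fin d) (Fin d) ℤ}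
    (hA : A.val = M.map (Int.cast : ℤ → ℝ)) {ι : Type} [Fintype ι] {δ : ι → Fin d → ℤ}
    (hδ : Function.Bijective fun p : ι × (Fin d → ℤ) => δ p.1 + M.mulVec p.2)
    (ψ f : L2 d) (n : ℤ) :
    ENNReal.ofReal |A.val.det| * quasiLayer A ψ n f
      = ∑ i, quasiLayer A ψ (n + 1)
        (translation (-matAct (A⁻¹).val (intVec (δ i))) (dilation A f)) := by
  rw [quasiLayer, besselSum, ← (Equiv.ofBijective _ hδ).tsum_eq, ENNReal.tsum_prod_mk,
    tsum_fintype, Finset.mul_sum]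
  refine Finset.sum_congr rfl fun i _ => ?_
  rw [quasiLayer, besselSum, ← ENNReal.tsum_mul_left]
  refine tsum_congr fun z => ?_
  have h1 : matAct (A⁻¹).val (intVec (M.mulVec z)) = intVec z := by
    rw [← matAct_intVec, ← hA, matAct_inv_matAct]
  rw [← inner_translation_left, translation_translation, dilationR_zpow_succ, map_smul,
    inner_smul_left, Equiv.ofBijective_apply, ← inner_dilation_dilation A, dilation_translation,
    intVec_add, map_add, h1, enorm_mul, mul_pow]
  congr 1
  rw [Complex.conj_ofReal, enorm_sq_eq_ofReal, Complex.norm_real, Real.norm_eq_abs, sq_abs,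
    Real.sq_sqrt (abs_nonneg _)]

theorem abs_det_eq_natAbs {A : GL (Fin d) ℝ} {M : Matrix (Fin d) (Fin d) ℤ}
    (hA : A.val = M.map (Int.cast : ℤ → ℝ)) : |A.val.det| = (M.det.natAbs : ℝ) := by
  have : A.val.det = ((M.det : ℤ) : ℝ) := by
    rw [hA]
    exact ((Int.castRingHom ℝ).map_det M).symm
  rw [this, Nat.cast_natAbs, Int.cast_abs]

/-- Induction on the number of negative levels. Up to the factor |det A|, the levels of f are sums
over digits of the levels, one higher, of functions gᵢ of the same norm. Thus N + 1 negative levels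
of f become N negative levels of the gᵢ, and averaging over exactly |det A| digits keeps the
constant C. -/
theorem quasi_bound {A : GL (Fin d) ℝ} (hint : IsIntegralMatrix A) {ψ : L2 d} {C : NNReal}
    (hC : ∀ f, ∑' n : ℕ, affineLayer A ψ n f ≤ C * ‖f‖ₑ ^ 2) (N : ℕ) (f : L2 d) :
    ∑' n : ℕ, affineLayer A ψ n f + ∑ m ∈ Finset.range N, quasiLayer A ψ (-(m + 1 : ℕ)) f
      ≤ C * ‖f‖ₑ ^ 2 := by
  obtain ⟨M, hM⟩ := hint.exists_intMatrix
  have hdet : M.det ≠ 0 := by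
    intro h0
    have := abs_det_eq_natAbs hM
    rw [h0, Int.natAbs_zero, Nat.cast_zero] at this
    exact abs_det_ne_zero A this
  obtain ⟨ι, hι, δ, hcard, hδ⟩ := exists_digits M hdet
  have hcard' : ENNReal.ofReal |A.val.det| = (Fintype.card ι : ℝ≥0∞) := by
    rw [abs_det_eq_natAbs hM, hcard, ENNReal.ofReal_natCast]
  have hpos : (Fintype.card ι : ℝ≥0∞) ≠ 0 := by
    rw [← hcard']
    simpa using abs_det_pos A
  induction N generalizing f with
  | zero => simpa using hC f
  | succ N ih =>
    set g : ι → L2 d := fun i =>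
      translation (-matAct (A⁻¹).val (intVec (δ i))) (dilation A f) with hg
    have hgn : ∀ i, ‖g i‖ₑ = ‖f‖ₑ := fun i => by
      rw [← ofReal_norm, ← ofReal_norm, hg, norm_translation, norm_dilation]
    have haff : ∀ (n : ℕ) (i : ι), affineLayer A ψ (n + 1 : ℕ) (g i) = affineLayer A ψ n f := by
      intro n i
      -- At level n + 1 ≥ 1 the translation by A⁻¹δᵢ is an integer shift Aⁿδᵢ, so the levels n ≥ 0
      -- of f are seen unchanged by every gᵢ.
      have h1 : matAct (A ^ ((n + 1 : ℕ) : ℤ)).val (matAct (A⁻¹).val (intVec (δ i)))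
          = intVec ((M ^ n).mulVec (δ i)) := by
        have h2 : A ^ ((n + 1 : ℕ) : ℤ) = A ^ n * A := by rw [zpow_natCast, pow_succ]
        rw [h2, Units.val_mul, matAct_mul, matAct_matAct_inv, Units.val_pow_eq_pow_val, hM,
          ← matAct_intVec]
        congr 2
        exact (map_pow (Int.castRingHom ℝ).mapMatrix M n).symm
      rw [hg, affineLayer_translation A ψ _ _ _ _ h1]
      have := affineLayer_add_dilation A ψ f n 1
      rw [zpow_one] at this
      exact_mod_cast this
    have hq : ∀ m : ℕ, (Fintype.card ι : ℝ≥0∞) * quasiLayer A ψ (-(m + 1 : ℕ)) f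
        = ∑ i, quasiLayer A ψ (-m) (g i) := by
      intro m
      rw [← hcard', quasiLayer_pred hM hδ]
      simp [hg]
    have key : (Fintype.card ι : ℝ≥0∞) * (∑' n : ℕ, affineLayer A ψ n f
        + ∑ m ∈ Finset.range (N + 1), quasiLayer A ψ (-(m + 1 : ℕ)) f)
        = ∑ i, (∑' n : ℕ, affineLayer A ψ n (g i)
          + ∑ m ∈ Finset.range N, quasiLayer A ψ (-(m + 1 : ℕ)) (g i)) := by
      have h3 : ∀ i, ∑' n : ℕ, affineLayer A ψ n (g i)
          = affineLayer A ψ 0 (g i) + ∑' n : ℕ, affineLayer A ψ n f := by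
        intro i
        rw [tsum_eq_zero_add' ENNReal.summable]
        simp only [haff, Nat.cast_zero]
      simp only [h3, mul_add, Finset.mul_sum, hq, Finset.sum_add_distrib, Finset.sum_const,
        Finset.card_univ, nsmul_eq_mul]
      -- The negative level nearest to 0 is raised to level 0, where it supplies the term
      -- `affineLayer A ψ 0 (g i)` that the shifted affine levels leave out.
      rw [Finset.sum_range_succ', Finset.sum_comm]
      simp only [Nat.cast_zero, neg_zero, quasiLayer_zero]
      ring
    have hfin : (Fintype.card ι : ℝ≥0∞) * (∑' n : ℕ, affineLayer A ψ n f
        + ∑ m ∈ Finset.range (N + 1), quasiLayer A ψ (-(m + 1 : ℕ)) f)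
        ≤ (Fintype.card ι : ℝ≥0∞) * (C * ‖f‖ₑ ^ 2) := by
      rw [key]
      refine (Finset.sum_le_sum fun i _ => ih (g i)).trans_eq ?_
      simp [hgn]
    exact (ENNReal.mul_le_mul_iff_right hpos (ENNReal.natCast_ne_top _)).1 hfin

variable {r : ℕ}

theorem besselSum_affineSystem (A : GL (Fin d) ℝ) (Ψ : Fin r → L2 d) (f : L2 d) :
    besselSum (affineSystem A Ψ) f = ∑ i, ∑' n : ℤ, affineLayer A (Ψ i) n f := by
  rw [besselSum, ENNReal.tsum_prod_mk, ← tsum_fintype (L := .unconditional _)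
    (fun i => ∑' n : ℤ, affineLayer A (Ψ i) n f),
    ENNReal.tsum_comm (f := fun i n => affineLayer A (Ψ i) n f)]
  refine tsum_congr fun n => ?_
  rw [ENNReal.tsum_prod_mk, ENNReal.tsum_comm]
  rfl

theorem besselSum_quasiAffineSystem (A : GL (Fin d) ℝ) (Ψ : Fin r → L2 d) (f : L2 d) :
    besselSum (quasiAffineSystem A Ψ) f
      = ∑ i, ∑' n : ℤ, if 0 ≤ n then affineLayer A (Ψ i) n f else quasiLayer A (Ψ i) n f := by
  rw [besselSum, ENNReal.tsum_prod_mk, ← tsum_fintype (L := .unconditional _) (fun i => ∑' n : ℤ,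
    if 0 ≤ n then affineLayer A (Ψ i) n f else quasiLayer A (Ψ i) n f),
    ENNReal.tsum_comm (f := fun i n =>
      if 0 ≤ n then affineLayer A (Ψ i) n f else quasiLayer A (Ψ i) n f)]
  refine tsum_congr fun n => ?_
  rw [ENNReal.tsum_prod_mk, ENNReal.tsum_comm]
  refine tsum_congr fun i => ?_
  simp only [affineLayer, quasiLayer, besselSum, quasiAffineSystem]
  split_ifs <;> rfl

theorem isBesselSeq_quasiAffineSystem {A : GL (Fin d) ℝ} (hint : IsIntegralMatrix A)
    {Ψ : Fin r → L2 d} (h : IsBesselSeq (affineSystem A Ψ)) :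
    IsBesselSeq (quasiAffineSystem A Ψ) := by
  rw [isBesselSeq_iff] at h ⊢
  obtain ⟨C, hC⟩ := h
  refine ⟨r * C, fun f => ?_⟩
  have h1 : ∀ i f, ∑' n : ℕ, affineLayer A (Ψ i) n f ≤ C * ‖f‖ₑ ^ 2 := by
    intro i f
    refine le_trans ?_ (hC f)
    rw [besselSum_affineSystem]
    refine le_trans ?_ (Finset.single_le_sum (f := fun i => ∑' n : ℤ, affineLayer A (Ψ i) n f)
      (fun _ _ => zero_le) (Finset.mem_univ i))
    exact ENNReal.tsum_comp_le_tsum_of_injective Nat.cast_injective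
      (fun n : ℤ => affineLayer A (Ψ i) n f)
  have h2 : ∀ i, (∑' n : ℤ, if 0 ≤ n then affineLayer A (Ψ i) n f else quasiLayer A (Ψ i) n f)
      ≤ C * ‖f‖ₑ ^ 2 := by
    intro i
    have h3 : ∀ n : ℕ, ¬ (0 : ℤ) ≤ -(n + 1 : ℤ) := fun n => by omega
    rw [tsum_of_nat_of_neg_add_one ENNReal.summable ENNReal.summable]
    simp only [Int.natCast_nonneg, if_true, h3, if_false]
    rw [ENNReal.tsum_eq_iSup_nat (f := fun n : ℕ => quasiLayer A (Ψ i) (-(n + 1 : ℤ)) f),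
      ENNReal.add_iSup]
    refine iSup_le fun N => ?_
    exact_mod_cast quasi_bound hint (h1 i) N f
  rw [besselSum_quasiAffineSystem]
  refine (Finset.sum_le_sum fun i _ => h2 i).trans_eq ?_
  simp [mul_assoc]

end QuasiBessel

/-! ### Bounds for the Calderón sum. -/

section Calderon

variable {d : ℕ}

theorem memLp_fourier_adjPow (A : GL (Fin d) ℝ) (ψ : L2 d) (j : ℤ) :
    MemLp (fun ξ => (𝓕 ψ : L2 d) (adjPow A j ξ)) 2 volume :=
  memLp_comp_matAct (glTranspose (A ^ j)) (𝓕 ψ : L2 d)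

theorem measurable_fourier_adjPow (A : GL (Fin d) ℝ) (ψ : L2 d) (j : ℤ) :
    Measurable (fun ξ => (𝓕 ψ : L2 d) (adjPow A j ξ)) :=
  (Lp.stronglyMeasurable (𝓕 ψ : L2 d)).measurable.comp (continuous_adjPow A j).measurable

/-- Two distinct points of one unit cell never differ by an integer vector, so only the shift 0
survives in the expansion of the level. -/
theorem quasiLayer_of_indicator (A : GL (Fin d) ℝ) (ψ : L2 d) (n : ℤ) {E : Set (Rd d)}
    (hE : MeasurableSet E) {k : Fin d → ℤ}
    (hk : E ⊆ (fun x : Rd d => x - intVec k) ⁻¹' unitCube d) {f : L2 d} (hf : IsBandLimited f)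
    (hfE : (𝓕 f : L2 d) =ᵐ[volume] E.indicator fun _ => 1) :
    quasiLayer A ψ n f = ∫⁻ ξ in E, ‖(𝓕 ψ : L2 d) (adjPow A (-n) ξ)‖ₑ ^ 2 := by
  have h := hasSum_translates_dilationR A (ψ := ψ) (φ := ψ) hf hf n
  have hzero : ∀ l : Fin d → ℤ, l ≠ 0 → shiftPairing A ψ ψ f f n (intVec l) = 0 := by
    intro l hl
    refine integral_eq_zero_of_ae ?_
    filter_upwards [ae_comp_add_right hfE (intVec l), hfE] with ξ h1 h2
    rw [h1, h2]
    have : ξ ∉ E ∨ ξ + intVec l ∉ E := by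
      by_contra hcon
      push Not at hcon
      have h3 := hk hcon.1
      have h4 := hk hcon.2
      refine Set.disjoint_left.1 (disjoint_cells (show k ≠ k - l from fun h => hl ?_)) h3 ?_
      · funext i
        have := congrFun h i
        simp only [Pi.sub_apply] at this
        simp only [Pi.zero_apply]
        omega
      · simp only [Set.mem_preimage, intVec_sub] at h4 ⊢
        convert! h4 using 1
        abel
    rcases this with h3 | h3 <;> simp [Set.indicator_of_notMem h3]
  rw [tsum_eq_single 0 hzero] at h
  have hS : shiftPairing A ψ ψ f f n (intVec 0)
      = ((∫ ξ in E, ‖(𝓕 ψ : L2 d) (adjPow A (-n) ξ)‖ ^ 2 : ℝ) : ℂ) := by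
    rw [← integral_indicator hE, ← integral_complex_ofReal, shiftPairing]
    refine integral_congr_ae ?_
    filter_upwards [hfE] with ξ h2
    simp only [intVec_zero, add_zero]
    rw [h2]
    by_cases hξ : ξ ∈ E
    · simp [hξ, crossTerm, Complex.mul_conj, Complex.normSq_eq_norm_sq]
    · simp [hξ]
  have hterm : ∀ x : L2 d, ⟪x, f⟫_ℂ * ⟪f, x⟫_ℂ = ((‖⟪x, f⟫_ℂ‖ ^ 2 : ℝ) : ℂ) := by
    intro x
    rw [← inner_conj_symm f x, Complex.mul_conj, Complex.normSq_eq_norm_sq]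
  rw [hS] at h
  simp only [hterm] at h
  have h' := Complex.hasSum_ofReal.1 h
  rw [quasiLayer, besselSum]
  simp only [enorm_sq_eq_ofReal]
  rw [← ENNReal.ofReal_tsum_of_nonneg (fun _ => by positivity) h'.summable, h'.tsum_eq,
    ofReal_integral_eq_lintegral_ofReal _ (.of_forall fun _ => by positivity)]
  exact ((memLp_two_iff_integrable_sq_norm
    (measurable_fourier_adjPow A ψ (-n)).aestronglyMeasurable).1
    (memLp_fourier_adjPow A ψ (-n))).integrableOn

theorem norm_le_of_mem_cell {k : Fin d → ℤ} :
    ∃ R : ℝ, ∀ x : Rd d, x - intVec k ∈ unitCube d → ‖x‖ ≤ R := by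
  have hb : Bornology.IsBounded (unitCube d) := by
    refine (Metric.isBounded_closedBall (x := (0 : Rd d)) (r := Real.sqrt d)).subset fun x hx => ?_
    rw [mem_closedBall_zero_iff, EuclideanSpace.norm_eq]
    refine Real.sqrt_le_sqrt ?_
    refine (Finset.sum_le_sum (g := fun _ => (1 : ℝ)) fun i _ => ?_).trans_eq (by simp)
    have := hx i
    rw [Real.norm_eq_abs, sq_abs]
    nlinarith [this.1, this.2]
  obtain ⟨R, hR⟩ := hb.subset_closedBall 0
  refine ⟨R + ‖intVec k‖, fun x hx => ?_⟩
  have h1 := hR hx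
  rw [mem_closedBall_zero_iff] at h1
  calc ‖x‖ = ‖x - intVec k + intVec k‖ := by rw [sub_add_cancel]
    _ ≤ _ := (norm_add_le _ _).trans (by gcongr)

theorem ae_of_ae_cells {p : Rd d → Prop}
    (h : ∀ k : Fin d → ℤ,
      ∀ᵐ x ∂volume.restrict ((fun x : Rd d => x - intVec k) ⁻¹' unitCube d), p x) :
    ∀ᵐ x, p x := by
  rw [← Measure.restrict_univ (μ := (volume : Measure (Rd d))), ← iUnion_cells,
    ae_restrict_iUnion_iff]
  exact h

/-- With f^ the indicator of E inside one cell, the hypothesis says that the sum has integral at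
most C|E| over E; as E is arbitrary, the sum is at most C almost everywhere. -/
theorem ae_tsum_nat_le {A : GL (Fin d) ℝ} {ψ : L2 d} {C : NNReal}
    (hC : ∀ f, ∑' m : ℕ, quasiLayer A ψ (-m) f ≤ C * ‖f‖ₑ ^ 2) :
    ∀ᵐ ξ : Rd d, ∑' m : ℕ, ‖(𝓕 ψ : L2 d) (adjPow A m ξ)‖ₑ ^ 2 ≤ C := by
  refine ae_of_ae_cells fun k => ?_
  have hmeas : ∀ m : ℕ, Measurable fun ξ => ‖(𝓕 ψ : L2 d) (adjPow A m ξ)‖ₑ ^ 2 := fun m =>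
    (measurable_fourier_adjPow A ψ m).enorm.pow_const 2
  refine ae_le_of_forall_setLIntegral_le_of_sigmaFinite (Measurable.tsum hmeas)
    fun s hs _ => ?_
  rw [Measure.restrict_restrict hs]
  set E := s ∩ (fun x : Rd d => x - intVec k) ⁻¹' unitCube d
  have hE : MeasurableSet E := hs.inter (measurableSet_cell k)
  obtain ⟨R, hR⟩ := norm_le_of_mem_cell (k := k)
  have hRE : ∀ ξ, R < ‖ξ‖ → E.indicator (fun _ => (1 : ℂ)) ξ = 0 := by
    intro ξ hξ
    refine Set.indicator_of_notMem (fun hmem => ?_) _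
    exact absurd (hR ξ hmem.2) (not_le.2 hξ)
  obtain ⟨f, hf, hfE⟩ := exists_isBandLimited (h := E.indicator fun _ => (1 : ℂ)) (C := 1)
    (measurable_const.indicator hE) (fun ξ => by
      by_cases hξ : ξ ∈ E <;> simp [hξ]) hRE
  have h1 := hC f
  have hlayer : ∀ m : ℕ, quasiLayer A ψ (-m) f
      = ∫⁻ ξ in E, ‖(𝓕 ψ : L2 d) (adjPow A m ξ)‖ₑ ^ 2 := by
    intro m
    rw [quasiLayer_of_indicator A ψ (-m) hE Set.inter_subset_right hf hfE, neg_neg]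
  simp only [hlayer] at h1
  rw [← lintegral_tsum fun m => (hmeas m).aemeasurable] at h1
  refine h1.trans_eq ?_
  rw [lintegral_const, Measure.restrict_apply_univ]
  congr 1
  have h2 : ‖f‖ₑ ^ 2 = eLpNorm (E.indicator fun _ => (1 : ℂ)) 2 volume ^ 2 := by
    rw [← ofReal_norm, ← Lp.norm_fourier_eq f, ofReal_norm, Lp.enorm_def, eLpNorm_congr_ae hfE]
  rw [h2, eLpNorm_indicator_const hE (by norm_num) (by norm_num), enorm_one, one_mul,
    ← ENNReal.rpow_natCast, ← ENNReal.rpow_mul]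
  norm_num

/-- The Calderón sum of a system with bounded quasi-affine coefficients is bounded. -/
theorem ae_tsum_int_le {A : GL (Fin d) ℝ} {ψ : L2 d} {C : NNReal}
    (hC : ∀ f, ∑' m : ℕ, quasiLayer A ψ (-m) f ≤ C * ‖f‖ₑ ^ 2) :
    ∀ᵐ ξ : Rd d, ∑' j : ℤ, ‖(𝓕 ψ : L2 d) (adjPow A j ξ)‖ₑ ^ 2 ≤ C := by
  -- The one-sided bound at A*^(-N) ξ controls the indices j ≥ -N at ξ with the same constant; then
  -- take the supremum over N.
  have h : ∀ᵐ ξ : Rd d, ∀ N : ℕ,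
      ∑' m : ℕ, ‖(𝓕 ψ : L2 d) (adjPow A m (adjPow A (-N) ξ))‖ₑ ^ 2 ≤ C :=
    ae_all_iff.2 fun N => (quasiMeasurePreserving_adjPow A (-N)).ae (ae_tsum_nat_le hC)
  filter_upwards [h] with ξ hξ
  set g : ℤ → ℝ≥0∞ := fun j => ‖(𝓕 ψ : L2 d) (adjPow A j ξ)‖ₑ ^ 2
  have hg : ∀ N : ℕ, ∑' m : ℕ, g m + ∑ m ∈ Finset.range N, g (-(m + 1 : ℤ))
      = ∑' m : ℕ, g (m - N) := by
    intro N
    induction N with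
    | zero => simp
    | succ N ih =>
      rw [Finset.sum_range_succ, ← add_assoc, ih]
      rw [tsum_eq_zero_add' (f := fun m : ℕ => g (m - (N + 1 : ℕ))) ENNReal.summable, add_comm]
      congr 1
      refine tsum_congr fun m => ?_
      congr 1
      push_cast
      ring
  rw [tsum_of_nat_of_neg_add_one (f := g) ENNReal.summable ENNReal.summable,
    ENNReal.tsum_eq_iSup_nat (f := fun n : ℕ => g (-(n + 1 : ℤ))), ENNReal.add_iSup]
  refine iSup_le fun N => ?_
  rw [hg N]
  refine le_trans (le_of_eq (tsum_congr fun m => ?_)) (hξ N)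
  rw [adjPow_adjPow, ← sub_eq_add_neg]

end Calderon

/-! ### Decomposition of the quasi-affine Gramian into frequency shifts. -/

section Frequency

variable {d r : ℕ}

theorem adjPow_natCast_intVec {A : GL (Fin d) ℝ} (hint : IsIntegralMatrix A) (n : ℕ) :
    ∃ m : (Fin d → ℤ) → Fin d → ℤ, ∀ l, adjPow A n (intVec l) = intVec (m l) := by
  obtain ⟨M, hM⟩ := hint.exists_intMatrix
  refine ⟨(M ^ n).transpose.mulVec, fun l => ?_⟩
  rw [← matAct_intVec, adjPow]
  congr 2
  rw [zpow_natCast, Units.val_pow_eq_pow_val, hM, Matrix.transpose_map]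
  exact congrArg Matrix.transpose (map_pow (Int.castRingHom ℝ).mapMatrix M n).symm

/-- A product is at most the sum of the two squares, and the shift by a preserves null sets. -/
theorem ae_tsum_crossTerm_le {A : GL (Fin d) ℝ} {φ ψ : L2 d} {C C' : NNReal}
    (hφ : ∀ᵐ ξ : Rd d, ∑' j : ℤ, ‖(𝓕 φ : L2 d) (adjPow A j ξ)‖ₑ ^ 2 ≤ C)
    (hψ : ∀ᵐ ξ : Rd d, ∑' j : ℤ, ‖(𝓕 ψ : L2 d) (adjPow A j ξ)‖ₑ ^ 2 ≤ C') (a : Rd d) :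
    ∀ᵐ ξ : Rd d, ∑' j : ℤ, ‖crossTerm A φ ψ j ξ (ξ + a)‖ₑ ≤ C + C' := by
  filter_upwards [hφ, (measurePreserving_add_right volume a).quasiMeasurePreserving.ae hψ]
    with ξ h1 h2
  refine le_trans ?_ (add_le_add h1 h2)
  rw [← ENNReal.tsum_add]
  refine ENNReal.tsum_le_tsum fun j => ?_
  rw [crossTerm, enorm_mul, RCLike.enorm_conj]
  rcases le_total (‖(𝓕 φ : L2 d) (adjPow A j ξ)‖ₑ) (‖(𝓕 ψ : L2 d) (adjPow A j (ξ + a))‖ₑ)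
    with h | h
  · refine le_trans (mul_le_mul_left h _) ?_
    rw [← sq]
    exact le_add_self
  · refine le_trans (mul_le_mul_right h _) ?_
    rw [← sq]
    exact le_self_add

theorem summable_of_tsum_enorm_le {ι : Type*} {u : ι → ℂ} {C : ℝ≥0∞} (hC : C ≠ ∞)
    (h : ∑' j, ‖u j‖ₑ ≤ C) : Summable u := by
  have h1 := ENNReal.summable_toReal (ne_top_of_le_ne_top hC h)
  simp only [toReal_enorm] at h1
  exact h1.of_norm

theorem measurable_crossTerm (A : GL (Fin d) ℝ) (φ ψ : L2 d) (j : ℤ) (a : Rd d) :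
    Measurable fun ξ => crossTerm A φ ψ j ξ (ξ + a) :=
  (Complex.continuous_conj.measurable.comp (measurable_fourier_adjPow A φ j)).mul
    ((measurable_fourier_adjPow A ψ j).comp (measurable_add_const a))

theorem integrable_shift_mul_conj (f g : L2 d) (a : Rd d) :
    Integrable fun ξ => (𝓕 f : L2 d) (ξ + a) * conj ((𝓕 g : L2 d) ξ) :=
  ((Lp.memLp (𝓕 f : L2 d)).comp_measurePreserving
    (measurePreserving_add_right volume a)).integrable_mul (Lp.memLp (𝓕 g : L2 d)).star

/-- Exchange of sum and integral: the absolute sums over the scales are at most C times the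
integrable product of f^ and conj g^, whichever set of scales is selected. -/
theorem hasSum_indicator_shiftPairing {A : GL (Fin d) ℝ} {φ ψ : L2 d} {C : NNReal} {a : Rd d}
    (h : ∀ᵐ ξ : Rd d, ∑' j : ℤ, ‖crossTerm A φ ψ j ξ (ξ + a)‖ₑ ≤ C) (f g : L2 d) (s : Set ℤ) :
    HasSum (s.indicator fun n => shiftPairing A ψ φ f g n a)
      (∫ ξ, (∑' n : ℤ, s.indicator (fun n => conj (crossTerm A φ ψ (-n) ξ (ξ + a))) n)
        * ((𝓕 f : L2 d) (ξ + a) * conj ((𝓕 g : L2 d) ξ))) := by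
  set w : Rd d → ℂ := fun ξ => (𝓕 f : L2 d) (ξ + a) * conj ((𝓕 g : L2 d) ξ) with hw
  have hwi : Integrable w := integrable_shift_mul_conj f g a
  set F : ℤ → Rd d → ℂ := fun n ξ =>
    s.indicator (fun n => conj (crossTerm A φ ψ (-n) ξ (ξ + a))) n * w ξ with hF
  have hFm : ∀ n, AEStronglyMeasurable (F n) volume := by
    intro n
    refine AEStronglyMeasurable.mul (Measurable.aestronglyMeasurable ?_) hwi.1
    by_cases hn : n ∈ s
    · simp only [Set.indicator_of_mem hn]
      exact Complex.continuous_conj.measurable.comp (measurable_crossTerm A φ ψ (-n) a)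
    · simp only [Set.indicator_of_notMem hn]
      exact measurable_const
  have hle : ∀ n ξ, ‖F n ξ‖ₑ ≤ ‖crossTerm A φ ψ (-n) ξ (ξ + a)‖ₑ * ‖w ξ‖ₑ := by
    intro n ξ
    rw [hF, enorm_mul]
    refine mul_le_mul_left ?_ _
    by_cases hn : n ∈ s
    · rw [Set.indicator_of_mem hn, RCLike.enorm_conj]
    · rw [Set.indicator_of_notMem hn, enorm_zero]
      exact zero_le
  have hsum : ∑' n, ∫⁻ ξ, ‖F n ξ‖ₑ ≠ ∞ := by
    rw [← lintegral_tsum fun n => (hFm n).enorm]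
    have hb : ∫⁻ ξ, ∑' n, ‖F n ξ‖ₑ ≤ ∫⁻ ξ, C * ‖w ξ‖ₑ := by
      refine lintegral_mono_ae ?_
      filter_upwards [h] with ξ hξ
      refine (ENNReal.tsum_le_tsum fun n => hle n ξ).trans ?_
      have hneg := (Equiv.neg ℤ).tsum_eq fun j => ‖crossTerm A φ ψ j ξ (ξ + a)‖ₑ
      simp only [Equiv.neg_apply] at hneg
      rw [ENNReal.tsum_mul_right, hneg]
      exact mul_le_mul_left hξ _
    refine ne_top_of_le_ne_top ?_ hb
    rw [lintegral_const_mul' _ _ ENNReal.coe_ne_top]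
    exact ENNReal.mul_ne_top ENNReal.coe_ne_top hwi.2.ne
  have hFi : ∀ n, Integrable (F n) := fun n => ⟨hFm n, lt_top_iff_ne_top.2
    (ne_top_of_le_ne_top hsum (ENNReal.le_tsum n))⟩
  have hFs : Summable fun n => ∫ ξ, ‖F n ξ‖ := by
    have := ENNReal.summable_toReal hsum
    refine this.congr fun n => ?_
    rw [integral_norm_eq_lintegral_enorm (hFm n)]
  have key := hasSum_integral_of_summable_integral_norm hFi hFs
  refine key.of_eq (fun n => ?_) ?_
  · by_cases hn : n ∈ s
    · simp only [hF, Set.indicator_of_mem hn]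
      rfl
    · simp [hF, Set.indicator_of_notMem hn]
  · simp only [hF, tsum_mul_right, hw]

/-- The scales `n` at which the quasi-affine system carries the frequency shift `k`. -/
def activeScales (A : GL (Fin d) ℝ) (k : Fin d → ℤ) : Set ℤ :=
  {n | n ≤ 0 ∨ ∃ l, adjPow A n (intVec l) = intVec k}

/-- The frequency-shift component of the quasi-affine mixed Gramian at the shift `k`. -/
def shiftComponent (A : GL (Fin d) ℝ) (Ψ Φ : Fin r → L2 d) (f g : L2 d) (k : Fin d → ℤ) : ℂ :=
  ∑' n : ℤ, (activeScales A k).indicator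
    (fun n => ∑ i, shiftPairing A (Ψ i) (Φ i) f g n (intVec k)) n

theorem shiftComponent_translation (A : GL (Fin d) ℝ) (Ψ Φ : Fin r → L2 d) (f g : L2 d)
    (k : Fin d → ℤ) (β : Rd d) :
    shiftComponent A Ψ Φ (translation β f) (translation β g) k
      = expo (-β) (intVec k) * shiftComponent A Ψ Φ f g k := by
  rw [shiftComponent, shiftComponent, ← tsum_mul_left]
  refine tsum_congr fun n => ?_
  by_cases hn : n ∈ activeScales A k
  · simp only [Set.indicator_of_mem hn, shiftPairing_translation, Finset.mul_sum]
  · simp only [Set.indicator_of_notMem hn, mul_zero]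

/-- This is where the definition of `activeScales` pays off: the scales 0 < n ≤ N, not covered by n
≤ 0, are active at A*^N k because A*^N k = A*ⁿ(A*^(N-n) k) with an integer vector inside. -/
theorem mem_activeScales_dilation {A : GL (Fin d) ℝ} (hint : IsIntegralMatrix A) {N : ℕ}
    {k k' : Fin d → ℤ} (hk : adjPow A N (intVec k) = intVec k') (n : ℤ) :
    n ∈ activeScales A k' ↔ n - N ∈ activeScales A k := by
  simp only [activeScales, Set.mem_ofPred_eq]
  have h1 : ∀ l, adjPow A n (intVec l) = intVec k' ↔ adjPow A (n - N) (intVec l) = intVec k := by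
    intro l
    rw [← hk, ← (adjPow_injective A N).eq_iff (a := adjPow A (n - N) (intVec l)), adjPow_adjPow,
      add_sub_cancel]
  simp only [h1]
  constructor
  · rintro (h | h)
    · left; omega
    · exact Or.inr h
  · rintro (h | h)
    · rcases le_or_gt n 0 with h0 | h0
      · exact Or.inl h0
      · right
        obtain ⟨m, hm⟩ := adjPow_natCast_intVec hint (N - n).toNat
        refine ⟨m k, ?_⟩
        rw [← hm, adjPow_adjPow, Int.toNat_of_nonneg (by omega)]
        rw [show n - N + (N - n) = 0 by ring, adjPow_zero]
    · exact Or.inr h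

theorem shiftComponent_dilation {A : GL (Fin d) ℝ} (hint : IsIntegralMatrix A) {N : ℕ}
    {k k' : Fin d → ℤ} (hk : adjPow A N (intVec k) = intVec k') (Ψ Φ : Fin r → L2 d)
    (f g : L2 d) :
    shiftComponent A Ψ Φ ((dilation A ^ (N : ℤ)) f) ((dilation A ^ (N : ℤ)) g) k'
      = shiftComponent A Ψ Φ f g k := by
  rw [shiftComponent, shiftComponent, ← (Equiv.subRight (N : ℤ)).tsum_eq fun n =>
    (activeScales A k).indicator (fun n => ∑ i, shiftPairing A (Ψ i) (Φ i) f g n (intVec k)) n]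
  refine tsum_congr fun n => ?_
  rw [Equiv.subRight_apply]
  by_cases hn : n ∈ activeScales A k'
  · rw [Set.indicator_of_mem hn, Set.indicator_of_mem ((mem_activeScales_dilation hint hk n).1 hn)]
    simp only [← hk, shiftPairing_dilation]
  · rw [Set.indicator_of_notMem hn,
      Set.indicator_of_notMem (mt (mem_activeScales_dilation hint hk n).2 hn)]

/-- The coefficient of the mixed Gramian form, as a double series. -/
theorem hasSum_inner_mixedGramian {H J : Type*} [NormedAddCommGroup H] [InnerProductSpace ℂ H]
    [CompleteSpace H] {x y : J → H} (hx : IsBesselSeq x) (hy : IsBesselSeq y) (f g : H) :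
    HasSum (fun j => ⟪x j, f⟫_ℂ * ⟪g, y j⟫_ℂ) ⟪g, mixedGramian hx hy f⟫_ℂ := by
  have := (hasSum_mixedGramian hx hy f).mapL (innerSL ℂ g)
  simpa [inner_smul_right] using this

theorem HasSum.fiberwise_scale {c : ℤ × (Fin d → ℤ) × Fin r → ℂ} {T : ℂ} {L : ℤ → Fin r → ℂ}
    (h : HasSum c T) (hL : ∀ n i, HasSum (fun z => c (n, z, i)) (L n i)) :
    HasSum (fun n => ∑ i, L n i) T := by
  let e : (ℤ × Fin r) × (Fin d → ℤ) ≃ ℤ × (Fin d → ℤ) × Fin r :=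
    { toFun := fun p => (p.1.1, p.2, p.1.2)
      invFun := fun p => ((p.1, p.2.2), p.2.1)
      left_inv := fun _ => rfl
      right_inv := fun _ => rfl }
  have h1 := (e.hasSum_iff.2 h).prod_fiberwise (g := fun p : ℤ × Fin r => L p.1 p.2)
    fun p => hL p.1 p.2
  exact h1.prod_fiberwise fun n => hasSum_fintype _

/-- The indicator of `activeScales` merges the two kinds of levels: every shift occurs at an
oversampled level, only those in A*ⁿℤᵈ at a level n ≥ 0. -/
theorem hasSum_quasi_layer {A : GL (Fin d) ℝ} (hint : IsIntegralMatrix A) (Ψ Φ : Fin r → L2 d)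
    {f g : L2 d} (hf : IsBandLimited f) (hg : IsBandLimited g) {S : Finset (Fin d → ℤ)}
    (hS : ∀ k ∉ S, ∀ n i, shiftPairing A (Ψ i) (Φ i) f g n (intVec k) = 0) (n : ℤ) (i : Fin r) :
    HasSum (fun z => ⟪quasiAffineSystem A Ψ (n, z, i), f⟫_ℂ
        * ⟪g, quasiAffineSystem A Φ (n, z, i)⟫_ℂ)
      (∑ k ∈ S, (activeScales A k).indicator
        (fun n => shiftPairing A (Ψ i) (Φ i) f g n (intVec k)) n) := by
  have hS' : ∀ k ∉ S, (activeScales A k).indicator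
        (fun n => shiftPairing A (Ψ i) (Φ i) f g n (intVec k)) n = 0 := by
    intro k hk
    simp [hS k hk]
  rw [← tsum_eq_sum (L := .unconditional _) hS']
  rcases lt_or_ge n 0 with hn | hn
  · refine (hasSum_translates_dilationR A (ψ := Ψ i) (φ := Φ i) hf hg n).of_eq (fun z => ?_)
      (tsum_congr fun l => ?_)
    · simp [quasiAffineSystem, not_le.2 hn]
    · rw [Set.indicator_of_mem (show n ∈ activeScales A l from Or.inl hn.le)]
  · refine (hasSum_dilation_translates A (ψ := Ψ i) (φ := Φ i) hf hg n).of_eq (fun z => ?_) ?_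
    · simp [quasiAffineSystem, hn]
    · lift n to ℕ using hn
      obtain ⟨m, hm⟩ := adjPow_natCast_intVec hint n
      have hinj : Function.Injective m := by
        intro a b hab
        exact intVec_injective (adjPow_injective A n (by rw [hm, hm, hab]))
      rw [← hinj.tsum_eq (f := fun k => (activeScales A k).indicator
        (fun n => shiftPairing A (Ψ i) (Φ i) f g n (intVec k)) (n : ℤ))]
      · refine tsum_congr fun l => ?_
        rw [Set.indicator_of_mem (show (n : ℤ) ∈ activeScales A (m l) from Or.inr ⟨l, hm l⟩), hm]
      · intro k hk
        have hk' : (n : ℤ) ∈ activeScales A k := Set.mem_of_indicator_ne_zero hk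
        rcases hk' with h0 | ⟨l, hl⟩
        -- Both alternatives of `activeScales` overlap at the scale 0, where every lattice point is
        -- its own preimage.
        · have hn0 : n = 0 := by omega
          subst hn0
          refine ⟨k, intVec_injective ?_⟩
          rw [← hm, Nat.cast_zero, adjPow_zero]
        · exact ⟨l, intVec_injective (by rw [← hm, hl])⟩

theorem exists_finset_shiftPairing_eq_zero (A : GL (Fin d) ℝ) (Ψ Φ : Fin r → L2 d) {f g : L2 d}
    (hf : IsBandLimited f) (hg : IsBandLimited g) :
    ∃ S : Finset (Fin d → ℤ),
      ∀ k ∉ S, ∀ n i, shiftPairing A (Ψ i) (Φ i) f g n (intVec k) = 0 := by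
  obtain ⟨h, R, C, hm, hC, hR, hh⟩ := hf
  obtain ⟨h', R', C', hm', hC', hR', hh'⟩ := hg
  obtain ⟨N, hN⟩ := exists_nat_gt (R + R')
  refine ⟨latticeBox d N, fun k hk n i => shiftPairing_eq_zero hR hh hR' hh' A n ?_⟩
  by_contra hcon
  push Not at hcon
  exact hk (mem_latticeBox_of_norm_le (hcon.trans hN.le))

/-- Uniform boundedness of the Calderón sums of a finite system. -/
def HasCalderonBound (A : GL (Fin d) ℝ) (Ψ : Fin r → L2 d) : Prop :=
  ∃ C : NNReal, ∀ᵐ ξ : Rd d, ∀ i, ∑' j : ℤ, ‖(𝓕 (Ψ i) : L2 d) (adjPow A j ξ)‖ₑ ^ 2 ≤ C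

theorem hasCalderonBound {A : GL (Fin d) ℝ} {Ψ : Fin r → L2 d}
    (h : IsBesselSeq (quasiAffineSystem A Ψ)) : HasCalderonBound A Ψ := by
  obtain ⟨C, hC⟩ := (isBesselSeq_iff _).1 h
  refine ⟨C, ae_all_iff.2 fun i => ae_tsum_int_le fun f => le_trans ?_ (hC f)⟩
  rw [besselSum_quasiAffineSystem]
  refine le_trans ?_ (Finset.single_le_sum (f := fun i => ∑' n : ℤ,
    if 0 ≤ n then affineLayer A (Ψ i) n f else quasiLayer A (Ψ i) n f)
      (fun _ _ => zero_le) (Finset.mem_univ i))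
  refine le_trans (ENNReal.tsum_le_tsum fun m => ?_) (ENNReal.tsum_comp_le_tsum_of_injective
    (f := fun m : ℕ => -(m : ℤ)) (neg_injective.comp Nat.cast_injective) _)
  rcases Nat.eq_zero_or_pos m with rfl | hm
  · simp [quasiLayer_zero]
  · simp [Nat.pos_iff_ne_zero.1 hm]

theorem HasCalderonBound.crossTerm {A : GL (Fin d) ℝ} {Ψ Φ : Fin r → L2 d}
    (hΨ : HasCalderonBound A Ψ) (hΦ : HasCalderonBound A Φ) :
    ∃ C : NNReal, ∀ a : Rd d, ∀ᵐ ξ : Rd d, ∀ i,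
      ∑' j : ℤ, ‖crossTerm A (Φ i) (Ψ i) j ξ (ξ + a)‖ₑ ≤ C := by
  obtain ⟨C, hC⟩ := hΨ
  obtain ⟨C', hC'⟩ := hΦ
  refine ⟨C' + C, fun a => ae_all_iff.2 fun i => ?_⟩
  exact_mod_cast ae_tsum_crossTerm_le (ae_all_iff.1 hC' i) (ae_all_iff.1 hC i) a

theorem summable_indicator_shiftPairing {A : GL (Fin d) ℝ} {Ψ Φ : Fin r → L2 d}
    (hΨ : HasCalderonBound A Ψ) (hΦ : HasCalderonBound A Φ) (f g : L2 d) (a : Rd d) (s : Set ℤ)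
    (i : Fin r) : Summable (s.indicator fun n => shiftPairing A (Ψ i) (Φ i) f g n a) := by
  obtain ⟨C, hC⟩ := hΨ.crossTerm hΦ
  exact (hasSum_indicator_shiftPairing (ae_all_iff.1 (hC a) i) f g s).summable

theorem indicator_finset_sum {ι κ E : Type*} [AddCommMonoid E] [Fintype κ] (s : Set ι)
    (u : κ → ι → E) (n : ι) :
    s.indicator (fun n => ∑ i, u i n) n = ∑ i, s.indicator (u i) n := by
  by_cases hn : n ∈ s <;> simp [hn]

/-- The mixed Gramian of quasi-affine systems is the sum of its frequency-shift components. -/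
theorem inner_quasiGramian {A : GL (Fin d) ℝ} (hint : IsIntegralMatrix A) {Ψ Φ : Fin r → L2 d}
    (hΨ : IsBesselSeq (quasiAffineSystem A Ψ)) (hΦ : IsBesselSeq (quasiAffineSystem A Φ))
    {f g : L2 d} (hf : IsBandLimited f) (hg : IsBandLimited g) {S : Finset (Fin d → ℤ)}
    (hS : ∀ k ∉ S, ∀ n i, shiftPairing A (Ψ i) (Φ i) f g n (intVec k) = 0) :
    ⟪g, mixedGramian hΨ hΦ f⟫_ℂ = ∑ k ∈ S, shiftComponent A Ψ Φ f g k := by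
  have h1 := (hasSum_inner_mixedGramian hΨ hΦ f g).fiberwise_scale
    fun n i => hasSum_quasi_layer hint Ψ Φ hf hg hS n i
  refine h1.unique ?_
  have h2 : ∀ k ∈ S, HasSum (fun n => (activeScales A k).indicator
      (fun n => ∑ i, shiftPairing A (Ψ i) (Φ i) f g n (intVec k)) n)
      (shiftComponent A Ψ Φ f g k) := by
    intro k _
    refine Summable.hasSum ?_
    simp only [indicator_finset_sum]
    exact summable_sum fun i _ => summable_indicator_shiftPairing (hasCalderonBound hΨ)
      (hasCalderonBound hΦ) f g _ _ i
  refine (hasSum_sum h2).of_eq (fun n => ?_) rfl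
  rw [Finset.sum_comm]
  simp only [indicator_finset_sum]

theorem shiftComponent_eq_zero {A : GL (Fin d) ℝ} {Ψ Φ : Fin r → L2 d} {f g : L2 d}
    {S : Finset (Fin d → ℤ)}
    (hS : ∀ k ∉ S, ∀ n i, shiftPairing A (Ψ i) (Φ i) f g n (intVec k) = 0) {k : Fin d → ℤ}
    (hk : k ∉ S) : shiftComponent A Ψ Φ f g k = 0 := by
  simp [shiftComponent, hS k hk]

theorem inner_quasiGramian_translation {A : GL (Fin d) ℝ} (hint : IsIntegralMatrix A)
    {Ψ Φ : Fin r → L2 d} (hΨ : IsBesselSeq (quasiAffineSystem A Ψ))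
    (hΦ : IsBesselSeq (quasiAffineSystem A Φ)) {f g : L2 d} (hf : IsBandLimited f)
    (hg : IsBandLimited g) {S : Finset (Fin d → ℤ)}
    (hS : ∀ k ∉ S, ∀ n i, shiftPairing A (Ψ i) (Φ i) f g n (intVec k) = 0) (β : Rd d) :
    ⟪translation β g, mixedGramian hΨ hΦ (translation β f)⟫_ℂ
      = ∑ k ∈ S, expo (-β) (intVec k) * shiftComponent A Ψ Φ f g k := by
  rw [inner_quasiGramian hint hΨ hΦ (hf.translation β) (hg.translation β) (S := S)]
  · simp only [shiftComponent_translation]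
  · intro k hk n i
    rw [shiftPairing_translation, hS k hk, mul_zero]

/-- For band-limited f and g the integrand is a trigonometric polynomial in β, whose coefficients
are the components. -/
theorem integral_inner_quasiGramian {A : GL (Fin d) ℝ} (hint : IsIntegralMatrix A)
    {Ψ Φ : Fin r → L2 d} (hΨ : IsBesselSeq (quasiAffineSystem A Ψ))
    (hΦ : IsBesselSeq (quasiAffineSystem A Φ)) {f g : L2 d} (hf : IsBandLimited f)
    (hg : IsBandLimited g) (k : Fin d → ℤ) :
    ∫ β in unitCube d, expo (intVec k) β
        * ⟪translation β g, mixedGramian hΨ hΦ (translation β f)⟫_ℂ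
      = shiftComponent A Ψ Φ f g k := by
  classical
  obtain ⟨S, hS⟩ := exists_finset_shiftPairing_eq_zero A Ψ Φ hf hg
  have : IsFiniteMeasure (volume.restrict (unitCube d)) :=
    ⟨by rw [Measure.restrict_apply_univ, volume_unitCube]; exact ENNReal.one_lt_top⟩
  have hint1 : ∀ (l : Fin d → ℤ) (c : ℂ),
      Integrable (fun β => expo (intVec l) β * c) (volume.restrict (unitCube d)) := fun l c =>
    (Integrable.of_bound (by fun_prop) 1 (.of_forall fun β => (norm_expo _ β).le)).mul_const c
  have h1 : ∀ β : Rd d, expo (intVec k) β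
        * ⟪translation β g, mixedGramian hΨ hΦ (translation β f)⟫_ℂ
      = ∑ l ∈ S, expo (intVec (k - l)) β * shiftComponent A Ψ Φ f g l := by
    intro β
    rw [inner_quasiGramian_translation hint hΨ hΦ hf hg hS, Finset.mul_sum]
    refine Finset.sum_congr rfl fun l _ => ?_
    rw [← mul_assoc, expo_comm (-β), sub_eq_add_neg, intVec_add, intVec_neg, expo_add_left,
      expo_neg_left, expo_neg_right]
  simp only [h1]
  rw [integral_finsetSum _ fun l _ => hint1 _ _]
  simp only [integral_mul_const, integral_unitCube_expo, sub_eq_zero, ite_mul, one_mul, zero_mul,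
    Finset.sum_ite_eq]
  split_ifs with hk
  · rfl
  · exact (shiftComponent_eq_zero hS hk).symm

theorem shiftComponent_eq_integral {A : GL (Fin d) ℝ} {Ψ Φ : Fin r → L2 d}
    (hΨ : HasCalderonBound A Ψ) (hΦ : HasCalderonBound A Φ) (f g : L2 d) (k : Fin d → ℤ) :
    shiftComponent A Ψ Φ f g k = ∑ i, ∫ ξ, (∑' n : ℤ, (activeScales A k).indicator
        (fun n => conj (crossTerm A (Φ i) (Ψ i) (-n) ξ (ξ + intVec k))) n)
        * ((𝓕 f : L2 d) (ξ + intVec k) * conj ((𝓕 g : L2 d) ξ)) := by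
  obtain ⟨C, hC⟩ := hΨ.crossTerm hΦ
  have h := hasSum_sum fun (i : Fin r) (_ : i ∈ Finset.univ) =>
    hasSum_indicator_shiftPairing (ae_all_iff.1 (hC (intVec k)) i) f g (activeScales A k)
  rw [shiftComponent, ← h.tsum_eq]
  simp only [indicator_finset_sum]

end Frequency

/-! ### Decay of the inverse powers of an expansive matrix. -/

section Expansive

open Filter Topology

/-- Gelfand's formula: the n-th root of ‖aⁿ‖ tends to the spectral radius, so ‖aⁿ‖ ≤ cⁿ eventually
for some c < 1. -/
theorem tendsto_norm_pow_of_spectrum {R : Type*} [NormedRing R] [NormedAlgebra ℂ R]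
    [CompleteSpace R] (a : R) (h : ∀ z ∈ spectrum ℂ a, ‖z‖ < 1) :
    Tendsto (fun n : ℕ => ‖a ^ n‖) atTop (𝓝 0) := by
  rcases subsingleton_or_nontrivial R with hR | hR
  · simp [Subsingleton.elim _ (0 : R)]
  have h1 : spectralRadius ℂ a < (1 : NNReal) :=
    spectrum.spectralRadius_lt_of_forall_lt a fun k hk => by
      rw [← NNReal.coe_lt_coe]
      exact h k hk
  obtain ⟨c, hac, hc1⟩ := ENNReal.lt_iff_exists_nnreal_btwn.1 h1
  have h2 := (spectrum.pow_nnnorm_pow_one_div_tendsto_nhds_spectralRadius a).eventually_lt_const hac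
  have hc : (c : ℝ) < 1 := by exact_mod_cast hc1
  refine squeeze_zero' (Eventually.of_forall fun n => norm_nonneg _) ?_
    (tendsto_pow_atTop_nhds_zero_of_lt_one c.2 hc)
  filter_upwards [h2, eventually_gt_atTop 0] with n hn hn0
  have hn' : (‖a ^ n‖₊ : ℝ≥0∞) ≤ (c : ℝ≥0∞) ^ n := by
    have h3 := ENNReal.rpow_le_rpow hn.le (z := (n : ℝ)) (by positivity)
    rwa [← ENNReal.rpow_mul, one_div, inv_mul_cancel₀ (by positivity), ENNReal.rpow_one,
      ENNReal.rpow_natCast] at h3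
  exact_mod_cast hn'

attribute [local instance] Matrix.linftyOpNormedRing Matrix.linftyOpNormedAlgebra

theorem norm_entry_le_linftyOpNorm {d : ℕ} (M : Matrix (Fin d) (Fin d) ℂ) (i j : Fin d) :
    ‖M i j‖ ≤ ‖M‖ := by
  rw [Matrix.linfty_opNorm_def, ← coe_nnnorm, NNReal.coe_le_coe]
  exact (Finset.single_le_sum (f := fun j => ‖M i j‖₊) (fun _ _ => zero_le)
    (Finset.mem_univ j)).trans (Finset.le_sup (f := fun i => ∑ j, ‖M i j‖₊) (Finset.mem_univ i))

theorem IsExpansive.tendsto_entry {d : ℕ} {A : GL (Fin d) ℝ} (hA : IsExpansive A) (i j : Fin d) :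
    Tendsto (fun n : ℕ => (A ^ (-(n : ℤ))).val i j) atTop (𝓝 0) := by
  set F : Matrix (Fin d) (Fin d) ℝ →+* Matrix (Fin d) (Fin d) ℂ := Complex.ofRealHom.mapMatrix
  set a : (Matrix (Fin d) (Fin d) ℂ)ˣ := Units.map (F : _ →* _) A with ha
  have h1 : ∀ z ∈ spectrum ℂ (a⁻¹).val, ‖z‖ < 1 := by
    intro z hz
    have hz' := spectrum.inv₀_mem_inv_iff.1 (by rwa [inv_inv] : (z⁻¹)⁻¹ ∈ _)
    have h2 : z⁻¹ ∈ spectrum ℂ (Matrix.toLin' a.val) := by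
      rwa [Matrix.spectrum_toLin']
    have h3 := hA _ (Module.End.hasEigenvalue_iff_mem_spectrum.2 h2)
    rw [norm_inv] at h3
    exact (one_lt_inv_iff₀.1 h3).2
  have : CompleteSpace (Matrix (Fin d) (Fin d) ℂ) := FiniteDimensional.complete ℂ _
  refine squeeze_zero_norm (fun n => ?_) (tendsto_norm_pow_of_spectrum _ h1)
  have h4 : (a⁻¹).val ^ n = F (A ^ (-(n : ℤ))).val := by
    rw [← Units.val_pow_eq_pow_val, inv_pow, ← zpow_natCast, ← zpow_neg, ha, ← map_zpow]
    rfl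
  rw [h4]
  refine le_trans (le_of_eq ?_) (norm_entry_le_linftyOpNorm _ i j)
  simp [F]

end Expansive

/-! ### Contraction estimates and divisibility by A*. -/

section Contraction

open Filter Topology

variable {d : ℕ}

/-- The negative powers of an expansive matrix tend to zero in operator norm. -/
theorem IsExpansive.exists_contraction {A : GL (Fin d) ℝ} (hA : IsExpansive A) :
    ∃ ε : ℕ → ℝ, Tendsto ε atTop (𝓝 0) ∧ (∀ n, 0 ≤ ε n) ∧
      ∀ (n : ℕ) x, ‖matAct (A ^ (-(n : ℤ))).val x‖ ≤ ε n * ‖x‖ := by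
  let L : Matrix (Fin d) (Fin d) ℝ →ₗ[ℝ] Rd d →L[ℝ] Rd d :=
    LinearMap.toContinuousLinearMap.toLinearMap ∘ₗ
      (Matrix.toEuclideanLin (𝕜 := ℝ) (m := Fin d) (n := Fin d)).toLinearMap
  have hL : Tendsto (fun n : ℕ => L (A ^ (-(n : ℤ))).val) atTop (𝓝 (L 0)) := by
    refine (LinearMap.continuous_of_finiteDimensional L).continuousAt.tendsto.comp ?_
    exact tendsto_pi_nhds.2 fun i => tendsto_pi_nhds.2 fun j => hA.tendsto_entry i j
  rw [map_zero] at hL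
  exact ⟨fun n => ‖L (A ^ (-(n : ℤ))).val‖, by simpa using hL.norm, fun n => norm_nonneg _,
    fun n x => (L (A ^ (-(n : ℤ))).val).le_opNorm x⟩

theorem IsExpansive.tendsto_abs_det {A : GL (Fin d) ℝ} (hA : IsExpansive A) (hd : d ≠ 0) :
    Tendsto (fun n : ℕ => |(A ^ (-(n : ℤ))).val.det|) atTop (𝓝 0) := by
  have h : Tendsto (fun n : ℕ => (A ^ (-(n : ℤ))).val.det) atTop
      (𝓝 (0 : Matrix (Fin d) (Fin d) ℝ).det) := by
    refine (continuous_id.matrix_det.continuousAt.tendsto).comp ?_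
    exact tendsto_pi_nhds.2 fun i => tendsto_pi_nhds.2 fun j => hA.tendsto_entry i j
  -- The zero matrix has determinant 0 only in positive dimension.
  have : Nonempty (Fin d) := ⟨⟨0, Nat.pos_of_ne_zero hd⟩⟩
  rw [Matrix.det_zero] at h
  simpa using h.abs

theorem det_zpow_neg (A : GL (Fin d) ℝ) (n : ℕ) :
    |(A ^ (-(n : ℤ))).val.det| = |A.val.det|⁻¹ ^ n := by
  have h : (A ^ (-(n : ℤ))).val.det * A.val.det ^ n = 1 := by
    rw [← Matrix.det_pow, ← Units.val_pow_eq_pow_val, ← zpow_natCast, ← Matrix.det_mul,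
      ← Units.val_mul, ← zpow_add, neg_add_cancel, zpow_zero, Units.val_one, Matrix.det_one]
  rw [inv_pow, ← abs_pow, ← abs_inv, eq_inv_of_mul_eq_one_left h]

theorem IsExpansive.one_lt_abs_det {A : GL (Fin d) ℝ} (hA : IsExpansive A) (hd : d ≠ 0) :
    1 < |A.val.det| := by
  have h := hA.tendsto_abs_det hd
  simp only [det_zpow_neg, tendsto_pow_atTop_nhds_zero_iff] at h
  rw [abs_inv, abs_abs] at h
  exact ((inv_lt_one_iff₀.1 h).resolve_left (not_le.2 (abs_det_pos A)))

/-- A nonzero integer vector is not infinitely divisible by `A^*`. -/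
theorem IsExpansive.exists_adjPow_not_mem_dualLattice {A : GL (Fin d) ℝ} (hA : IsExpansive A)
    {k : Fin d → ℤ} (hk : k ≠ 0) :
    ∃ (m : ℕ) (q : Fin d → ℤ), intVec q ∉ dualLattice A ∧ adjPow A m (intVec q) = intVec k := by
  by_contra! hcon
  have h1 : ∀ m : ℕ, ∃ q : Fin d → ℤ, adjPow A m (intVec q) = intVec k := by
    intro m
    induction m with
    | zero => exact ⟨k, adjPow_zero A _⟩
    | succ m ih =>
      obtain ⟨q, hq⟩ := ih
      obtain ⟨q', hq'⟩ : intVec q ∈ dualLattice A := by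
        by_contra h
        exact hcon m q h hq
      refine ⟨q', ?_⟩
      rw [Nat.cast_succ, ← adjPow_adjPow]
      exact (congrArg _ hq').trans hq
  obtain ⟨ε, hε, hε0, hεA⟩ := hA.exists_contraction
  have h2 : ∀ m : ℕ, ‖adjPow A (-(m : ℤ)) (intVec k)‖ ≤ ε m * ‖intVec k‖ := by
    intro m
    set v := adjPow A (-(m : ℤ)) (intVec k) with hv
    -- The contraction is known for A, not for its transpose; duality, ‖v‖² = ⟨A^(-m) v, k⟩,
    -- transfers it.
    have h3 : ‖v‖ * ‖v‖ ≤ (ε m * ‖intVec k‖) * ‖v‖ := by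
      rw [← real_inner_self_eq_norm_mul_norm]
      nth_rw 2 [hv]
      rw [adjPow, ← inner_matAct_left]
      refine (real_inner_le_norm _ _).trans ?_
      nlinarith [mul_le_mul_of_nonneg_right (hεA m v) (norm_nonneg (intVec k))]
    rcases (norm_nonneg v).eq_or_lt with h0 | h0
    · rw [← h0]; exact mul_nonneg (hε0 m) (norm_nonneg _)
    · exact le_of_mul_le_mul_right h3 h0
  have h4 : Tendsto (fun m => ε m * ‖intVec k‖) atTop (𝓝 0) := by
    simpa using hε.mul_const ‖intVec k‖
  obtain ⟨m, hm⟩ := (h4.eventually_lt_const one_pos).exists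
  obtain ⟨q, hq⟩ := h1 m
  have hq' : adjPow A (-(m : ℤ)) (intVec k) = intVec q := by
    rw [← hq, adjPow_adjPow, neg_add_cancel, adjPow_zero]
  have h5 : ‖intVec q‖ < 1 := hq' ▸ (h2 m).trans_lt hm
  -- An integer vector of norm less than 1 is zero, which contradicts k ≠ 0.
  have h6 : q = 0 := by
    ext i
    have h7 : |((q i : ℤ) : ℝ)| < 1 := (abs_coord_le_norm (intVec q) i).trans_lt h5
    exact Int.abs_lt_one_iff.1 (by exact_mod_cast h7)
  refine hk (intVec_injective ?_)
  rw [← hq, h6]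
  rw [intVec_zero]
  exact map_zero _

end Contraction

/-! ### Coefficients of functions supported in small balls. -/

section Concentration

open Filter Topology

variable {d : ℕ}

theorem enorm_sq_eq_lintegral (f : L2 d) : ‖f‖ₑ ^ 2 = ∫⁻ x, ‖f x‖ₑ ^ 2 := by
  have h := eLpNorm_nnreal_pow_eq_lintegral (f := f) (μ := (volume : Measure (Rd d))) (p := 2)
    two_ne_zero
  rw [Lp.enorm_def]
  simpa using h

/-- Cauchy–Schwarz, localized to a set outside of which one of the functions vanishes. -/
theorem enorm_inner_sq_le (x h : L2 d) {E : Set (Rd d)} (hE : MeasurableSet E)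
    (hh : ∀ᵐ y, y ∉ E → h y = 0) :
    ‖⟪x, h⟫_ℂ‖ₑ ^ 2 ≤ ‖h‖ₑ ^ 2 * ∫⁻ y in E, ‖x y‖ₑ ^ 2 := by
  have hm : MemLp (E.indicator x) 2 volume := (Lp.memLp x).indicator hE
  have h1 : ⟪x, h⟫_ℂ = ⟪hm.toLp, h⟫_ℂ := by
    rw [L2.inner_def, L2.inner_def]
    refine integral_congr_ae ?_
    filter_upwards [hm.coeFn_toLp, hh] with y h2 h3
    rw [h2]
    by_cases hy : y ∈ E
    · rw [Set.indicator_of_mem hy]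
    · rw [h3 hy, inner_zero_right, inner_zero_right]
  have h2 : ‖hm.toLp‖ₑ ^ 2 = ∫⁻ y in E, ‖x y‖ₑ ^ 2 := by
    rw [enorm_sq_eq_lintegral, ← lintegral_indicator hE]
    refine lintegral_congr_ae ?_
    filter_upwards [hm.coeFn_toLp] with y hy
    rw [hy]
    by_cases hy : y ∈ E <;> simp [hy]
  have h3 : ‖⟪hm.toLp, h⟫_ℂ‖ₑ ≤ ‖hm.toLp‖ₑ * ‖h‖ₑ := by
    rw [← ofReal_norm, ← ofReal_norm, ← ofReal_norm, ← ENNReal.ofReal_mul (norm_nonneg _)]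
    exact ENNReal.ofReal_le_ofReal (norm_inner_le_norm _ _)
  rw [h1, ← h2, mul_comm, ← mul_pow]
  gcongr

theorem setLIntegral_dilation_translation (B : GL (Fin d) ℝ) (a : Rd d) (ψ : L2 d) {E : Set (Rd d)}
    (hE : MeasurableSet E) :
    ∫⁻ x in E, ‖dilation B (translation a ψ) x‖ₑ ^ 2
      = ∫⁻ y, E.indicator (fun _ => 1) (matAct (B⁻¹).val (y + a)) * ‖ψ y‖ₑ ^ 2 := by
  have h1 : ∫⁻ x in E, ‖dilation B (translation a ψ) x‖ₑ ^ 2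
      = ∫⁻ x, ENNReal.ofReal |B.val.det| * (fun w => E.indicator (fun _ => 1) (matAct (B⁻¹).val w)
          * ‖ψ (w - a)‖ₑ ^ 2) (matAct B.val x) := by
    rw [← lintegral_indicator hE]
    refine lintegral_congr_ae ?_
    filter_upwards [dilation_ae B (translation a ψ),
      (quasiMeasurePreserving_matAct B).ae (translation_ae a ψ)] with x h2 h3
    by_cases hx : x ∈ E
    · simp only [Set.indicator_of_mem hx, matAct_inv_matAct, one_mul]
      rw [h2, h3, enorm_mul, mul_pow, enorm_sq_eq_ofReal, Complex.norm_real, Real.norm_eq_abs,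
        sq_abs, Real.sq_sqrt (abs_nonneg _)]
    · simp only [Set.indicator_of_notMem hx, matAct_inv_matAct, zero_mul, mul_zero]
  rw [h1, lintegral_const_mul' _ _ ENNReal.ofReal_ne_top,
    lintegral_comp_matAct B fun w => E.indicator (fun _ => 1) (matAct (B⁻¹).val w)
      * ‖ψ (w - a)‖ₑ ^ 2, ← mul_assoc,
    ← ENNReal.ofReal_mul (abs_nonneg _), mul_inv_cancel₀ (abs_det_pos B).ne', ENNReal.ofReal_one,
    one_mul, ← lintegral_add_right_eq_self _ a]
  simp

/-- Compared with the L²-normalized dilation, a weight |det B| remains. For B = A^(-m) it decays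
geometrically and replaces the counting over m needed in the affine case. -/
theorem setLIntegral_translation_dilationR (B : GL (Fin d) ℝ) (a : Rd d) (ψ : L2 d)
    {E : Set (Rd d)} (hE : MeasurableSet E) :
    ∫⁻ x in E, ‖translation a (dilationR B ψ) x‖ₑ ^ 2
      = ∫⁻ y, E.indicator (fun _ => ENNReal.ofReal |B.val.det|) (matAct (B⁻¹).val y + a)
          * ‖ψ y‖ₑ ^ 2 := by
  have h1 : ∫⁻ x in E, ‖translation a (dilationR B ψ) x‖ₑ ^ 2
      = ENNReal.ofReal |B.val.det|
        * ∫⁻ x in E, ‖dilation B (translation (matAct B.val a) ψ) x‖ₑ ^ 2 := by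
    rw [← lintegral_const_mul' _ _ ENNReal.ofReal_ne_top]
    refine lintegral_congr_ae (ae_restrict_of_ae ?_)
    rw [dilationR_eq, map_smul, translation_dilation]
    filter_upwards [Lp.coeFn_smul (Real.sqrt |B.val.det| : ℂ)
      (dilation B (translation (matAct B.val a) ψ))] with x hx
    rw [hx, Pi.smul_apply, smul_eq_mul, enorm_mul, mul_pow, enorm_sq_eq_ofReal (_ : ℂ),
      Complex.norm_real, Real.norm_eq_abs, sq_abs, Real.sq_sqrt (abs_nonneg _)]
  rw [h1, setLIntegral_dilation_translation _ _ _ hE,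
    ← lintegral_const_mul' _ _ ENNReal.ofReal_ne_top]
  refine lintegral_congr fun y => ?_
  rw [map_add, matAct_inv_matAct, ← mul_assoc]
  congr 1
  by_cases hy : matAct (B⁻¹).val y + a ∈ E
  · rw [Set.indicator_of_mem hy, Set.indicator_of_mem hy, mul_one]
  · rw [Set.indicator_of_notMem hy, Set.indicator_of_notMem hy, mul_zero]

/-- Shrinking balls around a point that is almost everywhere missed carry vanishing mass, provided
that one of the balls carries finite mass. -/
theorem tendsto_lintegral_tsum_closedBall {J : Type*} [Countable J] (w : J → ℝ≥0∞)
    {τ : J → Rd d → Rd d} (hτ : ∀ j, Measurable (τ j)) (β : Rd d) (ψ : L2 d) {ε : ℕ → ℝ}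
    (hε : Tendsto ε atTop (𝓝 0)) {ε₀ : ℝ} (hε₀ : 0 < ε₀) {K : ℝ≥0∞} (hK0 : K ≠ ∞)
    (hK : ∀ y, ∑' j, (Metric.closedBall β ε₀).indicator (fun _ => w j) (τ j y) ≤ K)
    (hne : ∀ j, ∀ᵐ y, τ j y ≠ β) :
    Tendsto (fun N => ∫⁻ y,
        ∑' j, (Metric.closedBall β (ε N)).indicator (fun _ => w j) (τ j y) * ‖ψ y‖ₑ ^ 2)
      atTop (𝓝 0) := by
  have hsmall : ∀ᶠ N in atTop, ε N ≤ ε₀ := (hε.eventually_lt_const hε₀).mono fun _ h => h.le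
  have hle : ∀ᶠ N in atTop, ∀ j y, (Metric.closedBall β (ε N)).indicator (fun _ => w j) (τ j y)
      ≤ (Metric.closedBall β ε₀).indicator (fun _ => w j) (τ j y) := by
    filter_upwards [hsmall] with N hN j y
    exact Set.indicator_le_indicator_of_subset (Metric.closedBall_subset_closedBall hN)
      (fun _ => zero_le) _
  have hψ : Measurable fun y => ‖ψ y‖ₑ ^ 2 := (Lp.stronglyMeasurable ψ).measurable.enorm.pow_const 2
  have key := tendsto_lintegral_filter_of_dominated_convergence (μ := (volume : Measure (Rd d)))
    (l := atTop) (F := fun N y => ∑' j, (Metric.closedBall β (ε N)).indicator (fun _ => w j) (τ j y)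
      * ‖ψ y‖ₑ ^ 2) (f := fun _ => 0) (fun y => K * ‖ψ y‖ₑ ^ 2) ?_ ?_ ?_ ?_
  · simpa using key
  · refine .of_forall fun N => Measurable.tsum fun j => Measurable.mul ?_ hψ
    exact (measurable_const.indicator Metric.isClosed_closedBall.measurableSet).comp (hτ j)
  · filter_upwards [hle] with N hN
    refine .of_forall fun y => ?_
    rw [ENNReal.tsum_mul_right]
    gcongr
    exact (ENNReal.tsum_le_tsum fun j => hN j y).trans (hK y)
  · rw [lintegral_const_mul _ hψ, ← enorm_sq_eq_lintegral]
    exact ENNReal.mul_ne_top hK0 (by simp)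
  · filter_upwards [ae_all_iff.2 hne] with y hy
    -- The sum over j is an integral for the counting measure, so dominated convergence applies a
    -- second time: each ball eventually misses τ j y ≠ β.
    let _ : MeasurableSpace J := ⊤
    have h1 := tendsto_lintegral_filter_of_dominated_convergence (μ := (Measure.count : Measure J))
      (l := atTop) (F := fun N j => (Metric.closedBall β (ε N)).indicator (fun _ => w j) (τ j y))
      (f := fun _ => 0) (fun j => (Metric.closedBall β ε₀).indicator (fun _ => w j) (τ j y))
      (.of_forall fun N => measurable_from_top) (by
        filter_upwards [hle] with N hN
        exact .of_forall fun j => hN j y)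
      (by rw [lintegral_count]; exact ne_top_of_le_ne_top hK0 (hK y))
      (.of_forall fun j => by
        refine tendsto_const_nhds.congr' ?_
        filter_upwards [hε.eventually_lt_const (dist_pos.2 (hy j))] with N hN
        rw [Set.indicator_of_notMem]
        simpa using hN)
    simp only [lintegral_count, tsum_zero] at h1
    simp only [ENNReal.tsum_mul_right]
    have h2 := ENNReal.Tendsto.mul_const (b := ‖ψ y‖ₑ ^ 2) h1 (.inr (by simp))
    simpa using h2

theorem ENNReal.tsum_indicator_le_card {ι : Type*} {S : Set ι} {s : Finset ι} (h : S ⊆ s) :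
    ∑' j, S.indicator (fun _ => (1 : ℝ≥0∞)) j ≤ s.card := by
  rw [tsum_eq_sum (s := s) fun j hj => Set.indicator_of_notMem (fun hS => hj (h hS)) _]
  refine (Finset.sum_le_card_nsmul s _ 1 fun j _ => ?_).trans (by simp)
  exact Set.indicator_le_self' (fun _ _ => zero_le) j

end Concentration

/-! ### How often lattice orbits meet a ball. -/

section Counting

open Filter Topology

variable {d : ℕ}

theorem norm_le_of_mem_closedBall_half {β u : Rd d} (h : u ∈ Metric.closedBall β (‖β‖ / 2)) :
    ‖β‖ / 2 ≤ ‖u‖ ∧ ‖u‖ ≤ 3 / 2 * ‖β‖ := by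
  rw [Metric.mem_closedBall, dist_eq_norm] at h
  have h1 := norm_sub_norm_le β u
  have h2 := norm_sub_norm_le u β
  rw [norm_sub_rev] at h1
  constructor <;> linarith

/-- Lattice orbits under an expansive matrix visit a ball away from the origin boundedly often. -/
theorem IsExpansive.exists_count_le {A : GL (Fin d) ℝ} (hA : IsExpansive A) {β : Rd d}
    (hβ : β ≠ 0) : ∃ K : ℝ≥0∞, K ≠ ∞ ∧ ∀ y, ∑' p : ℕ × (Fin d → ℤ),
      (Metric.closedBall β (‖β‖ / 2)).indicator (fun _ => (1 : ℝ≥0∞))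
        (matAct ((A ^ (-((p.1 + 1 : ℕ) : ℤ)))⁻¹).val (y + intVec p.2)) ≤ K := by
  obtain ⟨ε, hε, hε0, hεA⟩ := hA.exists_contraction
  obtain ⟨C, hC⟩ := hε.bddAbove_range
  have hC' : ∀ n, ε n ≤ C := fun n => hC ⟨n, rfl⟩
  have hC0 : 0 ≤ C := (hε0 0).trans (hC' 0)
  -- Norms in the ball lie between ‖β‖/2 and 3‖β‖/2, a ratio of 3. A contraction by more than 3
  -- therefore leaves the ball, and the visits of one orbit fit in a window of p₀ consecutive
  -- indices.
  obtain ⟨p₀, hp₀⟩ := eventually_atTop.1 (hε.eventually_lt_const (show (0 : ℝ) < 1 / 3 by norm_num))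
  have hβ0 : 0 < ‖β‖ := norm_pos_iff.2 hβ
  set E := Metric.closedBall β (‖β‖ / 2)
  set R := C * (3 / 2 * ‖β‖)
  obtain ⟨N, hN⟩ := exists_nat_gt (R + R)
  have hv : ∀ (m : ℕ) (v : Rd d), matAct ((A ^ (-((m + 1 : ℕ) : ℤ)))⁻¹).val v ∈ E → ‖v‖ ≤ R := by
    intro m v hm
    have h1 := hεA (m + 1) (matAct ((A ^ (-((m + 1 : ℕ) : ℤ)))⁻¹).val v)
    rw [matAct_matAct_inv] at h1
    exact h1.trans (mul_le_mul (hC' _) (norm_le_of_mem_closedBall_half hm).2 (norm_nonneg _) hC0)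
  have hgap : ∀ (m m' : ℕ) (v : Rd d), matAct ((A ^ (-((m + 1 : ℕ) : ℤ)))⁻¹).val v ∈ E →
      matAct ((A ^ (-((m' + 1 : ℕ) : ℤ)))⁻¹).val v ∈ E → m ≤ m' → m' < m + p₀ := by
    intro m m' v hm hm' hmm
    by_contra hcon
    have h1 := hεA (m' - m) (matAct ((A ^ (-((m' + 1 : ℕ) : ℤ)))⁻¹).val v)
    rw [← matAct_mul, ← Units.val_mul, ← zpow_neg, ← zpow_add,
      show -((m' - m : ℕ) : ℤ) + -(-((m' + 1 : ℕ) : ℤ)) = -(-((m + 1 : ℕ) : ℤ)) by omega] at h1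
    nth_rw 1 [zpow_neg] at h1
    have h2 := hp₀ (m' - m) (by omega)
    have h3 := (norm_le_of_mem_closedBall_half hm).1
    have h4 := (norm_le_of_mem_closedBall_half hm').2
    rw [← zpow_neg] at h4
    nlinarith [mul_le_mul_of_nonneg_left h4 (hε0 (m' - m))]
  have hm : ∀ v : Rd d, ∑' m : ℕ, E.indicator (fun _ => (1 : ℝ≥0∞))
      (matAct ((A ^ (-((m + 1 : ℕ) : ℤ)))⁻¹).val v)
        ≤ (Metric.closedBall 0 R).indicator (fun _ => (p₀ : ℝ≥0∞)) v := by
    intro v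
    set S : Set ℕ := {m | matAct ((A ^ (-((m + 1 : ℕ) : ℤ)))⁻¹).val v ∈ E} with hS
    have h0 : ∑' m : ℕ, E.indicator (fun _ => (1 : ℝ≥0∞))
        (matAct ((A ^ (-((m + 1 : ℕ) : ℤ)))⁻¹).val v) = ∑' m, S.indicator (fun _ => 1) m := rfl
    rw [h0]
    by_cases hne : ∃ m, m ∈ S
    · classical
      have h1 : S ⊆ (Finset.Ico (Nat.find hne) (Nat.find hne + p₀) : Finset ℕ) := by
        intro m hm
        have h2 := Nat.find_min' hne hm
        simpa using ⟨⟨_, le_rfl, hm⟩, hgap _ m v (Nat.find_spec hne) hm h2⟩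
      refine (ENNReal.tsum_indicator_le_card h1).trans ?_
      rw [Set.indicator_of_mem]
      · simp
      · simpa using hv _ v (Nat.find_spec hne)
    · rw [Set.eq_empty_iff_forall_notMem.2 (not_exists.1 hne)]
      simp
  refine ⟨p₀ * (latticeBox d N).card, ENNReal.mul_ne_top (by simp) (by simp), fun y => ?_⟩
  rw [ENNReal.tsum_prod_mk, ENNReal.tsum_comm]
  refine (ENNReal.tsum_le_tsum fun z => hm (y + intVec z)).trans ?_
  set Z : Set (Fin d → ℤ) := {z | y + intVec z ∈ Metric.closedBall (0 : Rd d) R} with hZ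
  have h1 : ∑' z : Fin d → ℤ, (Metric.closedBall 0 R).indicator (fun _ => (p₀ : ℝ≥0∞))
      (y + intVec z) = p₀ * ∑' z, Z.indicator (fun _ => 1) z := by
    rw [← ENNReal.tsum_mul_left]
    refine tsum_congr fun z => ?_
    by_cases hz : z ∈ Z
    · rw [Set.indicator_of_mem hz, mul_one]
      exact Set.indicator_of_mem (s := Metric.closedBall (0 : Rd d) R) hz _
    · rw [Set.indicator_of_notMem hz, mul_zero]
      exact Set.indicator_of_notMem (s := Metric.closedBall (0 : Rd d) R) hz _
  rw [h1]
  gcongr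
  by_cases hne : ∃ z₀, z₀ ∈ Z
  · obtain ⟨z₀, hz₀⟩ := hne
    classical
    -- Any two translates of y in the ball of radius R differ by an integer vector of norm at most
    -- 2R < N; this bounds their number independently of y.
    refine (ENNReal.tsum_indicator_le_card (s := (latticeBox d N).image fun k => k + z₀)
      fun z hz => ?_).trans ?_
    · refine Finset.mem_coe.2 (Finset.mem_image.2 ⟨z - z₀, mem_latticeBox_of_norm_le ?_, by simp⟩)
      have h2 : intVec (z - z₀) = (y + intVec z) - (y + intVec z₀) := by rw [intVec_sub]; abel
      rw [h2]
      rw [hZ, Set.mem_ofPred_eq, mem_closedBall_zero_iff] at hz hz₀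
      exact (norm_sub_le _ _).trans ((add_le_add hz hz₀).trans hN.le)
    · exact_mod_cast Finset.card_image_le
  · rw [Set.eq_empty_iff_forall_notMem.2 (not_exists.1 hne)]
    simp

/-- A ball of radius 1/4 contains at most one point of a translated integer lattice, so each m
contributes at most its weight, and the weights form a geometric series since |det A| > 1. -/
theorem IsExpansive.exists_weighted_count_le {A : GL (Fin d) ℝ} (hA : IsExpansive A) (hd : d ≠ 0)
    (β : Rd d) : ∃ K : ℝ≥0∞, K ≠ ∞ ∧ ∀ y, ∑' p : ℕ × (Fin d → ℤ),
      (Metric.closedBall β (1 / 4)).indicator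
        (fun _ => ENNReal.ofReal |(A ^ (-((p.1 + 1 : ℕ) : ℤ))).val.det|)
        (matAct ((A ^ (-((p.1 + 1 : ℕ) : ℤ)))⁻¹).val y + intVec p.2) ≤ K := by
  have h1 : |A.val.det|⁻¹ < 1 := inv_lt_one_of_one_lt₀ (hA.one_lt_abs_det hd)
  refine ⟨∑' m : ℕ, ENNReal.ofReal (|A.val.det|⁻¹ ^ (m + 1)), ?_, fun y => ?_⟩
  · have h2 : Summable fun m : ℕ => |A.val.det|⁻¹ ^ (m + 1) :=
      (summable_nat_add_iff 1).2 (summable_geometric_of_lt_one (by positivity) h1)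
    rw [← ENNReal.ofReal_tsum_of_nonneg (fun n => by positivity) h2]
    exact ENNReal.ofReal_ne_top
  · rw [ENNReal.tsum_prod_mk]
    refine ENNReal.tsum_le_tsum fun m => ?_
    simp only [det_zpow_neg]
    set v := matAct ((A ^ (-((m + 1 : ℕ) : ℤ)))⁻¹).val y
    by_cases hne : ∃ z, v + intVec z ∈ Metric.closedBall β (1 / 4)
    · obtain ⟨z₀, hz₀⟩ := hne
      rw [tsum_eq_single z₀]
      · exact Set.indicator_le_self' (fun _ _ => zero_le) _
      · intro z hz
        refine Set.indicator_of_notMem (fun hzE => hz ?_) _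
        rw [Metric.mem_closedBall] at hz₀ hzE
        have h3 : ‖intVec (z - z₀)‖ < 1 := by
          have h4 : intVec (z - z₀) = (v + intVec z) - (v + intVec z₀) := by rw [intVec_sub]; abel
          rw [h4, ← dist_eq_norm]
          linarith [dist_triangle_right (v + intVec z) (v + intVec z₀) β]
        ext i
        have h7 : |(((z - z₀) i : ℤ) : ℝ)| < 1 :=
          (abs_coord_le_norm (intVec (z - z₀)) i).trans_lt h3
        have h8 := Int.abs_lt_one_iff.1 (by exact_mod_cast h7 : |(z - z₀) i| < 1)
        simpa [sub_eq_zero] using h8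
    · rw [not_exists] at hne
      simp only [Set.indicator_of_notMem (hne _), tsum_zero, zero_le]

end Counting

/-! ### Negative levels vanish along concentrating functions. -/

section Layers

open Filter Topology

variable {d r : ℕ}

theorem lintegral_tsum_indicator_mul {J : Type*} [Countable J] (w : J → ℝ≥0∞)
    {τ : J → Rd d → Rd d} (hτ : ∀ j, Measurable (τ j)) {E : Set (Rd d)} (hE : MeasurableSet E)
    (ψ : L2 d) :
    ∫⁻ y, ∑' j, E.indicator (fun _ => w j) (τ j y) * ‖ψ y‖ₑ ^ 2
      = ∑' j, ∫⁻ y, E.indicator (fun _ => w j) (τ j y) * ‖ψ y‖ₑ ^ 2 := by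
  have hψ : Measurable fun y => ‖ψ y‖ₑ ^ 2 := (Lp.stronglyMeasurable ψ).measurable.enorm.pow_const 2
  have hm : ∀ j, Measurable fun y => E.indicator (fun _ => w j) (τ j y) := fun j =>
    (measurable_const.indicator hE).comp (hτ j)
  exact lintegral_tsum fun j => ((hm j).mul hψ).aemeasurable

theorem tsum_affineLayer_le (A : GL (Fin d) ℝ) (ψ h : L2 d) {E : Set (Rd d)}
    (hE : MeasurableSet E) (hh : ∀ᵐ y, y ∉ E → h y = 0) :
    ∑' m : ℕ, affineLayer A ψ (-((m + 1 : ℕ) : ℤ)) h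
      ≤ ‖h‖ₑ ^ 2 * ∫⁻ y, ∑' p : ℕ × (Fin d → ℤ), E.indicator (fun _ => (1 : ℝ≥0∞))
        (matAct ((A ^ (-((p.1 + 1 : ℕ) : ℤ)))⁻¹).val (y + intVec p.2)) * ‖ψ y‖ₑ ^ 2 := by
  rw [lintegral_tsum_indicator_mul (fun _ : ℕ × (Fin d → ℤ) => 1)
      (τ := fun p y => matAct ((A ^ (-((p.1 + 1 : ℕ) : ℤ)))⁻¹).val (y + intVec p.2))
      (fun p => (measurable_matAct _).comp (measurable_add_const _)) hE,
    ← ENNReal.tsum_mul_left, ENNReal.tsum_prod_mk]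
  simp only [affineLayer, besselSum, dilation_zpow]
  refine ENNReal.tsum_le_tsum fun m => ENNReal.tsum_le_tsum fun z => ?_
  rw [← setLIntegral_dilation_translation _ _ _ hE]
  exact enorm_inner_sq_le _ h hE hh

theorem tsum_quasiLayer_le (A : GL (Fin d) ℝ) (ψ h : L2 d) {E : Set (Rd d)}
    (hE : MeasurableSet E) (hh : ∀ᵐ y, y ∉ E → h y = 0) :
    ∑' m : ℕ, quasiLayer A ψ (-((m + 1 : ℕ) : ℤ)) h
      ≤ ‖h‖ₑ ^ 2 * ∫⁻ y, ∑' p : ℕ × (Fin d → ℤ), E.indicator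
        (fun _ => ENNReal.ofReal |(A ^ (-((p.1 + 1 : ℕ) : ℤ))).val.det|)
        (matAct ((A ^ (-((p.1 + 1 : ℕ) : ℤ)))⁻¹).val y + intVec p.2) * ‖ψ y‖ₑ ^ 2 := by
  rw [lintegral_tsum_indicator_mul
      (fun p : ℕ × (Fin d → ℤ) => ENNReal.ofReal |(A ^ (-((p.1 + 1 : ℕ) : ℤ))).val.det|)
      (τ := fun p y => matAct ((A ^ (-((p.1 + 1 : ℕ) : ℤ)))⁻¹).val y + intVec p.2)
      (fun p => (measurable_matAct _).add_const _) hE,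
    ← ENNReal.tsum_mul_left, ENNReal.tsum_prod_mk]
  simp only [quasiLayer, besselSum, dilationR_zpow]
  refine ENNReal.tsum_le_tsum fun m => ENNReal.tsum_le_tsum fun z => ?_
  rw [← setLIntegral_translation_dilationR _ _ _ hE]
  exact enorm_inner_sq_le _ h hE hh

/-- The function `f` vanishes almost everywhere outside of some ball. -/
def HasBoundedSupport (f : L2 d) : Prop := ∃ ρ : ℝ, ∀ᵐ x, ρ < ‖x‖ → f x = 0

theorem dense_hasBoundedSupport : Dense {f : L2 d | HasBoundedSupport f} := by
  intro f
  rw [Metric.mem_closure_iff]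
  intro ε hε
  obtain ⟨g, hgs, hg, -, hgm⟩ := (Lp.memLp f).exists_hasCompactSupport_eLpNorm_sub_le (by norm_num)
    (ε := ENNReal.ofReal (ε / 2)) (by simpa using hε)
  refine ⟨hgm.toLp, ?_, ?_⟩
  · obtain ⟨ρ, hρ⟩ := hgs.isCompact.isBounded.subset_closedBall (0 : Rd d)
    refine ⟨ρ, ?_⟩
    filter_upwards [hgm.coeFn_toLp] with x hx hxρ
    rw [hx]
    by_contra h0
    have := hρ (subset_tsupport g h0)
    rw [mem_closedBall_zero_iff] at this
    linarith
  · have h1 : edist f hgm.toLp ≤ ENNReal.ofReal (ε / 2) := by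
      rw [← Lp.toLp_coeFn f (Lp.memLp f), Lp.edist_toLp_toLp]
      exact hg
    rw [edist_dist, ENNReal.ofReal_le_ofReal_iff (by positivity)] at h1
    linarith

/-- D_A^N pulls the support back by A^(-N), which shrinks it to the origin; the translation moves it
to β. -/
theorem HasBoundedSupport.exists_support {A : GL (Fin d) ℝ} (hA : IsExpansive A) {f : L2 d}
    (hf : HasBoundedSupport f) (β : Rd d) :
    ∃ ε : ℕ → ℝ, Tendsto ε atTop (𝓝 0) ∧ ∀ N : ℕ, ∀ᵐ y, y ∉ Metric.closedBall β (ε N) →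
      translation β ((dilation A ^ (N : ℤ)) f) y = 0 := by
  obtain ⟨ρ, hρ⟩ := hf
  obtain ⟨ε, hε, hε0, hεA⟩ := hA.exists_contraction
  refine ⟨fun N => ε N * ρ, by simpa using hε.mul_const ρ, fun N => ?_⟩
  have h1 : ∀ᵐ x, x ∉ Metric.closedBall 0 (ε N * ρ) → (dilation A ^ (N : ℤ)) f x = 0 := by
    rw [dilation_zpow]
    filter_upwards [dilation_ae (A ^ (N : ℤ)) f, (quasiMeasurePreserving_matAct (A ^ (N : ℤ))).ae hρ]
      with x h2 h3 hx
    rw [h2, h3, mul_zero]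
    by_contra hcon
    push Not at hcon
    refine hx ?_
    rw [mem_closedBall_zero_iff]
    have h4 := hεA N (matAct (A ^ (N : ℤ)).val x)
    rw [zpow_neg, matAct_inv_matAct] at h4
    exact h4.trans (mul_le_mul_of_nonneg_left hcon (hε0 N))
  filter_upwards [translation_ae β ((dilation A ^ (N : ℤ)) f),
    (measurePreserving_sub_right volume β).quasiMeasurePreserving.ae h1] with y h2 h3 hy
  rw [h2]
  refine h3 fun h => hy ?_
  rwa [mem_closedBall_zero_iff, ← dist_eq_norm] at h

/-- In positive dimension points are null sets; in dimension 0 the statement is false. -/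
theorem ae_ne_of_injective (hd : d ≠ 0) {τ : Rd d → Rd d} (hτ : Function.Injective τ) (β : Rd d) :
    ∀ᵐ y, τ y ≠ β := by
  have : Nonempty (Fin d) := ⟨⟨0, Nat.pos_of_ne_zero hd⟩⟩
  have : Nontrivial (Rd d) := inferInstance
  have h : {y | τ y = β}.Subsingleton := fun x hx y hy => hτ (hx.trans hy.symm)
  have h0 : volume {y | τ y = β} = 0 := h.measure_zero volume
  rw [ae_iff]
  simpa using h0

theorem matAct_injective (A : GL (Fin d) ℝ) : Function.Injective (matAct A.val) :=
  (matActCLE A).injective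

theorem enorm_translation_dilation (A : GL (Fin d) ℝ) (β : Rd d) (n : ℤ) (f : L2 d) :
    ‖translation β ((dilation A ^ n) f)‖ₑ = ‖f‖ₑ := by
  rw [← ofReal_norm, norm_translation, dilation_zpow, norm_dilation, ofReal_norm]

theorem tendsto_tsum_quasiLayer {A : GL (Fin d) ℝ} (hA : IsExpansive A) (hd : d ≠ 0) (ψ : L2 d)
    {f : L2 d} (hf : HasBoundedSupport f) (β : Rd d) :
    Tendsto (fun N : ℕ => ∑' m : ℕ, quasiLayer A ψ (-((m + 1 : ℕ) : ℤ))
      (translation β ((dilation A ^ (N : ℤ)) f))) atTop (𝓝 0) := by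
  obtain ⟨ε, hε, hsupp⟩ := hf.exists_support hA β
  obtain ⟨K, hK0, hK⟩ := hA.exists_weighted_count_le hd β
  have h1 := tendsto_lintegral_tsum_closedBall
    (fun p : ℕ × (Fin d → ℤ) => ENNReal.ofReal |(A ^ (-((p.1 + 1 : ℕ) : ℤ))).val.det|)
    (τ := fun p y => matAct ((A ^ (-((p.1 + 1 : ℕ) : ℤ)))⁻¹).val y + intVec p.2)
    (fun p => (measurable_matAct _).add_const _) β ψ hε (by norm_num) hK0 hK
    (fun p => ae_ne_of_injective hd ((add_left_injective _).comp (matAct_injective _)) β)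
  have h2 := ENNReal.Tendsto.const_mul (a := ‖f‖ₑ ^ 2) h1 (.inr (by simp))
  rw [mul_zero] at h2
  refine tendsto_of_tendsto_of_tendsto_of_le_of_le tendsto_const_nhds h2 (fun _ => zero_le)
    fun N => ?_
  refine (tsum_quasiLayer_le A ψ _ Metric.isClosed_closedBall.measurableSet (hsupp N)).trans ?_
  rw [enorm_translation_dilation]

/-- Near β = 0 the orbit count is unbounded, because small vectors stay small for many powers of A.
There D_A^N instead pushes the levels into the tail of the convergent series of f; elsewhere
counting and dominated convergence apply. -/
theorem tendsto_tsum_affineLayer {A : GL (Fin d) ℝ} (hA : IsExpansive A) (hd : d ≠ 0) {ψ : L2 d}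
    (hψ : ∀ f, ∑' n : ℤ, affineLayer A ψ n f ≠ ∞)
    {f : L2 d} (hf : HasBoundedSupport f) (β : Rd d) :
    Tendsto (fun N : ℕ => ∑' m : ℕ, affineLayer A ψ (-((m + 1 : ℕ) : ℤ))
      (translation β ((dilation A ^ (N : ℤ)) f))) atTop (𝓝 0) := by
  rcases eq_or_ne β 0 with rfl | hβ
  · have hinj : Function.Injective fun m : ℕ => -((m + 1 : ℕ) : ℤ) := fun a b h => by
      simp only at h
      omega
    have h1 := ENNReal.tendsto_sum_nat_add (fun m : ℕ => affineLayer A ψ (-((m + 1 : ℕ) : ℤ)) f)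
      (ne_top_of_le_ne_top (hψ f) (ENNReal.tsum_comp_le_tsum_of_injective hinj
        fun n => affineLayer A ψ n f))
    refine h1.congr fun N => tsum_congr fun m => ?_
    rw [translation_zero, ← affineLayer_add_dilation A ψ f _ N]
    congr 1
    push_cast
    ring
  · obtain ⟨ε, hε, hsupp⟩ := hf.exists_support hA β
    obtain ⟨K, hK0, hK⟩ := hA.exists_count_le hβ
    have h1 := tendsto_lintegral_tsum_closedBall
      (fun p : ℕ × (Fin d → ℤ) => (1 : ℝ≥0∞))
      (τ := fun p y => matAct ((A ^ (-((p.1 + 1 : ℕ) : ℤ)))⁻¹).val (y + intVec p.2))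
      (fun p => (measurable_matAct _).comp (measurable_add_const _)) β ψ hε
      (by have := norm_pos_iff.2 hβ; positivity) hK0 hK
      (fun p => ae_ne_of_injective hd ((matAct_injective _).comp (add_left_injective _)) β)
    have h2 := ENNReal.Tendsto.const_mul (a := ‖f‖ₑ ^ 2) h1 (.inr (by simp))
    rw [mul_zero] at h2
    refine tendsto_of_tendsto_of_tendsto_of_le_of_le tendsto_const_nhds h2 (fun _ => zero_le)
      fun N => ?_
    refine (tsum_affineLayer_le A ψ _ Metric.isClosed_closedBall.measurableSet (hsupp N)).trans ?_
    rw [enorm_translation_dilation]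

end Layers

/-! ### The difference of the two Gramians. -/

section Difference

open Filter Topology

variable {d r : ℕ}

theorem ENNReal.mul_le_sq_add_sq (a b : ℝ≥0∞) : a * b ≤ a ^ 2 + b ^ 2 := by
  rcases le_total a b with h | h
  · calc a * b ≤ b * b := by gcongr
      _ = b ^ 2 := (sq b).symm
      _ ≤ _ := le_add_self
  · calc a * b ≤ a * a := by gcongr
      _ = a ^ 2 := (sq a).symm
      _ ≤ _ := le_self_add

theorem enorm_inner_comm {H : Type*} [NormedAddCommGroup H] [InnerProductSpace ℂ H] (a b : H) :
    ‖⟪a, b⟫_ℂ‖ₑ = ‖⟪b, a⟫_ℂ‖ₑ := by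
  rw [← ofReal_norm, norm_inner_symm, ofReal_norm]

theorem tsum_level_prod (u : ℕ → (Fin d → ℤ) × Fin r → ℝ≥0∞) :
    ∑' (m) (p), u m p = ∑ i, ∑' (m) (z), u m (z, i) := by
  rw [← tsum_fintype (L := .unconditional _) (fun i => ∑' (m) (z), u m (z, i)),
    ENNReal.tsum_comm (f := fun i m => ∑' z, u m (z, i))]
  refine tsum_congr fun m => ?_
  rw [ENNReal.tsum_prod_mk, ENNReal.tsum_comm]

/-- The mixed Gramians of the affine and of the quasi-affine systems differ only by the layers of
negative index. -/
theorem enorm_inner_sub_mixedGramian_le {A : GL (Fin d) ℝ} {Ψ Φ : Fin r → L2 d}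
    (hΨ : IsBesselSeq (affineSystem A Ψ)) (hΦ : IsBesselSeq (affineSystem A Φ))
    (hΨq : IsBesselSeq (quasiAffineSystem A Ψ)) (hΦq : IsBesselSeq (quasiAffineSystem A Φ))
    (f g : L2 d) :
    ‖⟪g, (mixedGramian hΨ hΦ - mixedGramian hΨq hΦq) f⟫_ℂ‖ₑ
      ≤ ∑ i, (∑' m : ℕ, affineLayer A (Ψ i) (-((m + 1 : ℕ) : ℤ)) f
        + ∑' m : ℕ, affineLayer A (Φ i) (-((m + 1 : ℕ) : ℤ)) g
        + (∑' m : ℕ, quasiLayer A (Ψ i) (-((m + 1 : ℕ) : ℤ)) f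
        + ∑' m : ℕ, quasiLayer A (Φ i) (-((m + 1 : ℕ) : ℤ)) g)) := by
  have h := (hasSum_inner_mixedGramian hΨ hΦ f g).sub (hasSum_inner_mixedGramian hΨq hΦq f g)
  set D : ℤ × (Fin d → ℤ) × Fin r → ℂ := fun p =>
    ⟪affineSystem A Ψ p, f⟫_ℂ * ⟪g, affineSystem A Φ p⟫_ℂ
      - ⟪quasiAffineSystem A Ψ p, f⟫_ℂ * ⟪g, quasiAffineSystem A Φ p⟫_ℂ with hD
  rw [sub_apply, inner_sub_right, ← h.tsum_eq]
  refine enorm_tsum_le_tsum_enorm.trans ?_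
  have hinj : Function.Injective fun m : ℕ => -((m + 1 : ℕ) : ℤ) := fun a b h => by
    simp only at h
    omega
  have h0 : ∀ n : ℤ, 0 ≤ n → ∀ p, D (n, p) = 0 := by
    intro n hn p
    simp [hD, affineSystem, quasiAffineSystem, hn]
  rw [ENNReal.tsum_prod_mk, ← hinj.tsum_eq (f := fun n => ∑' p, ‖D (n, p)‖ₑ), tsum_level_prod]
  · refine Finset.sum_le_sum fun i _ => ?_
    rw [← ENNReal.tsum_add, ← ENNReal.tsum_add, ← ENNReal.tsum_add]
    refine ENNReal.tsum_le_tsum fun m => ?_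
    rw [affineLayer, besselSum, affineLayer, besselSum, quasiLayer, besselSum, quasiLayer,
      besselSum, ← ENNReal.tsum_add, ← ENNReal.tsum_add, ← ENNReal.tsum_add]
    refine ENNReal.tsum_le_tsum fun z => ?_
    have hneg : ¬ (0 : ℤ) ≤ -((m + 1 : ℕ) : ℤ) := by omega
    simp only [hD, affineSystem, quasiAffineSystem, if_neg hneg]
    refine (enorm_sub_le).trans (add_le_add ?_ ?_)
    · rw [enorm_mul, enorm_inner_comm g]
      exact ENNReal.mul_le_sq_add_sq _ _
    · rw [enorm_mul, enorm_inner_comm g]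
      exact ENNReal.mul_le_sq_add_sq _ _
  · intro n hn
    by_contra hcon
    have hn0 : 0 ≤ n := by
      by_contra hneg
      exact hcon ⟨(-n - 1).toNat, by simp only; omega⟩
    exact hn (by simp [h0 n hn0])

theorem tendsto_zero_of_dense {H : Type*} [NormedAddCommGroup H] {l : ℕ → H → ℂ} {C : ℝ}
    (hl : ∀ N f f', ‖l N f - l N f'‖ ≤ C * ‖f - f'‖) {s : Set H} (hs : Dense s)
    (h : ∀ f ∈ s, Tendsto (fun N => l N f) atTop (𝓝 0)) (f : H) :
    Tendsto (fun N => l N f) atTop (𝓝 0) := by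
  rw [Metric.tendsto_atTop]
  intro ε hε
  have hC : 0 < |C| + 1 := by positivity
  obtain ⟨f', hf', hff⟩ := Metric.mem_closure_iff.1 (hs f) (ε / 2 / (|C| + 1)) (by positivity)
  obtain ⟨N₀, hN₀⟩ := Metric.tendsto_atTop.1 (h f' hf') (ε / 2) (by positivity)
  refine ⟨N₀, fun N hN => ?_⟩
  have h1 := hN₀ N hN
  have h2 := hl N f f'
  rw [dist_eq_norm, lt_div_iff₀ hC] at hff
  rw [dist_zero_right] at h1 ⊢
  have h3 := norm_sub_norm_le (l N f) (l N f')
  have h4 : C * ‖f - f'‖ ≤ ‖f - f'‖ * (|C| + 1) := by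
    nlinarith [norm_nonneg (f - f'), le_abs_self C]
  linarith

theorem mixedGramian_congr {H J : Type*} [NormedAddCommGroup H] [InnerProductSpace ℂ H]
    [CompleteSpace H] {x y x' y' : J → H} (hx : IsBesselSeq x) (hy : IsBesselSeq y)
    (hx' : IsBesselSeq x') (hy' : IsBesselSeq y') (h : x = x') (h' : y = y') :
    mixedGramian hx hy = mixedGramian hx' hy' := by
  subst h h'
  rfl

/-- Concentration has no meaning on a single point, but there every matrix is the identity and every
translation is trivial. -/
theorem quasiAffineSystem_eq_of_dim_zero (hd : d = 0) (A : GL (Fin d) ℝ) (Ψ : Fin r → L2 d) :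
    affineSystem A Ψ = quasiAffineSystem A Ψ := by
  subst hd
  funext p
  have hA : A = 1 := Units.ext (Subsingleton.elim _ _)
  have h1 : ∀ (z : Fin 0 → ℤ) (f : L2 0), translation (intVec z) f = f := by
    intro z f
    rw [Subsingleton.elim z 0, intVec_zero, translation_zero]
  have h2 : ∀ f : L2 0, dilationR (1 : GL (Fin 0) ℝ) f = f := by
    intro f
    rw [dilationR_eq, dilation_one]
    simp
  rw [affineSystem, quasiAffineSystem, hA]
  split_ifs
  · rfl
  · rw [dilation_zpow, dilationR_zpow, one_zpow, h1, h1, dilation_one, h2]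

/-- The difference of the two mixed Gramians vanishes asymptotically on concentrated functions. -/
theorem tendsto_inner_sub_mixedGramian {A : GL (Fin d) ℝ} (hA : IsExpansive A)
    {Ψ Φ : Fin r → L2 d}
    (hΨ : IsBesselSeq (affineSystem A Ψ)) (hΦ : IsBesselSeq (affineSystem A Φ))
    (hΨq : IsBesselSeq (quasiAffineSystem A Ψ)) (hΦq : IsBesselSeq (quasiAffineSystem A Φ))
    (β : Rd d) (f g : L2 d) :
    Tendsto (fun N : ℕ => ⟪translation β ((dilation A ^ (N : ℤ)) g),
      (mixedGramian hΨ hΦ - mixedGramian hΨq hΦq)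
        (translation β ((dilation A ^ (N : ℤ)) f))⟫_ℂ) atTop (𝓝 0) := by
  rcases eq_or_ne d 0 with hd | hd
  · rw [mixedGramian_congr hΨ hΦ hΨq hΦq (quasiAffineSystem_eq_of_dim_zero hd A Ψ)
      (quasiAffineSystem_eq_of_dim_zero hd A Φ)]
    simp
  set R := mixedGramian hΨ hΦ - mixedGramian hΨq hΦq with hR
  set U : ℕ → L2 d → L2 d := fun N f => translation β ((dilation A ^ (N : ℤ)) f) with hU
  have hUn : ∀ N f, ‖U N f‖ = ‖f‖ := fun N f => by
    rw [hU]
    simp only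
    rw [norm_translation, dilation_zpow, norm_dilation]
  have hUs : ∀ N f f', U N f - U N f' = U N (f - f') := fun N f f' => by
    simp only [hU, map_sub]
  have hfin : ∀ {Ψ : Fin r → L2 d}, IsBesselSeq (affineSystem A Ψ) → ∀ i f,
      ∑' n : ℤ, affineLayer A (Ψ i) n f ≠ ∞ := by
    intro Ψ h i f
    obtain ⟨C, hC⟩ := (isBesselSeq_iff _).1 h
    refine ne_top_of_le_ne_top (b := C * ‖f‖ₑ ^ 2) (ENNReal.mul_ne_top (by simp) (by simp)) ?_
    refine le_trans ?_ (hC f)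
    rw [besselSum_affineSystem]
    exact Finset.single_le_sum (f := fun i => ∑' n : ℤ, affineLayer A (Ψ i) n f)
      (fun _ _ => zero_le) (Finset.mem_univ i)
  -- Each `U N` is an isometry, so the forms are Lipschitz in f uniformly in N; likewise in g below.
  -- Bounded supports therefore suffice.
  refine tendsto_zero_of_dense (l := fun N f => ⟪U N g, R (U N f)⟫_ℂ) (C := ‖g‖ * ‖R‖)
    (fun N f f' => ?_) dense_hasBoundedSupport (fun f hf => ?_) f
  · rw [← inner_sub_right, ← map_sub, hUs]
    refine (norm_inner_le_norm _ _).trans ?_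
    rw [hUn, mul_assoc]
    gcongr
    exact (R.le_opNorm _).trans (by rw [hUn])
  refine tendsto_zero_of_dense (l := fun N g => ⟪U N g, R (U N f)⟫_ℂ) (C := ‖R‖ * ‖f‖)
    (fun N g g' => ?_) dense_hasBoundedSupport (fun g hg => ?_) g
  · rw [← inner_sub_left, hUs]
    refine (norm_inner_le_norm _ _).trans ?_
    rw [hUn, mul_comm]
    gcongr
    exact (R.le_opNorm _).trans (by rw [hUn])
  have h1 := tendsto_finsetSum (Finset.univ : Finset (Fin r)) fun i _ =>
    ((tendsto_tsum_affineLayer hA hd (hfin hΨ i) hf β).add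
      (tendsto_tsum_affineLayer hA hd (hfin hΦ i) hg β)).add
    ((tendsto_tsum_quasiLayer hA hd (Ψ i) hf β).add
      (tendsto_tsum_quasiLayer hA hd (Φ i) hg β))
  simp only [add_zero, Finset.sum_const_zero] at h1
  have h2 : Tendsto (fun N => ‖⟪U N g, R (U N f)⟫_ℂ‖ₑ) atTop (𝓝 0) :=
    tendsto_of_tendsto_of_tendsto_of_le_of_le tendsto_const_nhds h1 (fun _ => zero_le)
      fun N => enorm_inner_sub_mixedGramian_le hΨ hΦ hΨq hΦq (U N f) (U N g)
  exact tendsto_zero_iff_enorm_tendsto_zero.2 h2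

end Difference

/-! ### Commutation with translations and dilations. -/

section Commutation

open Filter Topology

variable {d r : ℕ}

theorem translation_eq_iff_inner {S : L2 d →L[ℂ] L2 d} (β : Rd d) :
    S * translation β = translation β * S
      ↔ ∀ f g, ⟪translation β g, S (translation β f)⟫_ℂ = ⟪g, S f⟫_ℂ := by
  constructor
  · intro h f g
    have h1 : S (translation β f) = translation β (S f) := DFunLike.congr_fun h f
    rw [h1, inner_translation_translation]
  · intro h
    ext1 f
    refine ext_inner_left ℂ fun v => ?_
    have hv : translation β (translation (-β) v) = v := by
      rw [translation_translation, add_neg_cancel, translation_zero]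
    rw [← hv]
    change ⟪translation β (translation (-β) v), S (translation β f)⟫_ℂ
      = ⟪translation β (translation (-β) v), translation β (S f)⟫_ℂ
    rw [h, inner_translation_translation]

/-- Equality of two continuous sesquilinear quantities may be tested on band-limited functions. -/
theorem inner_eq_of_isBandLimited {P Q : L2 d → L2 d} {U V : L2 d → L2 d} (hP : Continuous P)
    (hQ : Continuous Q) (hU : Continuous U) (hV : Continuous V)
    (h : ∀ f g, IsBandLimited f → IsBandLimited g → ⟪U g, P f⟫_ℂ = ⟪V g, Q f⟫_ℂ) (f g : L2 d) :
    ⟪U g, P f⟫_ℂ = ⟪V g, Q f⟫_ℂ := by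
  have h1 : ∀ f, IsBandLimited f → ∀ g, ⟪U g, P f⟫_ℂ = ⟪V g, Q f⟫_ℂ := fun f hf g =>
    dense_isBandLimited.induction (fun g hg => h f g hf hg)
      (isClosed_eq (hU.inner continuous_const) (hV.inner continuous_const)) g
  exact dense_isBandLimited.induction (fun f hf => h1 f hf g)
    (isClosed_eq (continuous_const.inner hP) (continuous_const.inner hQ)) f

theorem affineSystem_succ (A : GL (Fin d) ℝ) (Ψ : Fin r → L2 d) (n : ℤ) (p : (Fin d → ℤ) × Fin r) :
    affineSystem A Ψ (n + 1, p) = dilation A (affineSystem A Ψ (n, p)) := by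
  rw [affineSystem, add_comm, zpow_add, zpow_one]
  rfl

/-- D_A permutes the affine system by raising n, so the affine Gramian commutes with it
unconditionally. The quasi-affine system has no such symmetry. -/
theorem inner_mixedGramian_dilation {A : GL (Fin d) ℝ} {Ψ Φ : Fin r → L2 d}
    (hΨ : IsBesselSeq (affineSystem A Ψ)) (hΦ : IsBesselSeq (affineSystem A Φ)) (f g : L2 d) :
    ⟪dilation A g, mixedGramian hΨ hΦ (dilation A f)⟫_ℂ = ⟪g, mixedGramian hΨ hΦ f⟫_ℂ := by
  let e : ℤ × (Fin d → ℤ) × Fin r ≃ ℤ × (Fin d → ℤ) × Fin r :=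
    (Equiv.addRight (1 : ℤ)).prodCongr (Equiv.refl _)
  have h1 := (e.hasSum_iff.2 (hasSum_inner_mixedGramian hΨ hΦ (dilation A f) (dilation A g)))
  refine h1.unique ((hasSum_inner_mixedGramian hΨ hΦ f g).of_eq (fun p => ?_) rfl)
  obtain ⟨n, p⟩ := p
  change ⟪affineSystem A Ψ (n + 1, p), dilation A f⟫_ℂ * ⟪dilation A g, affineSystem A Φ (n + 1, p)⟫_ℂ
    = _
  rw [affineSystem_succ, affineSystem_succ, inner_dilation_dilation, inner_dilation_dilation]

theorem inner_dilation_npow {A : GL (Fin d) ℝ} {S : L2 d →L[ℂ] L2 d}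
    (hS : ∀ f g, ⟪dilation A g, S (dilation A f)⟫_ℂ = ⟪g, S f⟫_ℂ) (N : ℕ) (f g : L2 d) :
    ⟪(dilation A ^ (N : ℤ)) g, S ((dilation A ^ (N : ℤ)) f)⟫_ℂ = ⟪g, S f⟫_ℂ := by
  induction N with
  | zero =>
    rw [Nat.cast_zero, zpow_zero]
    rfl
  | succ N ih =>
    rw [Nat.cast_succ, add_comm, zpow_add, zpow_one]
    exact (hS _ _).trans ih

theorem exists_intVec_near (d : ℕ) : ∃ R : ℝ, ∀ v : Rd d, ∃ z : Fin d → ℤ, ‖v - intVec z‖ ≤ R := by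
  obtain ⟨R, hR⟩ := norm_le_of_mem_cell (d := d) (k := 0)
  refine ⟨R, fun v => ?_⟩
  obtain ⟨z, hz⟩ := Set.mem_iUnion.1 ((iUnion_cells (d := d)).symm ▸ Set.mem_univ v)
  exact ⟨z, hR _ (by simpa using hz)⟩

/-- An operator that commutes with an expansive dilation and with all integer translations commutes
with all translations. -/
theorem commute_translation_of_dilation {A : GL (Fin d) ℝ} (hA : IsExpansive A)
    {S : L2 d →L[ℂ] L2 d} (hS : ∀ f g, ⟪dilation A g, S (dilation A f)⟫_ℂ = ⟪g, S f⟫_ℂ)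
    (h : ∀ z : Fin d → ℤ, S * translation (intVec z) = translation (intVec z) * S) (β : Rd d) :
    S * translation β = translation β * S := by
  have h1 : ∀ (N : ℕ) (z : Fin d → ℤ) (f g : L2 d),
      ⟪translation (matAct (A ^ (-(N : ℤ))).val (intVec z)) g,
        S (translation (matAct (A ^ (-(N : ℤ))).val (intVec z)) f)⟫_ℂ = ⟪g, S f⟫_ℂ := by
    intro N z f g
    have hsurj : ∀ f : L2 d, (dilation A ^ (N : ℤ)) ((dilation A ^ (N : ℤ)).symm f) = f :=
      fun f => (dilation A ^ (N : ℤ)).apply_symm_apply f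
    have htr : ∀ f : L2 d, translation (matAct (A ^ (-(N : ℤ))).val (intVec z))
        ((dilation A ^ (N : ℤ)) f) = (dilation A ^ (N : ℤ)) (translation (intVec z) f) := by
      intro f
      rw [dilation_zpow, dilation_translation, zpow_neg]
    rw [← hsurj f, ← hsurj g, htr, htr, inner_dilation_npow hS, inner_dilation_npow hS]
    exact (translation_eq_iff_inner _).1 (h z) _ _
  obtain ⟨ε, hε, hε0, hεA⟩ := hA.exists_contraction
  obtain ⟨R, hR⟩ := exists_intVec_near d
  -- Integer points at bounded distance from A^N β; scaled back by A^(-N) they converge to β, and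
  -- strong continuity of translations finishes.
  choose z hz using fun N : ℕ => hR (matAct (A ^ (N : ℤ)).val β)
  have hlim : Tendsto (fun N : ℕ => matAct (A ^ (-(N : ℤ))).val (intVec (z N))) atTop (𝓝 β) := by
    rw [tendsto_iff_norm_sub_tendsto_zero]
    refine squeeze_zero (fun _ => norm_nonneg _) (fun N => ?_)
      (by simpa using hε.mul_const R : Tendsto (fun N => ε N * R) atTop (𝓝 0))
    have h2 : matAct (A ^ (-(N : ℤ))).val (intVec (z N)) - β
        = -matAct (A ^ (-(N : ℤ))).val (matAct (A ^ (N : ℤ)).val β - intVec (z N)) := by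
      rw [map_sub]
      nth_rw 2 [zpow_neg]
      rw [matAct_inv_matAct, neg_sub]
    rw [h2, norm_neg]
    exact (hεA N _).trans (mul_le_mul_of_nonneg_left (hz N) (hε0 N))
  refine (translation_eq_iff_inner β).2 fun f g => ?_
  have hc : Continuous fun α : Rd d => ⟪translation α g, S (translation α f)⟫_ℂ :=
    (continuous_translation g).inner (S.continuous.comp (continuous_translation f))
  refine tendsto_nhds_unique ((hc.tendsto β).comp hlim) ?_
  exact tendsto_const_nhds.congr fun N => (h1 N (z N) f g).symm

theorem fourier_L2_injective {f g : L2 d} (h : (𝓕 f : L2 d) =ᵐ[volume] (𝓕 g : L2 d)) : f = g :=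
  (Lp.fourierTransformₗᵢ (Rd d) ℂ).injective (Lp.ext h)

theorem IsFourierMultiplier.commute_translation {S : L2 d →L[ℂ] L2 d} {s : Rd d → ℂ}
    (hS : IsFourierMultiplier S s) (β : Rd d) : S * translation β = translation β * S := by
  ext1 f
  refine fourier_L2_injective ?_
  change (𝓕 (S (translation β f)) : L2 d) =ᵐ[volume] (𝓕 (translation β (S f)) : L2 d)
  filter_upwards [hS.2 (translation β f), hS.2 f, fourier_translation_ae β f,
    fourier_translation_ae β (S f)] with ξ h1 h2 h3 h4
  rw [h1, h3, h4, h2]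
  ring

theorem IsFourierMultiplier.commute_dilation {A : GL (Fin d) ℝ} {S : L2 d →L[ℂ] L2 d}
    {s : Rd d → ℂ} (hS : IsFourierMultiplier S s) (hs : ∀ ξ, s (adjPow A (-1) ξ) = s ξ)
    (f : L2 d) : S (dilation A f) = dilation A (S f) := by
  refine fourier_L2_injective ?_
  have h0 := fun f => fourier_dilation_zpow_ae A 1 f
  simp only [zpow_one] at h0
  filter_upwards [hS.2 (dilation A f), h0 f, h0 (S f),
    (quasiMeasurePreserving_adjPow A (-1)).ae (hS.2 f)] with ξ h1 h2 h3 h4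
  rw [h1, h2, h3, h4, hs]
  ring

end Commutation

/-! ### Symbols of the components and the main implications. -/

section Symbols

open Filter Topology

variable {d r : ℕ}

/-- The symbol of the frequency-shift component at a shift outside of `A^* ℤᵈ`. -/
def shiftSymbol (A : GL (Fin d) ℝ) (Ψ Φ : Fin r → L2 d) (q : Fin d → ℤ) (ξ : Rd d) : ℂ :=
  ∑ i, ∑' j : ℕ, crossTerm A (Φ i) (Ψ i) j ξ (ξ + intVec q)

/-- The symbol of the frequency-shift component at the shift zero. -/
def diagonalSymbol (A : GL (Fin d) ℝ) (Ψ Φ : Fin r → L2 d) (ξ : Rd d) : ℂ :=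
  ∑ i, ∑' j : ℤ, crossTerm A (Ψ i) (Φ i) j ξ ξ

theorem memLp_top_of_enorm_le {s : Rd d → ℂ} (hs : Measurable s) {C : ℝ≥0∞} (hC : C ≠ ∞)
    (h : ∀ᵐ ξ, ‖s ξ‖ₑ ≤ C) : MemLp s ∞ volume :=
  ⟨hs.aestronglyMeasurable, (essSup_le_of_ae_le C h).trans_lt hC.lt_top⟩

theorem memLp_tsum_crossTerm {A : GL (Fin d) ℝ} {Ψ Φ : Fin r → L2 d}
    (hΨ : HasCalderonBound A Ψ) (hΦ : HasCalderonBound A Φ) {ι : Type*} [Countable ι] {e : ι → ℤ}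
    (he : Function.Injective e) (a : Rd d) (i : Fin r) :
    MemLp (fun ξ => ∑' j, crossTerm A (Φ i) (Ψ i) (e j) ξ (ξ + a)) ∞ volume := by
  obtain ⟨C, hC⟩ := hΨ.crossTerm hΦ
  refine memLp_top_of_enorm_le (Measurable.tsum fun j =>
    measurable_crossTerm A (Φ i) (Ψ i) (e j) a) (C := C) (by simp) ?_
  filter_upwards [hC a] with ξ hξ
  exact enorm_tsum_le_tsum_enorm.trans ((ENNReal.tsum_comp_le_tsum_of_injective
    he fun j : ℤ => ‖crossTerm A (Φ i) (Ψ i) j ξ (ξ + a)‖ₑ).trans (hξ i))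

theorem memLp_shiftSymbol {A : GL (Fin d) ℝ} {Ψ Φ : Fin r → L2 d} (hΨ : HasCalderonBound A Ψ)
    (hΦ : HasCalderonBound A Φ) (q : Fin d → ℤ) : MemLp (shiftSymbol A Ψ Φ q) ∞ volume :=
  memLp_finsetSum _ fun i _ => memLp_tsum_crossTerm hΨ hΦ (Nat.cast_injective (R := ℤ)) (intVec q) i

theorem memLp_diagonalSymbol {A : GL (Fin d) ℝ} {Ψ Φ : Fin r → L2 d} (hΨ : HasCalderonBound A Ψ)
    (hΦ : HasCalderonBound A Φ) : MemLp (diagonalSymbol A Ψ Φ) ∞ volume :=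
  memLp_finsetSum _ fun i _ => by
    simpa only [add_zero, id] using memLp_tsum_crossTerm hΦ hΨ Function.injective_id 0 i

/-- The sum runs over all integer scales, hence is invariant under a shift of scale; for this reason
the multiplier commutes with D_A. -/
theorem diagonalSymbol_adjPow (A : GL (Fin d) ℝ) (Ψ Φ : Fin r → L2 d) (n : ℤ) (ξ : Rd d) :
    diagonalSymbol A Ψ Φ (adjPow A n ξ) = diagonalSymbol A Ψ Φ ξ := by
  refine Finset.sum_congr rfl fun i _ => ?_
  rw [← (Equiv.addRight n).tsum_eq fun j => crossTerm A (Ψ i) (Φ i) j ξ ξ]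
  refine tsum_congr fun j => ?_
  simp only [crossTerm, adjPow_adjPow, Equiv.coe_addRight]

theorem conj_crossTerm (A : GL (Fin d) ℝ) (φ ψ : L2 d) (j : ℤ) (ξ : Rd d) :
    conj (crossTerm A φ ψ j ξ ξ) = crossTerm A ψ φ j ξ ξ := by
  simp [crossTerm, mul_comm]

theorem intVec_ne_zero_of_not_mem_dualLattice {A : GL (Fin d) ℝ} {q : Fin d → ℤ}
    (hq : intVec q ∉ dualLattice A) : q ≠ 0 := by
  rintro rfl
  refine hq ⟨0, ?_⟩
  simp [adjPow]

/-- A positive active scale would exhibit q as A* of an integer vector. This explains the sum over j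
≥ 0, with j = -n, in condition 6. -/
theorem activeScales_of_not_mem_dualLattice {A : GL (Fin d) ℝ} (hint : IsIntegralMatrix A)
    {q : Fin d → ℤ} (hq : intVec q ∉ dualLattice A) :
    activeScales A q = Set.range fun j : ℕ => -(j : ℤ) := by
  ext n
  constructor
  · rintro (h | ⟨l, hl⟩)
    · exact ⟨n.natAbs, by simp only; omega⟩
    · by_contra hn
      have hn1 : 1 ≤ n := by
        by_contra h
        exact hn ⟨n.natAbs, by simp only; omega⟩
      obtain ⟨m, hm⟩ := adjPow_natCast_intVec hint (n - 1).toNat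
      refine hq ⟨m l, ?_⟩
      simp only
      rw [← hm, adjPow_adjPow, ← hl]
      congr 1
      omega
  · rintro ⟨j, rfl⟩
    exact Or.inl (by simp)

theorem activeScales_zero (A : GL (Fin d) ℝ) : activeScales A 0 = Set.univ := by
  refine Set.eq_univ_of_forall fun n => Or.inr ⟨0, ?_⟩
  simp [adjPow]

theorem shiftComponent_eq_integral_shiftSymbol {A : GL (Fin d) ℝ} (hint : IsIntegralMatrix A)
    {Ψ Φ : Fin r → L2 d} (hΨ : HasCalderonBound A Ψ) (hΦ : HasCalderonBound A Φ) (f g : L2 d)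
    {q : Fin d → ℤ} (hq : intVec q ∉ dualLattice A) :
    shiftComponent A Ψ Φ f g q = ∫ ξ, conj (shiftSymbol A Ψ Φ q ξ)
      * ((𝓕 f : L2 d) (ξ + intVec q) * conj ((𝓕 g : L2 d) ξ)) := by
  have hinj : Function.Injective fun j : ℕ => -(j : ℤ) := fun a b h => by
    simp only at h
    omega
  have h1 : ∀ i ξ, ∑' n : ℤ, (activeScales A q).indicator
      (fun n => conj (crossTerm A (Φ i) (Ψ i) (-n) ξ (ξ + intVec q))) n
        = conj (∑' j : ℕ, crossTerm A (Φ i) (Ψ i) j ξ (ξ + intVec q)) := by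
    intro i ξ
    rw [activeScales_of_not_mem_dualLattice hint hq, Complex.conj_tsum,
      ← hinj.tsum_eq Set.support_indicator_subset]
    refine tsum_congr fun j => ?_
    rw [Set.indicator_of_mem (show -(j : ℤ) ∈ Set.range fun j : ℕ => -(j : ℤ) from ⟨j, rfl⟩), neg_neg]
  rw [shiftComponent_eq_integral hΨ hΦ, ← integral_finsetSum]
  · simp only [h1, shiftSymbol, map_sum, Finset.sum_mul]
  · intro i _
    simp only [h1]
    exact (integrable_shift_mul_conj f g (intVec q)).mul_of_top_right
      (memLp_tsum_crossTerm hΨ hΦ (Nat.cast_injective (R := ℤ)) (intVec q) i).star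

theorem shiftComponent_zero_eq_integral {A : GL (Fin d) ℝ}
    {Ψ Φ : Fin r → L2 d} (hΨ : HasCalderonBound A Ψ) (hΦ : HasCalderonBound A Φ) (f g : L2 d) :
    shiftComponent A Ψ Φ f g 0 = ∫ ξ, diagonalSymbol A Ψ Φ ξ
      * ((𝓕 f : L2 d) ξ * conj ((𝓕 g : L2 d) ξ)) := by
  have h1 : ∀ i ξ, ∑' n : ℤ, (activeScales A 0).indicator
      (fun n => conj (crossTerm A (Φ i) (Ψ i) (-n) ξ ξ)) n
        = ∑' j : ℤ, crossTerm A (Ψ i) (Φ i) j ξ ξ := by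
    intro i ξ
    rw [← (Equiv.neg ℤ).tsum_eq]
    refine tsum_congr fun j => ?_
    rw [activeScales_zero, Set.indicator_of_mem (Set.mem_univ _), conj_crossTerm]
    simp
  have h2 := integrable_shift_mul_conj f g 0
  simp only [add_zero] at h2
  rw [shiftComponent_eq_integral hΨ hΦ, ← integral_finsetSum]
  · simp only [intVec_zero, add_zero, h1, diagonalSymbol, Finset.sum_mul]
  · intro i _
    simp only [intVec_zero, add_zero, h1]
    refine h2.mul_of_top_right ?_
    simpa only [add_zero, id] using memLp_tsum_crossTerm hΦ hΨ Function.injective_id 0 i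

/-- Taking g^ to be the indicator of a bounded set E and f^ that of E + q isolates the integral of
the conjugate symbol over E; all of these vanish. -/
theorem shiftSymbol_ae_eq_zero {A : GL (Fin d) ℝ} (hint : IsIntegralMatrix A)
    {Ψ Φ : Fin r → L2 d} (hΨ : HasCalderonBound A Ψ) (hΦ : HasCalderonBound A Φ)
    {q : Fin d → ℤ} (hq : intVec q ∉ dualLattice A)
    (h : ∀ f g, IsBandLimited f → IsBandLimited g → shiftComponent A Ψ Φ f g q = 0) :
    ∀ᵐ ξ, shiftSymbol A Ψ Φ q ξ = 0 := by
  have hs := memLp_shiftSymbol hΨ hΦ q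
  have hmem : ∀ E : Set (Rd d), MeasurableSet E → ∀ R, (∀ ξ ∈ E, ‖ξ‖ ≤ R) →
      ∃ f : L2 d, IsBandLimited f ∧ (𝓕 f : L2 d) =ᵐ[volume] E.indicator fun _ => (1 : ℂ) := by
    intro E hE R hR
    refine exists_isBandLimited (C := 1) (R := R) (measurable_const.indicator hE) (fun ξ => ?_)
      fun ξ hξ => Set.indicator_of_notMem (fun hm => absurd (hR ξ hm) (not_le.2 hξ)) _
    by_cases hm : ξ ∈ E <;> simp [hm]
  have key : ∀ E : Set (Rd d), MeasurableSet E → ∀ R, (∀ ξ ∈ E, ‖ξ‖ ≤ R) →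
      ∫ ξ in E, conj (shiftSymbol A Ψ Φ q ξ) = 0 := by
    intro E hE R hR
    obtain ⟨g, hg, hgE⟩ := hmem E hE R hR
    obtain ⟨f, hf, hfE⟩ := hmem ((fun ξ => ξ - intVec q) ⁻¹' E)
      (measurable_sub_const (intVec q) hE) (R + ‖intVec q‖) fun ξ hξ => by
        have := hR _ hξ
        linarith [norm_sub_norm_le ξ (intVec q)]
    rw [← h f g hf hg, shiftComponent_eq_integral_shiftSymbol hint hΨ hΦ f g hq,
      ← integral_indicator hE]
    refine integral_congr_ae ?_
    filter_upwards [ae_comp_add_right hfE (intVec q), hgE] with ξ h1 h2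
    rw [h1, h2]
    by_cases hξ : ξ ∈ E <;> simp [hξ]
  have hball : ∀ N : ℕ, ∀ᵐ ξ : Rd d, ξ ∈ Metric.closedBall (0 : Rd d) N →
      shiftSymbol A Ψ Φ q ξ = 0 := by
    intro N
    set B := Metric.closedBall (0 : Rd d) N with hB
    have hBm : MeasurableSet B := Metric.isClosed_closedBall.measurableSet
    have hfin : IsFiniteMeasure ((volume : Measure (Rd d)).restrict B) :=
      ⟨by simpa using measure_closedBall_lt_top⟩
    have hint' : Integrable (fun ξ => conj (shiftSymbol A Ψ Φ q ξ)) (volume.restrict B) :=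
      memLp_one_iff_integrable.1 ((hs.star.restrict B).mono_exponent le_top)
    have h1 := hint'.ae_eq_zero_of_forall_setIntegral_eq_zero fun s hs _ => by
      rw [Measure.restrict_restrict hs]
      exact key _ (hs.inter hBm) N fun ξ hξ => mem_closedBall_zero_iff.1 hξ.2
    filter_upwards [(ae_restrict_iff' hBm).1 h1] with ξ h2 h3
    simpa using h2 h3
  filter_upwards [ae_all_iff.2 hball] with ξ hξ
  obtain ⟨N, hN⟩ := exists_nat_ge ‖ξ‖
  exact hξ N (mem_closedBall_zero_iff.2 hN)

/-- If the symbols of all nontrivial shifts vanish, then the quasi-affine mixed Gramian is a Fourier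
multiplier. -/
theorem isFourierMultiplier_quasiGramian {A : GL (Fin d) ℝ} (hexp : IsExpansive A)
    (hint : IsIntegralMatrix A) {Ψ Φ : Fin r → L2 d}
    (hΨ : IsBesselSeq (quasiAffineSystem A Ψ)) (hΦ : IsBesselSeq (quasiAffineSystem A Φ))
    (h : ∀ q : Fin d → ℤ, intVec q ∉ dualLattice A → ∀ᵐ ξ, shiftSymbol A Ψ Φ q ξ = 0) :
    IsFourierMultiplier (mixedGramian hΨ hΦ) (diagonalSymbol A Ψ Φ) := by
  have cΨ := hasCalderonBound hΨ
  have cΦ := hasCalderonBound hΦ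
  have hq : ∀ q : Fin d → ℤ, intVec q ∉ dualLattice A → ∀ f g,
      shiftComponent A Ψ Φ f g q = 0 := by
    intro q hq f g
    rw [shiftComponent_eq_integral_shiftSymbol hint cΨ cΦ f g hq]
    refine integral_eq_zero_of_ae ?_
    filter_upwards [h q hq] with ξ hξ
    simp [hξ]
  -- Divide k by A* as often as possible and undo the corresponding power of the dilation on f and
  -- g.
  have hk : ∀ k : Fin d → ℤ, k ≠ 0 → ∀ f g, shiftComponent A Ψ Φ f g k = 0 := by
    intro k hk f g
    obtain ⟨m, q, hqd, hqk⟩ := hexp.exists_adjPow_not_mem_dualLattice hk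
    have hsurj : ∀ f : L2 d, (dilation A ^ (m : ℤ)) ((dilation A ^ (m : ℤ)).symm f) = f :=
      fun f => (dilation A ^ (m : ℤ)).apply_symm_apply f
    rw [← hsurj f, ← hsurj g, shiftComponent_dilation hint hqk]
    exact hq q hqd _ _
  have hs := memLp_diagonalSymbol cΨ cΦ
  refine ⟨hs, ?_⟩
  have h1 : ∀ f g : L2 d, ⟪(𝓕 g : L2 d), (𝓕 (mixedGramian hΨ hΦ f) : L2 d)⟫_ℂ
      = ⟪(𝓕 g : L2 d), mulOp _ hs (𝓕 f : L2 d)⟫_ℂ := by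
    refine inner_eq_of_isBandLimited (P := fun f => (𝓕 (mixedGramian hΨ hΦ f) : L2 d))
      (Q := fun f => mulOp _ hs (𝓕 f : L2 d)) (U := fun g => (𝓕 g : L2 d))
      (V := fun g => (𝓕 g : L2 d))
      (continuous_fourier_L2.comp (mixedGramian hΨ hΦ).continuous)
      ((mulOp _ hs).continuous.comp continuous_fourier_L2) continuous_fourier_L2
      continuous_fourier_L2 fun f g hf hg => ?_
    obtain ⟨S, hS⟩ := exists_finset_shiftPairing_eq_zero A Ψ Φ hf hg
    rw [Lp.inner_fourier_eq, inner_quasiGramian hint hΨ hΦ hf hg hS,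
      Finset.sum_eq_single 0 (fun k _ hk0 => hk k hk0 f g)
        (fun h0 => shiftComponent_eq_zero hS h0),
      shiftComponent_zero_eq_integral cΨ cΦ, L2.inner_def]
    refine integral_congr_ae ?_
    filter_upwards [mulOp_ae _ hs (𝓕 f : L2 d)] with ξ hξ
    rw [hξ, RCLike.inner_apply]
    ring
  intro f
  have h2 : (𝓕 (mixedGramian hΨ hΦ f) : L2 d) = mulOp _ hs (𝓕 f : L2 d) := by
    refine ext_inner_left ℂ fun v => ?_
    have hv : (𝓕 ((Lp.fourierTransformₗᵢ (Rd d) ℂ).symm v) : L2 d) = v :=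
      (Lp.fourierTransformₗᵢ (Rd d) ℂ).apply_symm_apply v
    rw [← hv]
    exact h1 f _
  rw [h2]
  exact mulOp_ae _ hs _

/-- If the affine mixed Gramian commutes with all translations, then the shift components of the
quasi-affine one vanish outside of `A^* ℤᵈ`. -/
theorem shiftComponent_eq_zero_of_affine_commute {A : GL (Fin d) ℝ} (hexp : IsExpansive A)
    (hint : IsIntegralMatrix A) {Ψ Φ : Fin r → L2 d}
    (hΨ : IsBesselSeq (affineSystem A Ψ)) (hΦ : IsBesselSeq (affineSystem A Φ))
    (hΨq : IsBesselSeq (quasiAffineSystem A Ψ)) (hΦq : IsBesselSeq (quasiAffineSystem A Φ))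
    (h : ∀ β : Rd d, mixedGramian hΨ hΦ * translation β = translation β * mixedGramian hΨ hΦ)
    {q : Fin d → ℤ} (hq : q ≠ 0) {f g : L2 d} (hf : IsBandLimited f) (hg : IsBandLimited g) :
    shiftComponent A Ψ Φ f g q = 0 := by
  set θ := mixedGramian hΨ hΦ
  set θq := mixedGramian hΨq hΦq
  choose k hk using fun N : ℕ => (adjPow_natCast_intVec hint N).imp fun m hm => hm q
  have hk0 : ∀ N, k N q ≠ 0 := fun N h0 => hq (intVec_injective (adjPow_injective A N (by
    rw [hk, h0, intVec_zero]
    simp [adjPow])))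
  set u : ℕ → Rd d → ℂ := fun N β => ⟪translation β ((dilation A ^ (N : ℤ)) g),
    (θ - θq) (translation β ((dilation A ^ (N : ℤ)) f))⟫_ℂ with hu
  have huc : ∀ N, Continuous (u N) := fun N =>
    (continuous_translation _).inner ((θ - θq).continuous.comp (continuous_translation _))
  have hub : ∀ N β, ‖u N β‖ ≤ ‖g‖ * (‖θ - θq‖ * ‖f‖) := by
    intro N β
    have hn : ∀ f : L2 d, ‖translation β ((dilation A ^ (N : ℤ)) f)‖ = ‖f‖ := fun f => by
      rw [norm_translation, dilation_zpow, norm_dilation]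
    refine (norm_inner_le_norm _ _).trans ?_
    rw [hn]
    gcongr
    exact ((θ - θq).le_opNorm _).trans (by rw [hn])
  have hfin : IsFiniteMeasure ((volume : Measure (Rd d)).restrict (unitCube d)) :=
    ⟨by simp [volume_unitCube]⟩
  -- The left side does not depend on N. On the right θ^q = θ - (θ - θ^q), and the part of θ is
  -- constant in β, so its Fourier coefficient at A*^N q ≠ 0 vanishes.
  have h1 : ∀ N, shiftComponent A Ψ Φ f g q
      = -∫ β in unitCube d, expo (intVec (k N q)) β * u N β := by
    intro N
    rw [← shiftComponent_dilation hint (hk N) Ψ Φ f g,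
      ← integral_inner_quasiGramian hint hΨq hΦq (hf.dilation_zpow A N) (hg.dilation_zpow A N),
      ← integral_neg]
    have h2 : ∀ β, expo (intVec (k N q)) β * ⟪translation β ((dilation A ^ (N : ℤ)) g),
        θq (translation β ((dilation A ^ (N : ℤ)) f))⟫_ℂ
        = expo (intVec (k N q)) β
            * ⟪(dilation A ^ (N : ℤ)) g, θ ((dilation A ^ (N : ℤ)) f)⟫_ℂ
          + -(expo (intVec (k N q)) β * u N β) := by
      intro β
      rw [← (translation_eq_iff_inner β).1 (h β), hu]
      simp only [sub_apply, inner_sub_right]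
      ring
    refine (integral_congr_ae (.of_forall h2)).trans ?_
    rw [integral_add, integral_mul_const, integral_unitCube_expo, if_neg (hk0 N), zero_mul,
      zero_add]
    · exact (Integrable.of_bound (continuous_expo _).aestronglyMeasurable 1
        (.of_forall fun β => (norm_expo _ _).le)).mul_const _
    · refine (Integrable.of_bound ((continuous_expo _).mul (huc N)).aestronglyMeasurable
        (‖g‖ * (‖θ - θq‖ * ‖f‖)) (.of_forall fun β => ?_)).neg
      rw [Pi.mul_apply, norm_mul, norm_expo, one_mul]
      exact hub N β
  have h3 : Tendsto (fun N => ∫ β in unitCube d, expo (intVec (k N q)) β * u N β) atTop (𝓝 0) := by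
    have := tendsto_integral_of_dominated_convergence (μ := volume.restrict (unitCube d))
      (F := fun N β => expo (intVec (k N q)) β * u N β) (f := fun _ => 0)
      (fun _ => ‖g‖ * (‖θ - θq‖ * ‖f‖))
      (fun N => ((continuous_expo _).mul (huc N)).aestronglyMeasurable) (integrable_const _)
      (fun N => .of_forall fun β => by
        rw [norm_mul, norm_expo, one_mul]
        exact hub N β)
      (.of_forall fun β => by
        rw [tendsto_zero_iff_norm_tendsto_zero]
        simp only [norm_mul, norm_expo, one_mul]
        exact tendsto_zero_iff_norm_tendsto_zero.1
          (tendsto_inner_sub_mixedGramian hexp hΨ hΦ hΨq hΦq β f g))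
    simpa using this
  have h4 := h3.neg
  rw [neg_zero] at h4
  exact tendsto_nhds_unique (tendsto_const_nhds.congr h1) h4

/-- The form is then constant in β and has no nonzero Fourier coefficient besides the one at 0. -/
theorem shiftComponent_eq_zero_of_quasi_commute {A : GL (Fin d) ℝ} (hint : IsIntegralMatrix A)
    {Ψ Φ : Fin r → L2 d}
    (hΨq : IsBesselSeq (quasiAffineSystem A Ψ)) (hΦq : IsBesselSeq (quasiAffineSystem A Φ))
    (h : ∀ β : Rd d, mixedGramian hΨq hΦq * translation β
      = translation β * mixedGramian hΨq hΦq)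
    {q : Fin d → ℤ} (hq : q ≠ 0) {f g : L2 d} (hf : IsBandLimited f) (hg : IsBandLimited g) :
    shiftComponent A Ψ Φ f g q = 0 := by
  rw [← integral_inner_quasiGramian hint hΨq hΦq hf hg]
  simp only [(translation_eq_iff_inner _).1 (h _)]
  rw [integral_mul_const, integral_unitCube_expo, if_neg hq, zero_mul]

/-- All frequency shifts are integer vectors, so an integer translation multiplies every component
by 1. -/
theorem quasiGramian_commute_intVec {A : GL (Fin d) ℝ} (hint : IsIntegralMatrix A)
    {Ψ Φ : Fin r → L2 d}
    (hΨ : IsBesselSeq (quasiAffineSystem A Ψ)) (hΦ : IsBesselSeq (quasiAffineSystem A Φ))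
    (z : Fin d → ℤ) :
    mixedGramian hΨ hΦ * translation (intVec z) = translation (intVec z) * mixedGramian hΨ hΦ := by
  refine (translation_eq_iff_inner _).2 ?_
  refine inner_eq_of_isBandLimited
    (P := fun f => mixedGramian hΨ hΦ (translation (intVec z) f)) (Q := mixedGramian hΨ hΦ)
    (U := translation (intVec z)) (V := id)
    ((mixedGramian hΨ hΦ).continuous.comp (translation _).continuous)
    (mixedGramian hΨ hΦ).continuous (translation _).continuous continuous_id fun f g hf hg => ?_
  obtain ⟨S, hS⟩ := exists_finset_shiftPairing_eq_zero A Ψ Φ hf hg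
  rw [inner_quasiGramian_translation hint hΨ hΦ hf hg hS, id, inner_quasiGramian hint hΨ hΦ hf hg hS]
  refine Finset.sum_congr rfl fun k _ => ?_
  rw [← intVec_neg, expo_intVec_intVec, one_mul]

/-- If the quasi-affine mixed Gramian commutes with the dilation, then it agrees with the affine
one. -/
theorem mixedGramian_eq_of_commute_dilation {A : GL (Fin d) ℝ} (hexp : IsExpansive A)
    {Ψ Φ : Fin r → L2 d}
    (hΨ : IsBesselSeq (affineSystem A Ψ)) (hΦ : IsBesselSeq (affineSystem A Φ))
    (hΨq : IsBesselSeq (quasiAffineSystem A Ψ)) (hΦq : IsBesselSeq (quasiAffineSystem A Φ))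
    (h : ∀ f, mixedGramian hΨq hΦq (dilation A f) = dilation A (mixedGramian hΨq hΦq f)) :
    mixedGramian hΨ hΦ = mixedGramian hΨq hΦq := by
  have hR : ∀ f g, ⟪dilation A g, (mixedGramian hΨ hΦ - mixedGramian hΨq hΦq) (dilation A f)⟫_ℂ
      = ⟪g, (mixedGramian hΨ hΦ - mixedGramian hΨq hΦq) f⟫_ℂ := by
    intro f g
    rw [sub_apply, sub_apply, inner_sub_right, inner_sub_right, inner_mixedGramian_dilation, h,
      inner_dilation_dilation]
  rw [← sub_eq_zero]
  ext1 f
  refine ext_inner_left ℂ fun g => ?_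
  -- Concentration at β = 0 suffices: the form is independent of N by invariance under D_A, hence
  -- equals its limit 0.
  have h1 := tendsto_inner_sub_mixedGramian hexp hΨ hΦ hΨq hΦq 0 f g
  simp only [translation_zero, inner_dilation_npow hR] at h1
  rw [tendsto_nhds_unique tendsto_const_nhds h1, zero_apply, inner_zero_right]

end Symbols

/-! ### Assembly of the equivalences. -/

section Equivalence

variable {d r : ℕ}

theorem mem_centralizer_range_translation {ι : Type*} {v : ι → Rd d} {S : L2 d →L[ℂ] L2 d} :
    S ∈ Set.centralizer (Set.range fun i => translation (v i))
      ↔ ∀ i, S * translation (v i) = translation (v i) * S := by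
  simp [Set.mem_centralizer_iff, eq_comm]

end Equivalence

end

theorem theoremT {d r : ℕ} (A : GL (Fin d) ℝ) (hexp : IsExpansive A) (hint : IsIntegralMatrix A)
    (Ψ Φ : Fin r → L2 d)
    (hΨ : IsBesselSeq (affineSystem A Ψ)) (hΦ : IsBesselSeq (affineSystem A Φ)) :
    ∃ (hΨq : IsBesselSeq (quasiAffineSystem A Ψ)) (hΦq : IsBesselSeq (quasiAffineSystem A Φ)),
      -- the series in the conditions below converge absolutely almost everywhere
      (∀ q : Fin d → ℤ, ∀ᵐ ξ : Rd d, ∀ i,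
        Summable fun j : ℕ => crossTerm A (Φ i) (Ψ i) j ξ (ξ + intVec q)) ∧
      (∀ᵐ ξ : Rd d, ∀ i, Summable fun j : ℤ => crossTerm A (Ψ i) (Φ i) j ξ ξ) ∧
      List.TFAE [
        mixedGramian hΨ hΦ ∈
          Set.centralizer (Set.range fun z : Fin d → ℤ => translation (intVec z)),
        mixedGramian hΨq hΦq ∈
          Set.centralizer {(dilation A : L2 d →L[ℂ] L2 d)},
        mixedGramian hΨ hΦ ∈ Set.centralizer (Set.range fun β : Rd d => translation β),
        mixedGramian hΨq hΦq ∈ Set.centralizer (Set.range fun β : Rd d => translation β),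
        mixedGramian hΨ hΦ = mixedGramian hΨq hΦq,
        ∀ q : Fin d → ℤ, intVec q ∉ dualLattice A →
          ∀ᵐ ξ : Rd d, ∑ i, ∑' j : ℕ, crossTerm A (Φ i) (Ψ i) j ξ (ξ + intVec q) = 0,
        IsFourierMultiplier (mixedGramian hΨ hΦ)
          (fun ξ => ∑ i, ∑' j : ℤ, crossTerm A (Ψ i) (Φ i) j ξ ξ),
        IsFourierMultiplier (mixedGramian hΨq hΦq)
          (fun ξ => ∑ i, ∑' j : ℤ, crossTerm A (Ψ i) (Φ i) j ξ ξ)] := by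
  have hΨq := isBesselSeq_quasiAffineSystem hint hΨ
  have hΦq := isBesselSeq_quasiAffineSystem hint hΦ
  have cΨ := hasCalderonBound hΨq
  have cΦ := hasCalderonBound hΦq
  refine ⟨hΨq, hΦq, fun q => ?_, ?_, ?_⟩
  · obtain ⟨C, hC⟩ := cΨ.crossTerm cΦ
    filter_upwards [hC (intVec q)] with ξ hξ i
    exact (summable_of_tsum_enorm_le ENNReal.coe_ne_top (hξ i)).comp_injective
      (i := fun j : ℕ => (j : ℤ)) Nat.cast_injective
  · obtain ⟨C, hC⟩ := cΦ.crossTerm cΨ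
    filter_upwards [hC 0] with ξ hξ i
    simp only [add_zero] at hξ
    exact summable_of_tsum_enorm_le ENNReal.coe_ne_top (hξ i)
  rw [mem_centralizer_range_translation, mem_centralizer_range_translation,
    mem_centralizer_range_translation]
  -- The main cycle is 1 → 3 → 6 → 8 → 2 → 5 → 1; condition 4 hangs on it by 8 → 4 → 6, and
  -- condition 7 by 8 → 7 → 3.
  tfae_have 1 → 3 := fun h =>
    commute_translation_of_dilation hexp (inner_mixedGramian_dilation hΨ hΦ) h
  tfae_have 3 → 6 := fun h q hq => shiftSymbol_ae_eq_zero hint cΨ cΦ hq fun f g hf hg =>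
    shiftComponent_eq_zero_of_affine_commute hexp hint hΨ hΦ hΨq hΦq h
      (intVec_ne_zero_of_not_mem_dualLattice hq) hf hg
  tfae_have 4 → 6 := fun h q hq => shiftSymbol_ae_eq_zero hint cΨ cΦ hq fun f g hf hg =>
    shiftComponent_eq_zero_of_quasi_commute hint hΨq hΦq h
      (intVec_ne_zero_of_not_mem_dualLattice hq) hf hg
  tfae_have 6 → 8 := fun h => isFourierMultiplier_quasiGramian hexp hint hΨq hΦq h
  tfae_have 8 → 4 := fun h => h.commute_translation
  tfae_have 8 → 2 := fun h => by
    rintro _ rfl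
    ext1 f
    exact (h.commute_dilation (diagonalSymbol_adjPow A Ψ Φ (-1)) f).symm
  tfae_have 2 → 5 := fun h => mixedGramian_eq_of_commute_dilation hexp hΨ hΦ hΨq hΦq fun f =>
    (DFunLike.congr_fun (h _ rfl) f).symm
  tfae_have 5 → 1 := fun h => by
    rw [h]
    exact quasiGramian_commute_intVec hint hΨq hΦq
  tfae_have 8 → 7 := fun h => by
    rw [tfae_2_to_5 (tfae_8_to_2 h)]
    exact h
  tfae_have 7 → 3 := fun h => h.commute_translation
  tfae_finish
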